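/- Let $\times$ be the $7$-dimensional cross product on $\mathbb{R}^7$, bilinear and skew-symmetric, given on the canonical basis by $e_1\times e_2=e_3$, $e_1\times e_4=e_5$, $e_1\times e_7=e_6$, $e_2\times e_4=e_6$, $e_2\times e_5=e_7$, $e_3\times e_4=e_7$, $e_3\times e_6=e_5$ and the cyclic permutations of these relations (each triple being closed under cyclic permutation), all other products of basis vectors not obtained by skew-symmetry being zero. A $4$-dimensional subspace $W\subset\mathbb{R}^7$ admits a $\times$-compatible decomposition if $W=W_1\oplus W_2$ is an orthogonal direct sum with $\dim W_1=\dim W_2=2$ and $W_1\times W_1\perp W_2\times W_2$. Let $\Sigma$ be a connected Riemann surface, let $\varphi:\Sigma\to S^6\subset\mathbb{R}^7$ be a (smooth) conformal harmonic immersion, and let $F:\Sigma\to\mathbb{R}^7$ be a smooth map with $dF=\varphi\times *d\varphi$, that is, $F_x=\varphi\times\varphi_y$ and $F_y=-\varphi\times\varphi_x$ in every local conformal coordinate $z=x+iy$ (such an $F$ exists if $\Sigma$ is simply connected). Then $F$ is a conformal immersion; let $\mathbf{I}_F$, $\mathbf{I\!I}_F$ and $\mathbf{h}_F=\frac12\mathrm{tr}\,\mathbf{I}_F^{-1}\mathbf{I\!I}_F$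 be its first fundamental form, its (normal-bundle valued) second fundamental form and its mean curvature vector field. $F$ is pseudo-umbilical if $\mathbf{I\!I}_F\cdot\mathbf{h}_F=\lambda\,\mathbf{I}_F$ for some smooth function $\lambda$ on $\Sigma$, and has parallel mean curvature if the normal component of $d\mathbf{h}_F$ vanishes identically. Regard $\varphi$ as the line subbundle $\varphi_0=\mathbb{C}\varphi$ of the trivial bundle $\Sigma\times\mathbb{C}^7$, and let $\varphi_0,\varphi_1,\varphi_2,\dots$ be its harmonic sequence: $\varphi_{j+1}$ is the image of $A'_{\varphi_j}(v)=P_{\varphi_j}^{\perp}(\partial v/\partial z)$, $v$ a smooth local section of $\varphi_j$ and $P_{\varphi_j}^\perp$ the Hermitian orthogonal projection onto $\varphi_j^\perp$, extended over the isolated zeros of $A'_{\varphi_j}$ (and $\varphi_{j+1}=\{0\}$ if $A'_{\varphi_j}\equiv 0$). The map $\varphi$ has isotropy order $r>0$ if $\varphi_0$ is Hermitian orthogonal to $\varphi_1,\dots,\varphi_r$ at every point but is not everywhere orthogonal to $\varphi_{r+1}$; it is superminimal if $\varphi_j=\{0\}$ for some $j>0$. For a linear subspace $W$ of dimension $n+1$,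 $\varphi$ is full in $S^n=S^6\cap W$ if it takes values in $W$ and in no proper linear subspace of $W$, and it is superconformal in $S^n=S^6\cap W$ if it takes values in $W$ and has isotropy order $n$. If $F$ is pseudo-umbilical with non-parallel mean curvature vector field, then at least one of the following holds: 1. $\varphi$ is full and superminimal in $S^4=S^6\cap W$ for some $5$-dimensional subspace $W$ of $\mathbb{R}^7$; 2. $\varphi$ has isotropy order $r=3$ and is full in $S^4=S^6\cap W$ for some $5$-dimensional subspace $W$ of $\mathbb{R}^7$; 3. $\varphi$ is superconformal in $S^3=S^6\cap W$ for some $4$-dimensional subspace $W$ of $\mathbb{R}^7$ admitting a $\times$-compatible decomposition. Conversely, if $\varphi$ is superconformal in $S^3=S^6\cap W$ for some $4$-dimensional subspace $W$ admitting a $\times$-compatible decomposition, then $F$ is pseudo-umbilical with non-parallel mean curvature vector field. -/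

import Mathlib

open scoped Manifold ContDiff RealInnerProductSpace

namespace SixSphere

/-- The Euclidean space `ℝ⁷`. -/
abbrev E7 : Type := EuclideanSpace ℝ (Fin 7)

/-- The space `ℂ⁷` with its standard Hermitian inner product. -/
abbrev C7 : Type := EuclideanSpace ℂ (Fin 7)

/-- The seven dimensional cross product. With the canonical basis `e₁, …, e₇` (index `k` of the code
is index `k + 1` here) its non-zero products are, up to skew-symmetry and cyclic permutation,
`e₁ × e₂ = e₃`, `e₁ × e₄ = e₅`, `e₁ × e₇ = e₆`, `e₂ × e₄ = e₆`, `e₂ × e₅ = e₇`, `e₃ × e₄ = e₇`,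
`e₃ × e₆ = e₅`. -/
noncomputable def cross (x y : E7) : E7 :=
  !₂[x 1 * y 2 - x 2 * y 1 + (x 3 * y 4 - x 4 * y 3) + (x 6 * y 5 - x 5 * y 6),
     x 2 * y 0 - x 0 * y 2 + (x 3 * y 5 - x 5 * y 3) + (x 4 * y 6 - x 6 * y 4),
     x 0 * y 1 - x 1 * y 0 + (x 3 * y 6 - x 6 * y 3) + (x 5 * y 4 - x 4 * y 5),
     x 4 * y 0 - x 0 * y 4 + (x 5 * y 1 - x 1 * y 5) + (x 6 * y 2 - x 2 * y 6),
     x 0 * y 3 - x 3 * y 0 + (x 6 * y 1 - x 1 * y 6) + (x 2 * y 5 - x 5 * y 2),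
     x 0 * y 6 - x 6 * y 0 + (x 1 * y 3 - x 3 * y 1) + (x 4 * y 2 - x 2 * y 4),
     x 5 * y 0 - x 0 * y 5 + (x 1 * y 4 - x 4 * y 1) + (x 2 * y 3 - x 3 * y 2)]

/-- `W` is the orthogonal direct sum of two planes `W₁`, `W₂` with `W₁ × W₁ ⟂ W₂ × W₂`. -/
def HasCrossCompatibleDecomposition (W : Submodule ℝ E7) : Prop :=
  ∃ W₁ W₂ : Submodule ℝ E7,
    Module.finrank ℝ W₁ = 2 ∧ Module.finrank ℝ W₂ = 2 ∧ W₁ ⟂ W₂ ∧ W₁ ⊔ W₂ = W ∧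
    ∀ a ∈ W₁, ∀ b ∈ W₁, ∀ c ∈ W₂, ∀ d ∈ W₂, ⟪cross a b, cross c d⟫ = 0

/-! ### Geometry of an immersed surface, in a coordinate `z = x + i y` -/

/-- The coordinate directions `∂/∂x` and `∂/∂y`. -/
noncomputable def dir (i : Fin 2) : ℂ := ![1, Complex.I] i

/-- The first fundamental form. -/
noncomputable def firstForm (X : ℂ → E7) (z : ℂ) : Matrix (Fin 2) (Fin 2) ℝ :=
  Matrix.of fun i j => ⟪fderiv ℝ X z (dir i), fderiv ℝ X z (dir j)⟫

/-- The tangent plane. -/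
noncomputable def tangentPlane (X : ℂ → E7) (z : ℂ) : Submodule ℝ E7 :=
  LinearMap.range (fderiv ℝ X z).toLinearMap

/-- The orthogonal projection onto the normal space. -/
noncomputable def normalProj (X : ℂ → E7) (z : ℂ) : E7 →L[ℝ] E7 :=
  (tangentPlane X z)ᗮ.starProjection

/-- The (vector valued) second fundamental form: the normal part of `∂ᵢ ∂ⱼ X`. -/
noncomputable def secondForm (X : ℂ → E7) (z : ℂ) (i j : Fin 2) : E7 :=
  normalProj X z (fderiv ℝ (fun w => fderiv ℝ X w (dir j)) z (dir i))

/-- The mean curvature vector `½ tr (I⁻¹ II)`. -/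
noncomputable def meanCurvature (X : ℂ → E7) (z : ℂ) : E7 :=
  (1 / 2 : ℝ) • ∑ i, ∑ j, (firstForm X z)⁻¹ i j • secondForm X z i j

section Surfaces

variable {S : Type*} [TopologicalSpace S] [ChartedSpace ℂ S]

/-- `F` is pseudo-umbilical: `II · h = λ I` for some smooth function `λ` on the surface. -/
def IsPseudoUmbilical (F : S → E7) : Prop :=
  ∃ lam : S → ℝ, ContMDiff 𝓘(ℝ, ℂ) 𝓘(ℝ, ℝ) ∞ lam ∧
    ∀ e ∈ atlas ℂ S, ∀ z ∈ e.target, ∀ i j : Fin 2,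
      ⟪secondForm (F ∘ e.symm) z i j, meanCurvature (F ∘ e.symm) z⟫
        = lam (e.symm z) * firstForm (F ∘ e.symm) z i j

/-- The mean curvature vector field of `F` is parallel in the normal bundle. -/
def HasParallelMeanCurvature (F : S → E7) : Prop :=
  ∀ e ∈ atlas ℂ S, ∀ z ∈ e.target, ∀ v : ℂ,
    normalProj (F ∘ e.symm) z (fderiv ℝ (meanCurvature (F ∘ e.symm)) z v) = 0

/-- `φ` is a smooth conformal harmonic immersion into the unit sphere `S⁶ ⊂ ℝ⁷`. Harmonicity means
that in every coordinate `Δ φ` is orthogonal to `T_φ S⁶`, the orthogonal complement of `φ`; a map is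
a conformal immersion when in every coordinate its differential is a non-zero multiple of an
isometric embedding. -/
structure IsConformalHarmonicImmersion (φ : S → E7) : Prop where
  mem_sphere : ∀ p, φ p ∈ Metric.sphere (0 : E7) 1
  smooth : ContMDiff 𝓘(ℝ, ℂ) 𝓘(ℝ, E7) ∞ φ
  conformal : ∀ e ∈ atlas ℂ S, ∀ z ∈ e.target, ConformalAt (φ ∘ e.symm) z
  harmonic : ∀ e ∈ atlas ℂ S, ∀ z ∈ e.target, ∀ u : E7, ⟪φ (e.symm z), u⟫ = 0 →
    ⟪Laplacian.laplacian (φ ∘ e.symm) z, u⟫ = 0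

/-- `F` is smooth with `dF = φ × *dφ`, that is, `dF (v) = φ × dφ (i v)` for tangent vectors `v`
(so `F_x = φ × φ_y` and `F_y = - φ × φ_x`). -/
structure IsAssociatedSurface (φ F : S → E7) : Prop where
  smooth : ContMDiff 𝓘(ℝ, ℂ) 𝓘(ℝ, E7) ∞ F
  deriv_eq : ∀ e ∈ atlas ℂ S, ∀ z ∈ e.target, ∀ v : ℂ,
    fderiv ℝ (F ∘ e.symm) z v
      = cross (φ (e.symm z)) (fderiv ℝ (φ ∘ e.symm) z (Complex.I * v))

/-! ### Harmonic sequences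

A family `ψ : S → Submodule ℂ C7` is seen as a subbundle of the trivial bundle with fibre `ℂ⁷`. -/

/-- The operator `∂/∂z = ½ (∂/∂x - i ∂/∂y)`. -/
noncomputable def delZ (f : ℂ → C7) (z : ℂ) : C7 :=
  (1 / 2 : ℂ) • (fderiv ℝ f z 1 - Complex.I • fderiv ℝ f z Complex.I)

/-- The image at `q` of the second fundamental form `A'(v) = P^⊥ (∂v/∂z)` of the bundle `ψ`, where
`v` runs over the smooth local sections of `ψ` near `q`. It does not depend on the coordinate. -/
def imageSecondFundamental (ψ : S → Submodule ℂ C7) (q : S) : Set C7 :=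
  {w | ∃ (U : Set S) (v : S → C7), IsOpen U ∧ q ∈ U ∧ ContMDiffOn 𝓘(ℝ, ℂ) 𝓘(ℝ, C7) ∞ v U ∧
    (∀ p ∈ U, v p ∈ ψ p) ∧
    w = (ψ q)ᗮ.starProjection (delZ (v ∘ (chartAt ℂ q).symm) (chartAt ℂ q q))}

/-- The bundle spanned by the image of `A'`, extended over the (isolated) points where `A'` drops
rank by taking limits: the fibre at `p` is spanned by the limits of elements of the images of `A'`
at points tending to `p`. -/
def delBundle (ψ : S → Submodule ℂ C7) (p : S) : Submodule ℂ C7 :=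
  Submodule.span ℂ
    {w | (p, w) ∈ closure {x : S × C7 | x.2 ∈ imageSecondFundamental ψ x.1}}

/-- The complex line bundle spanned by a map into `ℝ⁷`; it is the map into `ℝP⁶ ⊂ ℂP⁶`. -/
noncomputable def lineBundle (φ : S → E7) (p : S) : Submodule ℂ C7 :=
  Submodule.span ℂ {WithLp.toLp 2 fun k => ((φ p k : ℝ) : ℂ)}

/-- The elements `φ₀, φ₁, φ₂, …` of the harmonic sequence of `φ`. -/
noncomputable def harmonicSequence (φ : S → E7) : ℕ → S → Submodule ℂ C7
  | 0 => lineBundle φ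
  | n + 1 => delBundle (harmonicSequence φ n)

/-- `φ` has (finite) isotropy order `r > 0`: it is Hermitian orthogonal to `φ₁, …, φ_r`, but not
to `φ_{r+1}`. -/
def HasIsotropyOrder (φ : S → E7) (r : ℕ) : Prop :=
  0 < r ∧
  (∀ i, 0 < i → i ≤ r → ∀ p, harmonicSequence φ 0 p ⟂ harmonicSequence φ i p) ∧
  ¬ ∀ p, harmonicSequence φ 0 p ⟂ harmonicSequence φ (r + 1) p

/-- `φ` is superminimal: some `φ_j` with `j > 0` vanishes. -/
def IsSuperminimal (φ : S → E7) : Prop :=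
  ∃ j, 0 < j ∧ ∀ p, harmonicSequence φ j p = ⊥

/-- `φ` is full in `S⁶ ∩ W`: it has values in `W` and in no proper linear subspace of `W`. -/
def IsFullIn (φ : S → E7) (W : Submodule ℝ E7) : Prop :=
  (∀ p, φ p ∈ W) ∧ ∀ V : Submodule ℝ E7, V ≤ W → (∀ p, φ p ∈ V) → V = W

/-- `φ` is superconformal in the sphere `Sⁿ = S⁶ ∩ W`, where `dim W = n + 1`: it has values in `W`
and isotropy order `n`, the dimension of the projective space of `W ⊗ ℂ`. -/
def IsSuperconformalIn (φ : S → E7) (W : Submodule ℝ E7) : Prop :=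
  (∀ p, φ p ∈ W) ∧ ∃ n : ℕ, Module.finrank ℝ W = n + 1 ∧ HasIsotropyOrder φ n

end Surfaces

end SixSphere

/-! Write `P` for the map in `ℂ⁷`, `a = P_z`, `b = P_z̄`, `ρ = ⟨a, b⟩` for the bilinear product, `s
= f₂ = P_zz - (ρ_z/ρ) a`, `h = (i/ρ) b × a` and `N = P × h`. Since `F_z = i P × a`, differentiation
gives `F_zz̄ = ρ h`, so `h` is the mean curvature vector of `F` and has length one, while `⟨F_zz, h⟩
= -i ⟨N, s⟩`. Hence `F` is pseudo-umbilical exactly when `⟨N, s⟩ = 0`, and then `λ = 1`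
(`dotC_eq_zero_iff`, `umbilical_of_dotC_eq_zero`). Moreover `h_z = (i/ρ) b × s - F_z`, so `b × s =
0` makes `h` parallel. Finally `⟨N, s⟩` is, up to the factor `-iρ`, the value on `(P, a, b, s)` of
an alternating four-form `Φ` built from the cross product (`fourFormC_eq`). This ties umbilicity to
compatible decompositions, because `Φ` vanishes on a space that has one.

Direct implication: the third alternative always holds. Differentiating `⟨N, s⟩ = 0` in `z̄` gives
`⟨s, P × (a × s̄)⟩ = 0`. Where `N ≠ 0`, expanding `s` in an explicit basis turns this into `⟨h, s⟩
s̄ = ⟨h, s̄⟩ s` (`conj_proportional`). If `N = 0` on an open set, or if `N ≠ 0` and `⟨h, s⟩ = 0`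
there, then `b × s = 0` (`cross_eq_zero_of_normal_eq_zero`, `cross_eq_zero`). So non-parallel `h`
yields an open set where `s` is a nonzero multiple of a real vector
(`exists_open_conj_proportional`). There the span of `P, a, b, s` is closed under differentiation,
hence constant: the surface lies locally in a real four-dimensional `W`
(`exists_ball_dotC_eq_zero`). A Carleman estimate for `∂/∂z̄` propagates this over the connected
surface (`inner_eq_zero_of_eventually`). The decomposition of `W` is read off from `Φ(P, a, b, s) =
0`, and `⟨s, s⟩ ≠ 0` forces isotropy order three (`hasIsotropyOrder_three`).

Converse: `P, a, b, s` lie in `W ⊗ ℂ`, where `Φ` vanishes, so `F` is pseudo-umbilical. If `h` were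
parallel then `⟨s, s⟩ = 0` everywhere (`IsAssociatedChart.dotC_secondSection_self_eq_zero`). At a
point with `s ≠ 0`, which exists because the isotropy order is finite, `P, a, b, s, s̄` would be
five Hermitian orthogonal vectors in a space of dimension four. -/

namespace SixSphere

/-! ### The complexified cross product -/

/-- The complex bilinear extension of the inner product of `ℝ⁷`. -/
noncomputable def dotC (x y : C7) : ℂ := ∑ i, x i * y i

/-- The complex bilinear extension of the cross product. -/
noncomputable def crossC (x y : C7) : C7 :=
  !₂[x 1 * y 2 - x 2 * y 1 + (x 3 * y 4 - x 4 * y 3) + (x 6 * y 5 - x 5 * y 6),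
     x 2 * y 0 - x 0 * y 2 + (x 3 * y 5 - x 5 * y 3) + (x 4 * y 6 - x 6 * y 4),
     x 0 * y 1 - x 1 * y 0 + (x 3 * y 6 - x 6 * y 3) + (x 5 * y 4 - x 4 * y 5),
     x 4 * y 0 - x 0 * y 4 + (x 5 * y 1 - x 1 * y 5) + (x 6 * y 2 - x 2 * y 6),
     x 0 * y 3 - x 3 * y 0 + (x 6 * y 1 - x 1 * y 6) + (x 2 * y 5 - x 5 * y 2),
     x 0 * y 6 - x 6 * y 0 + (x 1 * y 3 - x 3 * y 1) + (x 4 * y 2 - x 2 * y 4),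
     x 5 * y 0 - x 0 * y 5 + (x 1 * y 4 - x 4 * y 1) + (x 2 * y 3 - x 3 * y 2)]

lemma dotC_add_left (x y z : C7) : dotC (x + y) z = dotC x z + dotC y z := by
  simp [dotC, add_mul, Finset.sum_add_distrib]

lemma dotC_comm (x y : C7) : dotC x y = dotC y x := by
  simp [dotC, mul_comm]

lemma dotC_add_right (x y z : C7) : dotC z (x + y) = dotC z x + dotC z y := by
  simp [dotC, mul_add, Finset.sum_add_distrib]

lemma dotC_smul_left (c : ℂ) (x y : C7) : dotC (c • x) y = c * dotC x y := by
  simp [dotC, mul_assoc, Finset.mul_sum]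

lemma dotC_smul_right (c : ℂ) (x y : C7) : dotC x (c • y) = c * dotC x y := by
  simp [dotC, mul_left_comm, Finset.mul_sum]

lemma dotC_neg_left (x y : C7) : dotC (-x) y = -dotC x y := by simp [dotC]
lemma dotC_neg_right (x y : C7) : dotC x (-y) = -dotC x y := by simp [dotC]
lemma dotC_sub_left (x y z : C7) : dotC (x - y) z = dotC x z - dotC y z := by
  simp [dotC, sub_mul]
lemma dotC_sub_right (x y z : C7) : dotC z (x - y) = dotC z x - dotC z y := by
  simp [dotC, mul_sub]
@[simp] lemma dotC_zero_left (x : C7) : dotC 0 x = 0 := by simp [dotC]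
@[simp] lemma dotC_zero_right (x : C7) : dotC x 0 = 0 := by simp [dotC]

lemma crossC_add_left (x y z : C7) : crossC (x + y) z = crossC x z + crossC y z := by
  ext i; fin_cases i <;> simp [crossC] <;> ring
lemma crossC_add_right (x y z : C7) : crossC z (x + y) = crossC z x + crossC z y := by
  ext i; fin_cases i <;> simp [crossC] <;> ring
lemma crossC_smul_left (c : ℂ) (x y : C7) : crossC (c • x) y = c • crossC x y := by
  ext i; fin_cases i <;> simp [crossC] <;> ring
lemma crossC_smul_right (c : ℂ) (x y : C7) : crossC x (c • y) = c • crossC x y := by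
  ext i; fin_cases i <;> simp [crossC] <;> ring
lemma crossC_anticomm (x y : C7) : crossC x y = -crossC y x := by
  ext i; fin_cases i <;> simp [crossC] <;> ring
@[simp] lemma crossC_self (x : C7) : crossC x x = 0 := by
  ext i; fin_cases i <;> simp [crossC] <;> ring
@[simp] lemma crossC_zero_right (x : C7) : crossC x 0 = 0 := by
  simpa using crossC_smul_right 0 x 0
lemma crossC_neg_left (x y : C7) : crossC (-x) y = -crossC x y := by
  simpa using crossC_smul_left (-1) x y
lemma crossC_neg_right (x y : C7) : crossC x (-y) = -crossC x y := by
  simpa using crossC_smul_right (-1) x y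
lemma crossC_sub_left (x y z : C7) : crossC (x - y) z = crossC x z - crossC y z := by
  rw [sub_eq_add_neg, crossC_add_left, crossC_neg_left, ← sub_eq_add_neg]
lemma crossC_sub_right (x y z : C7) : crossC z (x - y) = crossC z x - crossC z y := by
  rw [sub_eq_add_neg, crossC_add_right, crossC_neg_right, ← sub_eq_add_neg]

lemma dotC_crossC_left (x y z : C7) : dotC (crossC x y) z = dotC x (crossC y z) := by
  simp [dotC, crossC, Fin.sum_univ_succ]; ring

lemma dotC_crossC_self_left (x y : C7) : dotC x (crossC x y) = 0 := by
  rw [← dotC_crossC_left]; simp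

lemma dotC_crossC_self_right (x y : C7) : dotC x (crossC y x) = 0 := by
  rw [crossC_anticomm, dotC_neg_right, dotC_crossC_self_left, neg_zero]

lemma crossC_crossC_self (x y : C7) : crossC x (crossC x y) = dotC x y • x - dotC x x • y := by
  ext i; fin_cases i <;> simp [crossC, dotC, Fin.sum_univ_succ] <;> ring

lemma crossC_crossC_swap (x y : C7) : crossC x (crossC y x) = dotC x x • y - dotC x y • x := by
  rw [crossC_anticomm y x, crossC_neg_right, crossC_crossC_self, neg_sub]

/-- Polarisation of the double product formula `crossC_crossC_self`. In dimension seven only this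
symmetrised identity survives, not the full triple product formula of `ℝ³`. -/
lemma crossC_crossC_add (x y z : C7) : crossC x (crossC y z) + crossC y (crossC x z) =
    dotC x z • y + dotC y z • x - (2 * dotC x y) • z := by
  ext i; fin_cases i <;> simp [crossC, dotC, Fin.sum_univ_succ] <;> ring

/-- The `4`-form measuring how far the cross product of orthogonal vectors is from that of `ℝ³`. -/
noncomputable def fourFormC (x y z w : C7) : ℂ :=
  dotC (crossC x y) (crossC z w) - dotC x z * dotC y w + dotC x w * dotC y z

lemma fourFormC_swap₁ (x y z w : C7) : fourFormC y x z w = -fourFormC x y z w := by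
  simp only [fourFormC, crossC_anticomm y x, dotC_neg_left]; ring

lemma fourFormC_swap₃ (x y z w : C7) : fourFormC x y w z = -fourFormC x y z w := by
  simp only [fourFormC, crossC_anticomm w z, dotC_neg_right]; ring

/-- The one exchange that skew-symmetry of the product does not give directly: pairing the polarised
double product identity with `x` yields it. With the two outer exchanges it makes the form
alternating. -/
lemma fourFormC_swap₂ (x y z w : C7) : fourFormC x z y w = -fourFormC x y z w := by
  have h := congrArg (dotC x) (crossC_crossC_add y z w)
  simp only [dotC_add_right, dotC_sub_right, dotC_smul_right] at h
  simp only [fourFormC, dotC_crossC_left x]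
  rw [dotC_comm z y]
  linear_combination h

lemma dotC_crossC_cycle (x y z : C7) : dotC x (crossC y z) = dotC y (crossC z x) := by
  rw [← dotC_crossC_left y, dotC_comm]

lemma dotC_crossC_crossC_self (x y z : C7) :
    dotC (crossC x y) (crossC x z) = dotC x x * dotC y z - dotC x y * dotC x z := by
  rw [crossC_anticomm x y, dotC_neg_left, dotC_crossC_left, crossC_crossC_self]
  simp only [dotC_sub_right, dotC_smul_right, dotC_comm y x]; ring

/-! ### Conjugation -/

/-- Conjugation of the coordinates of a complex vector. -/
noncomputable def conjC (x : C7) : C7 := WithLp.toLp 2 fun i => (starRingEnd ℂ) (x i)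

@[simp] lemma conjC_apply (x : C7) (i : Fin 7) : conjC x i = (starRingEnd ℂ) (x i) := rfl
@[simp] lemma conjC_conjC (x : C7) : conjC (conjC x) = x := by ext i; simp
lemma conjC_add (x y : C7) : conjC (x + y) = conjC x + conjC y := by ext i; simp
lemma conjC_sub (x y : C7) : conjC (x - y) = conjC x - conjC y := by ext i; simp
@[simp] lemma conjC_zero : conjC 0 = 0 := by ext i; simp
lemma conjC_smul (c : ℂ) (x : C7) : conjC (c • x) = (starRingEnd ℂ) c • conjC x := by ext i; simp
lemma conjC_crossC (x y : C7) : conjC (crossC x y) = crossC (conjC x) (conjC y) := by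
  ext i; fin_cases i <;> simp [crossC]
lemma dotC_conjC (x y : C7) : dotC (conjC x) (conjC y) = (starRingEnd ℂ) (dotC x y) := by
  simp [dotC]
lemma inner_eq_dotC (x y : C7) : inner ℂ x y = dotC (conjC x) y := by
  simp [dotC, PiLp.inner_apply, mul_comm]
lemma dotC_conjC_self_eq_zero {x : C7} : dotC (conjC x) x = 0 ↔ x = 0 := by
  rw [← inner_eq_dotC, inner_self_eq_zero]

end SixSphere

/-! ### Pointwise algebra of a conformal frame -/

namespace SixSphere

open Complex

/-- The pointwise data of a conformal immersion into `S⁶`: the point `p` and the complex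
derivatives `a`, `b` with respect to `z`, `z̄`. -/
structure IsConformalFrame (p a b : C7) (ρ : ℂ) : Prop where
  pp : dotC p p = 1
  pa : dotC p a = 0
  pb : dotC p b = 0
  aa : dotC a a = 0
  bb : dotC b b = 0
  ab : dotC a b = ρ
  ne : ρ ≠ 0
  conj_p : conjC p = p
  conj_a : conjC a = b

/-- The mean curvature vector of the associated surface, `i b × a / ρ`. -/
noncomputable def meanVec (a b : C7) (ρ : ℂ) : C7 := (I / ρ) • crossC b a

/-- The vector `ε` completing `a` to the complex span of the first normal directions. -/
noncomputable def epsVec (p a : C7) (θ : ℂ) : C7 := crossC p a - (I * θ) • a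

namespace IsConformalFrame

variable {p a b : C7} {ρ : ℂ}

lemma ba (H : IsConformalFrame p a b ρ) : dotC b a = ρ := by rw [dotC_comm, H.ab]
lemma ap (H : IsConformalFrame p a b ρ) : dotC a p = 0 := by rw [dotC_comm, H.pa]
lemma bp (H : IsConformalFrame p a b ρ) : dotC b p = 0 := by rw [dotC_comm, H.pb]
lemma conj_b (H : IsConformalFrame p a b ρ) : conjC b = a := by rw [← H.conj_a, conjC_conjC]
lemma conj_rho (H : IsConformalFrame p a b ρ) : (starRingEnd ℂ) ρ = ρ := by
  rw [← H.ab, ← dotC_conjC, H.conj_a, H.conj_b, dotC_comm]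

lemma cross_a_b (H : IsConformalFrame p a b ρ) : crossC a b = (I * ρ) • meanVec a b ρ := by
  rw [meanVec, smul_smul, crossC_anticomm a b]
  have : I * ρ * (I / ρ) = -1 := by have := H.ne; field_simp; simp
  rw [this, neg_one_smul]

lemma conj_mean (H : IsConformalFrame p a b ρ) : conjC (meanVec a b ρ) = meanVec a b ρ := by
  rw [meanVec, conjC_smul, conjC_crossC, H.conj_a, H.conj_b, crossC_anticomm a b, map_div₀, conj_I,
    H.conj_rho, smul_neg, ← neg_smul, neg_div, neg_neg]

lemma mean_a (H : IsConformalFrame p a b ρ) : dotC (meanVec a b ρ) a = 0 := by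
  rw [meanVec, dotC_smul_left, dotC_comm, dotC_crossC_self_right, mul_zero]

lemma mean_b (H : IsConformalFrame p a b ρ) : dotC (meanVec a b ρ) b = 0 := by
  rw [meanVec, dotC_smul_left, dotC_comm, dotC_crossC_self_left, mul_zero]

lemma mean_mean (H : IsConformalFrame p a b ρ) :
    dotC (meanVec a b ρ) (meanVec a b ρ) = 1 := by
  rw [meanVec, dotC_smul_left, dotC_smul_right, crossC_anticomm b a, dotC_neg_right, dotC_neg_left,
    dotC_crossC_crossC_self, H.aa, H.bb, H.ab]
  have := H.ne; field_simp; simp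

/-- Multiplication by `h` acts on the tangent plane as a complex structure, with `a` and `b` as
eigenvectors. Most later identities reduce to this one and its conjugate. -/
lemma cross_a_mean (H : IsConformalFrame p a b ρ) : crossC a (meanVec a b ρ) = -(I • a) := by
  rw [meanVec, crossC_smul_right, crossC_crossC_swap, H.aa, H.ab, zero_smul, zero_sub, smul_neg,
    smul_smul, div_mul_cancel₀ _ H.ne]

lemma cross_b_mean (H : IsConformalFrame p a b ρ) : crossC b (meanVec a b ρ) = I • b := by
  rw [meanVec, crossC_smul_right, crossC_crossC_self, H.bb, H.ba, zero_smul, sub_zero,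
    smul_smul, div_mul_cancel₀ _ H.ne]

lemma pCrossA_mean (H : IsConformalFrame p a b ρ) :
    dotC (crossC p a) (meanVec a b ρ) = 0 := by
  rw [dotC_crossC_left, H.cross_a_mean, dotC_neg_right, dotC_smul_right, H.pa]; simp

lemma pCrossB_mean (H : IsConformalFrame p a b ρ) :
    dotC (crossC p b) (meanVec a b ρ) = 0 := by
  rw [dotC_crossC_left, H.cross_b_mean, dotC_smul_right, H.pb]; simp

lemma a_N (H : IsConformalFrame p a b ρ) : dotC a (crossC p (meanVec a b ρ)) = 0 := by
  rw [← dotC_crossC_left, crossC_anticomm, dotC_neg_left, H.pCrossA_mean, neg_zero]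

lemma b_N (H : IsConformalFrame p a b ρ) : dotC b (crossC p (meanVec a b ρ)) = 0 := by
  rw [← dotC_crossC_left, crossC_anticomm, dotC_neg_left, H.pCrossB_mean, neg_zero]

lemma pCrossA_b (H : IsConformalFrame p a b ρ) :
    dotC (crossC p a) b = I * ρ * dotC p (meanVec a b ρ) := by
  rw [dotC_crossC_left, H.cross_a_b, dotC_smul_right]

lemma pCrossB_a (H : IsConformalFrame p a b ρ) :
    dotC (crossC p b) a = -(I * ρ * dotC p (meanVec a b ρ)) := by
  rw [dotC_crossC_left, crossC_anticomm, H.cross_a_b, dotC_neg_right, dotC_smul_right]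

/-- Because `N` is real, this scalar is its squared length. The hypothesis that `1 - θ ^ 2` is
nonzero, with `θ = ⟨p, h⟩`, therefore says that `N` does not vanish. -/
lemma N_N (H : IsConformalFrame p a b ρ) :
    dotC (crossC p (meanVec a b ρ)) (crossC p (meanVec a b ρ)) = 1 - dotC p (meanVec a b ρ) ^ 2 := by
  rw [dotC_crossC_crossC_self, H.pp, H.mean_mean]; ring

lemma p_cross_N (H : IsConformalFrame p a b ρ) :
    crossC p (crossC p (meanVec a b ρ)) =
      dotC p (meanVec a b ρ) • p - meanVec a b ρ := by
  rw [crossC_crossC_self, H.pp, one_smul]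

lemma p_cross_a (H : IsConformalFrame p a b ρ) : crossC p (crossC p a) = -a := by
  rw [crossC_crossC_self, H.pp, H.pa]; simp

lemma p_cross_b (H : IsConformalFrame p a b ρ) : crossC p (crossC p b) = -b := by
  rw [crossC_crossC_self, H.pp, H.pb]; simp

lemma a_cross_pa (H : IsConformalFrame p a b ρ) : crossC a (crossC p a) = 0 := by
  rw [crossC_crossC_swap, H.aa, H.ap]; simp

lemma b_cross_pb (H : IsConformalFrame p a b ρ) : crossC b (crossC p b) = 0 := by
  rw [crossC_crossC_swap, H.bb, H.bp]; simp

lemma pCross_dots (H : IsConformalFrame p a b ρ) :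
    dotC (crossC p a) (crossC p a) = 0 ∧ dotC (crossC p a) (crossC p b) = ρ ∧
    dotC (crossC p b) (crossC p a) = ρ ∧ dotC (crossC p b) (crossC p b) = 0 := by
  simp [dotC_crossC_crossC_self, H.pp, H.pa, H.pb, H.aa, H.bb, H.ab, H.ba]

lemma conj_theta (H : IsConformalFrame p a b ρ) :
    (starRingEnd ℂ) (dotC p (meanVec a b ρ)) = dotC p (meanVec a b ρ) := by
  rw [← dotC_conjC, H.conj_p, H.conj_mean]

lemma conj_eps (H : IsConformalFrame p a b ρ) :
    conjC (epsVec p a (dotC p (meanVec a b ρ))) = epsVec p b (-dotC p (meanVec a b ρ)) := by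
  rw [epsVec, epsVec, conjC_sub, conjC_crossC, conjC_smul, H.conj_a, H.conj_p, map_mul,
    H.conj_theta, conj_I]
  simp

lemma conj_eps' (H : IsConformalFrame p a b ρ) :
    conjC (epsVec p b (-dotC p (meanVec a b ρ))) = epsVec p a (dotC p (meanVec a b ρ)) := by
  rw [← H.conj_eps, conjC_conjC]

lemma conj_N (H : IsConformalFrame p a b ρ) :
    conjC (crossC p (meanVec a b ρ)) = crossC p (meanVec a b ρ) := by
  rw [conjC_crossC, H.conj_p, H.conj_mean]

lemma conj_M (H : IsConformalFrame p a b ρ) :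
    conjC (crossC p (crossC p (meanVec a b ρ))) = crossC p (crossC p (meanVec a b ρ)) := by
  rw [conjC_crossC, H.conj_p, H.conj_N]

/-- The scalar products of `p`, `a`, `b`, `N = p × h` and `M = p × N` with `ε` and its conjugate. -/
lemma eps_dots (H : IsConformalFrame p a b ρ) {θ : ℂ} (hθ : θ = dotC p (meanVec a b ρ)) :
    dotC p (epsVec p a θ) = 0 ∧ dotC p (epsVec p b (-θ)) = 0 ∧
    dotC a (epsVec p a θ) = 0 ∧ dotC a (epsVec p b (-θ)) = 0 ∧
    dotC b (epsVec p a θ) = 0 ∧ dotC b (epsVec p b (-θ)) = 0 ∧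
    dotC (epsVec p a θ) (epsVec p a θ) = 0 ∧
    dotC (epsVec p a θ) (epsVec p b (-θ)) = ρ * (1 - θ ^ 2) ∧
    dotC (epsVec p b (-θ)) (epsVec p b (-θ)) = 0 := by
  obtain ⟨h1, h2, h3, h4⟩ := H.pCross_dots
  have h5 := H.pCrossA_b
  have h6 := H.pCrossB_a
  rw [← hθ] at h5 h6
  have h7 : dotC (crossC p a) a = 0 := by rw [dotC_comm, dotC_crossC_self_right]
  have h8 : dotC (crossC p b) b = 0 := by rw [dotC_comm, dotC_crossC_self_right]
  have h9 : dotC a (crossC p b) = -(I * ρ * θ) := by rw [dotC_comm, h6]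
  have h10 : dotC b (crossC p a) = I * ρ * θ := by rw [dotC_comm, h5]
  refine ⟨?_, ?_, ?_, ?_, ?_, ?_, ?_, ?_, ?_⟩ <;>
  simp only [epsVec, dotC_sub_right, dotC_sub_left, dotC_smul_left, dotC_smul_right,
    dotC_crossC_self_left, dotC_crossC_self_right, h1, h2, h3, h4, h5, h6, h7, h8, h9, h10,
    H.pa, H.pb, H.aa, H.bb, H.ab, H.ba] <;> ring_nf <;> simp <;> ring

lemma eps_N (H : IsConformalFrame p a b ρ) (θ : ℂ) :
    dotC (epsVec p a θ) (crossC p (meanVec a b ρ)) = 0 := by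
  rw [epsVec, dotC_sub_left, dotC_smul_left, H.a_N, dotC_crossC_crossC_self, H.pa, dotC_comm a,
    H.mean_a]; simp

lemma eps_N' (H : IsConformalFrame p a b ρ) (θ : ℂ) :
    dotC (epsVec p b θ) (crossC p (meanVec a b ρ)) = 0 := by
  rw [epsVec, dotC_sub_left, dotC_smul_left, H.b_N, dotC_crossC_crossC_self, H.pb, dotC_comm b,
    H.mean_b]; simp

lemma eps_mean (H : IsConformalFrame p a b ρ) (θ : ℂ) :
    dotC (epsVec p a θ) (meanVec a b ρ) = 0 := by
  rw [epsVec, dotC_sub_left, dotC_smul_left, H.pCrossA_mean, dotC_comm a, H.mean_a]; simp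

lemma eps_mean' (H : IsConformalFrame p a b ρ) (θ : ℂ) :
    dotC (epsVec p b θ) (meanVec a b ρ) = 0 := by
  rw [epsVec, dotC_sub_left, dotC_smul_left, H.pCrossB_mean, dotC_comm b, H.mean_b]; simp

lemma M_M (H : IsConformalFrame p a b ρ) :
    dotC (crossC p (crossC p (meanVec a b ρ))) (crossC p (crossC p (meanVec a b ρ))) =
      1 - dotC p (meanVec a b ρ) ^ 2 := by
  rw [dotC_crossC_crossC_self, H.pp, H.N_N, dotC_crossC_self_left]; ring

/-- If `N = p × h` does not vanish, then `p`, `a`, `b`, `p × a`, `p × b`, `N`, `h` span `ℂ⁷`. -/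
lemma eq_zero_of_orthogonal (H : IsConformalFrame p a b ρ) (hD : 1 - dotC p (meanVec a b ρ) ^ 2 ≠ 0)
    {x : C7} (xp : dotC p x = 0) (xa : dotC a x = 0) (xb : dotC b x = 0)
    (xε : dotC (epsVec p a (dotC p (meanVec a b ρ))) x = 0)
    (xε' : dotC (epsVec p b (-dotC p (meanVec a b ρ))) x = 0)
    (xN : dotC (crossC p (meanVec a b ρ)) x = 0)
    (xM : dotC (crossC p (crossC p (meanVec a b ρ))) x = 0) : x = 0 := by
  by_contra hx
  obtain ⟨e1, e2, e3, e4, e5, e6, e7, e8, e9⟩ := H.eps_dots rfl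
  have hM := H.p_cross_N
  have c1 := H.conj_eps
  have c2 := H.conj_eps'
  have c3 := H.conj_N
  have c4 := H.conj_M
  have n1 := H.eps_N (dotC p (meanVec a b ρ))
  have n2 := H.eps_N' (-dotC p (meanVec a b ρ))
  have m1 : dotC (epsVec p a (dotC p (meanVec a b ρ))) (crossC p (crossC p (meanVec a b ρ))) = 0 := by
    rw [hM, dotC_sub_right, H.eps_mean, dotC_smul_right, dotC_comm _ p, e1]; simp
  have m2 : dotC (epsVec p b (-dotC p (meanVec a b ρ))) (crossC p (crossC p (meanVec a b ρ))) = 0 := by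
    rw [hM, dotC_sub_right, H.eps_mean', dotC_smul_right, dotC_comm _ p, e2]; simp
  have am : dotC a (crossC p (crossC p (meanVec a b ρ))) = 0 := by
    rw [hM, dotC_sub_right, dotC_smul_right, H.ap, dotC_comm a, H.mean_a]; simp
  have bm : dotC b (crossC p (crossC p (meanVec a b ρ))) = 0 := by
    rw [hM, dotC_sub_right, dotC_smul_right, H.bp, dotC_comm b, H.mean_b]; simp
  have nm : dotC (crossC p (meanVec a b ρ)) (crossC p (crossC p (meanVec a b ρ))) = 0 :=
    dotC_crossC_self_right _ _
  have ne : ∀ u v : C7, dotC u v ≠ 0 → u ≠ 0 := by rintro u v h rfl; simp at h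
  have ne' : ∀ u v : C7, dotC u v ≠ 0 → v ≠ 0 := by rintro u v h rfl; simp at h
  have NN := H.N_N
  have MM := H.M_M
  have aN := H.a_N
  have bN := H.b_N
  set θ := dotC p (meanVec a b ρ)
  have pN : dotC p (crossC p (meanVec a b ρ)) = 0 := dotC_crossC_self_left _ _
  have pM : dotC p (crossC p (crossC p (meanVec a b ρ))) = 0 := dotC_crossC_self_left _ _
  generalize crossC p (crossC p (meanVec a b ρ)) = M at *
  generalize crossC p (meanVec a b ρ) = N at *
  -- The family is closed under conjugation apart from `x`, so bilinear orthogonality relations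
  -- become Hermitian ones. A nonzero `x` would give eight orthogonal vectors in `ℂ⁷`.
  set v : Fin 8 → C7 := ![p, a, b, epsVec p a θ, epsVec p b (-θ), N, M, x] with hv
  have hlin : LinearIndependent ℂ v := by
    apply linearIndependent_of_ne_zero_of_inner_eq_zero
    · intro i
      fin_cases i
      · exact ne p p (by rw [H.pp]; simp)
      · exact ne a b (by rw [H.ab]; exact H.ne)
      · exact ne' a b (by rw [H.ab]; exact H.ne)
      · exact ne (epsVec p a θ) (epsVec p b (-θ)) (by rw [e8]; exact mul_ne_zero H.ne hD)
      · exact ne' (epsVec p a θ) (epsVec p b (-θ)) (by rw [e8]; exact mul_ne_zero H.ne hD)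
      · exact ne N N (by rw [NN]; exact hD)
      · exact ne M M (by rw [MM]; exact hD)
      · exact hx
    · have key : ∀ i j : Fin 8, i < j → inner ℂ (v i) (v j) = 0 := by
        intro i j hij
        rw [inner_eq_dotC]
        fin_cases i <;> fin_cases j <;> first | (exfalso; revert hij; decide) | skip
        all_goals
          simp only [hv, Matrix.cons_val, Fin.mk_one, Fin.zero_eta, Fin.reduceFinMk,
            H.conj_p, H.conj_a, H.conj_b, c1, c2, c3, c4, xp, xa, xb, xε, xε', xN, xM,
            H.pa, H.pb, H.aa, H.bb, e1, e2, e3, e4, e5, e6, e7, e9, n1, n2, m1, m2, am, bm, nm, aN,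
            bN, pN, pM]
      intro i j hij
      rcases lt_or_gt_of_ne hij with h | h
      · exact key i j h
      · rw [← inner_conj_symm, key j i h, map_zero]
  have := hlin.fintype_card_le_finrank
  simp at this

lemma a_cross_eps (H : IsConformalFrame p a b ρ) (θ : ℂ) : crossC a (epsVec p a θ) = 0 := by
  rw [epsVec, crossC_sub_right, H.a_cross_pa, crossC_smul_right, crossC_self]; simp

lemma b_cross_eps (H : IsConformalFrame p a b ρ) (θ : ℂ) : crossC b (epsVec p b θ) = 0 := by
  rw [epsVec, crossC_sub_right, H.b_cross_pb, crossC_smul_right, crossC_self]; simp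

/-- With `a_cross_eps`, this computes the operator `T = p × (a × ·)` on two basis vectors: it kills
`ε` and sends `M` to `iε`. Skewness of `T` supplies the remaining products needed. -/
lemma p_cross_a_cross_M (H : IsConformalFrame p a b ρ) :
    crossC p (crossC a (crossC p (crossC p (meanVec a b ρ)))) =
      I • epsVec p a (dotC p (meanVec a b ρ)) := by
  rw [H.p_cross_N, crossC_sub_right, crossC_smul_right, H.cross_a_mean, crossC_sub_right,
    crossC_smul_right, crossC_anticomm a p, crossC_neg_right, H.p_cross_a, crossC_neg_right,
    crossC_smul_right, epsVec, smul_sub, smul_smul, ← mul_assoc, I_mul_I]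
  simp [add_comm, sub_eq_add_neg]

/-- A vector in the complexified normal space of the surface in `S⁶` which is orthogonal to `N` is
a combination of `ε`, its conjugate and `M = p × N`. -/
lemma exists_eps_expansion (H : IsConformalFrame p a b ρ)
    (hD : 1 - dotC p (meanVec a b ρ) ^ 2 ≠ 0) {s : C7} (sp : dotC p s = 0) (sa : dotC a s = 0)
    (sb : dotC b s = 0) (sN : dotC (crossC p (meanVec a b ρ)) s = 0) :
    ∃ α β γ : ℂ, s = α • epsVec p a (dotC p (meanVec a b ρ)) +
        β • epsVec p b (-dotC p (meanVec a b ρ)) +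
        γ • crossC p (crossC p (meanVec a b ρ)) ∧
      γ * (1 - dotC p (meanVec a b ρ) ^ 2) = -dotC (meanVec a b ρ) s := by
  obtain ⟨e1, e2, e3, e4, e5, e6, e7, e8, e9⟩ := H.eps_dots rfl
  have hM := H.p_cross_N
  have n1 := H.eps_N (dotC p (meanVec a b ρ))
  have n2 := H.eps_N' (-dotC p (meanVec a b ρ))
  have hh1 := H.eps_mean (dotC p (meanVec a b ρ))
  have hh2 := H.eps_mean' (-dotC p (meanVec a b ρ))
  have MM := H.M_M
  have hMs : dotC (crossC p (crossC p (meanVec a b ρ))) s = -dotC (meanVec a b ρ) s := by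
    rw [hM, dotC_sub_left, dotC_smul_left, sp]; ring
  have hNM : dotC (crossC p (meanVec a b ρ)) (crossC p (crossC p (meanVec a b ρ))) = 0 :=
    dotC_crossC_self_right _ _
  have hρ := H.ne
  set θ := dotC p (meanVec a b ρ) with hθ
  have hpM : dotC p (crossC p (crossC p (meanVec a b ρ))) = 0 := dotC_crossC_self_left _ _
  have haM : dotC a (crossC p (crossC p (meanVec a b ρ))) = 0 := by
    rw [hM, dotC_sub_right, dotC_smul_right, H.ap, dotC_comm a, H.mean_a]; simp
  have hbM : dotC b (crossC p (crossC p (meanVec a b ρ))) = 0 := by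
    rw [hM, dotC_sub_right, dotC_smul_right, H.bp, dotC_comm b, H.mean_b]; simp
  have m1 : dotC (epsVec p a θ) (crossC p (crossC p (meanVec a b ρ))) = 0 := by
    rw [hM, dotC_sub_right, hh1, dotC_smul_right, dotC_comm _ p, e1]; simp
  have m2 : dotC (epsVec p b (-θ)) (crossC p (crossC p (meanVec a b ρ))) = 0 := by
    rw [hM, dotC_sub_right, hh2, dotC_smul_right, dotC_comm _ p, e2]; simp
  -- The isotropic vectors `ε` and `ε̄` are dual up to `ρ (1 - θ ^ 2)`, so the coefficient of each
  -- is read off by pairing with the other. The coefficient along `M` uses `⟨M, s⟩ = -⟨h, s⟩`.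
  have key : s - (dotC (epsVec p b (-θ)) s / (ρ * (1 - θ ^ 2))) • epsVec p a θ -
      (dotC (epsVec p a θ) s / (ρ * (1 - θ ^ 2))) • epsVec p b (-θ) -
      (-dotC (meanVec a b ρ) s / (1 - θ ^ 2)) • crossC p (crossC p (meanVec a b ρ)) = 0 := by
    apply H.eq_zero_of_orthogonal hD <;>
    simp only [dotC_sub_right, dotC_smul_right, sp, sa, sb, sN, e1, e2, e3, e4, e5, e6, e7, e8, e9,
      ← hθ, dotC_comm (epsVec p b (-θ)) (epsVec p a θ), dotC_comm _ (epsVec p a θ),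
      dotC_comm _ (epsVec p b (-θ)), n1, n2, m1, m2, hpM, haM, hbM, MM, hMs, hNM] <;>
    field_simp <;> ring
  refine ⟨dotC (epsVec p b (-θ)) s / (ρ * (1 - θ ^ 2)), dotC (epsVec p a θ) s / (ρ * (1 - θ ^ 2)),
    -dotC (meanVec a b ρ) s / (1 - θ ^ 2), ?_, div_mul_cancel₀ _ hD⟩
  rw [sub_eq_zero, sub_eq_iff_eq_add, sub_eq_iff_eq_add] at key
  refine key.trans ?_
  abel

/-- On vectors orthogonal to `p` and `a` the bilinear form of `T = p × (a × ·)` is `-Φ(p, ·, a, ·)`,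
which is alternating. Hence `T` is skew there. -/
lemma dotC_pCross_aCross_swap (H : IsConformalFrame p a b ρ) {x y : C7} (xp : dotC p x = 0)
    (xa : dotC a x = 0) (yp : dotC p y = 0) (ya : dotC a y = 0) :
    dotC x (crossC p (crossC a y)) = -dotC y (crossC p (crossC a x)) := by
  have key : ∀ u v : C7, dotC p u = 0 → dotC a u = 0 → dotC p v = 0 → dotC a v = 0 →
      dotC u (crossC p (crossC a v)) = -fourFormC p u a v := by
    intro u v h1 h2 h3 h4
    rw [← dotC_crossC_left, crossC_anticomm u p, dotC_neg_left, fourFormC, H.pa, h3]; ring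
  rw [key x y xp xa yp ya, key y x yp ya xp xa, fourFormC_swap₂ p a y x, fourFormC_swap₃ p a x y,
    fourFormC_swap₂ p x a y]
  ring

/-- If `s` is orthogonal to `N ≠ 0` and `p × s` to `a × s̄`, then `⟨h, s⟩ s̄ = ⟨h, s̄⟩ s`. -/
lemma conj_proportional (H : IsConformalFrame p a b ρ)
    (hD : 1 - dotC p (meanVec a b ρ) ^ 2 ≠ 0) {s : C7} (sp : dotC p s = 0) (sa : dotC a s = 0)
    (sb : dotC b s = 0) (sN : dotC (crossC p (meanVec a b ρ)) s = 0)
    (hT : dotC s (crossC p (crossC a (conjC s))) = 0) :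
    dotC (meanVec a b ρ) s • conjC s = dotC (meanVec a b ρ) (conjC s) • s := by
  obtain ⟨α, β, γ, hs, hγ⟩ := H.exists_eps_expansion hD sp sa sb sN
  obtain ⟨e1, e2, e3, e4, e5, e6, e7, e8, e9⟩ := H.eps_dots rfl
  have ht : conjC s = (starRingEnd ℂ α) • epsVec p b (-dotC p (meanVec a b ρ)) +
      (starRingEnd ℂ β) • epsVec p a (dotC p (meanVec a b ρ)) +
      (starRingEnd ℂ γ) • crossC p (crossC p (meanVec a b ρ)) := by
    rw [hs, conjC_add, conjC_add, conjC_smul, conjC_smul, conjC_smul, H.conj_eps, H.conj_eps',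
      H.conj_M]
  have hγ' : starRingEnd ℂ γ * (1 - dotC p (meanVec a b ρ) ^ 2) =
      -dotC (meanVec a b ρ) (conjC s) := by
    have := congrArg (starRingEnd ℂ) hγ
    rwa [map_neg, ← dotC_conjC, H.conj_mean, map_mul, map_sub, map_pow, H.conj_theta, map_one]
      at this
  have hpM : dotC p (crossC p (crossC p (meanVec a b ρ))) = 0 := dotC_crossC_self_left _ _
  have haM : dotC a (crossC p (crossC p (meanVec a b ρ))) = 0 := by
    rw [H.p_cross_N, dotC_sub_right, dotC_smul_right, H.ap, dotC_comm a, H.mean_a]; simp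
  have hMe : dotC (crossC p (crossC p (meanVec a b ρ))) (epsVec p a (dotC p (meanVec a b ρ))) = 0 := by
    rw [H.p_cross_N, dotC_sub_left, dotC_smul_left, e1, dotC_comm (meanVec a b ρ) (epsVec _ _ _),
      H.eps_mean]; simp
  have hTM := H.p_cross_a_cross_M
  have hρ := H.ne
  have hae := H.a_cross_eps (dotC p (meanVec a b ρ))
  have s1 := H.dotC_pCross_aCross_swap e1 e3 e2 e4
  have s2 := H.dotC_pCross_aCross_swap hpM haM e2 e4
  have s3 := H.dotC_pCross_aCross_swap e2 e4 e2 e4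
  set θ := dotC p (meanVec a b ρ) with hθ
  set M := crossC p (crossC p (meanVec a b ρ))
  rw [hae, crossC_zero_right, dotC_zero_right, neg_zero] at s1
  rw [hTM, dotC_smul_right, dotC_comm (epsVec p b (-θ)) (epsVec p a θ), e8] at s2
  have s4 : dotC (epsVec p b (-θ)) (crossC p (crossC a (epsVec p b (-θ)))) = 0 := by
    linear_combination (1 / 2 : ℂ) * s3
  -- Of all terms of `⟨s, T s̄⟩` only those pairing `M` with `ε̄` survive, namely `iρ(1 - θ²)(γ̄β -
  -- ᾱγ)`.
  have hprop : starRingEnd ℂ γ * β = starRingEnd ℂ α * γ := by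
    rw [ht] at hT
    nth_rewrite 1 [hs] at hT
    simp only [crossC_add_right, crossC_smul_right, dotC_add_right, dotC_add_left, dotC_smul_left,
      dotC_smul_right, hae, hTM, crossC_zero_right, dotC_zero_right, s1, s2, s4, e7, hMe,
      dotC_comm (epsVec p b (-θ)) (epsVec p a θ), e8] at hT
    have h0 : I * (ρ * (1 - θ ^ 2)) ≠ 0 := mul_ne_zero I_ne_zero (mul_ne_zero hρ hD)
    apply mul_right_cancel₀ h0
    linear_combination hT
  have hprop' : γ * starRingEnd ℂ β = α * starRingEnd ℂ γ := by
    simpa using congrArg (starRingEnd ℂ) hprop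
  have h1 : dotC (meanVec a b ρ) s = -(γ * (1 - θ ^ 2)) := by rw [hγ, neg_neg]
  have h2 : dotC (meanVec a b ρ) (conjC s) = -(starRingEnd ℂ γ * (1 - θ ^ 2)) := by
    rw [hγ', neg_neg]
  rw [h1, h2, ht]
  nth_rewrite 1 [hs]
  linear_combination (norm := module) (-(1 - θ ^ 2)) • hprop' • epsVec p a θ +
    (1 - θ ^ 2) • hprop • epsVec p b (-θ)

/-- If `s` is orthogonal to `N ≠ 0`, to `h` and to `∂h/∂z̄`, then `b × s = 0`. -/
lemma cross_eq_zero (H : IsConformalFrame p a b ρ)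
    (hD : 1 - dotC p (meanVec a b ρ) ^ 2 ≠ 0) {s : C7} (sp : dotC p s = 0) (sa : dotC a s = 0)
    (sb : dotC b s = 0) (sN : dotC (crossC p (meanVec a b ρ)) s = 0)
    (sh : dotC (meanVec a b ρ) s = 0)
    (hz : dotC (I • crossC p b - (I / ρ) • crossC a (conjC s)) s = 0) : crossC b s = 0 := by
  obtain ⟨α, β, γ, hs, hγ⟩ := H.exists_eps_expansion hD sp sa sb sN
  obtain ⟨e1, e2, e3, e4, e5, e6, e7, e8, e9⟩ := H.eps_dots rfl
  obtain ⟨d1, d2, d3, d4⟩ := H.pCross_dots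
  have hγ0 : γ = 0 := by
    rw [sh, neg_zero] at hγ
    exact (mul_eq_zero.1 hγ).resolve_right hD
  rw [hγ0, zero_smul, add_zero] at hs
  have ht : conjC s = (starRingEnd ℂ α) • epsVec p b (-dotC p (meanVec a b ρ)) +
      (starRingEnd ℂ β) • epsVec p a (dotC p (meanVec a b ρ)) := by
    rw [hs, conjC_add, conjC_smul, conjC_smul, H.conj_eps, H.conj_eps']
  have hae := H.a_cross_eps (dotC p (meanVec a b ρ))
  have hbe := H.b_cross_eps (-dotC p (meanVec a b ρ))
  have hba := H.pCrossB_a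
  have hρ := H.ne
  set θ := dotC p (meanVec a b ρ) with hθ
  -- By cyclic symmetry of the triple product this pairs `ε̄` with `a × ε`, which is zero.
  have h1 : dotC (crossC a (epsVec p b (-θ))) (epsVec p a θ) = 0 := by
    rw [dotC_comm, dotC_crossC_cycle, dotC_crossC_cycle, crossC_anticomm, hae]; simp
  have h2 : dotC (crossC a (epsVec p b (-θ))) (epsVec p b (-θ)) = 0 := by
    rw [dotC_comm, dotC_crossC_self_right]
  have h3 : dotC (crossC p b) (epsVec p a θ) = ρ * (1 - θ ^ 2) := by
    rw [epsVec, dotC_sub_right, d3, dotC_smul_right, hba]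
    linear_combination (ρ * θ ^ 2) * I_sq
  have h4 : dotC (crossC p b) (epsVec p b (-θ)) = 0 := by
    rw [epsVec, dotC_sub_right, d4, dotC_smul_right, dotC_comm, dotC_crossC_self_right]; ring
  have h5 : crossC a (conjC s) = (starRingEnd ℂ α) • crossC a (epsVec p b (-θ)) := by
    rw [ht, crossC_add_right, crossC_smul_right, crossC_smul_right, hae, smul_zero, add_zero]
  -- With `γ = 0` the condition on `∂h/∂z̄` collapses to `iρ(1 - θ²) α = 0`. What remains of `s` is
  -- a multiple of `ε̄`, and `b × ε̄ = 0`.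
  have hα : α = 0 := by
    rw [h5, hs] at hz
    simp only [dotC_sub_left, dotC_add_right, dotC_smul_left, dotC_smul_right, h1, h2, h3, h4] at hz
    have h0 : I * (ρ * (1 - θ ^ 2)) ≠ 0 := mul_ne_zero I_ne_zero (mul_ne_zero hρ hD)
    apply mul_right_cancel₀ h0
    linear_combination hz
  rw [hs, hα, zero_smul, zero_add, crossC_smul_right, hbe, smul_zero]

end IsConformalFrame
end SixSphere

namespace SixSphere

open Complex

/-! ### Wirtinger derivatives -/

section Wirtinger

variable {E F G : Type*} [NormedAddCommGroup E] [NormedSpace ℝ E] [NormedSpace ℂ E]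
  [IsScalarTower ℝ ℂ E] [NormedAddCommGroup F] [NormedSpace ℝ F] [NormedSpace ℂ F]
  [IsScalarTower ℝ ℂ F] [NormedAddCommGroup G] [NormedSpace ℝ G] [NormedSpace ℂ G]
  [IsScalarTower ℝ ℂ G]

/-- The operator `½ (∂/∂x + σ ∂/∂y)`, which is `∂/∂z` for `σ = -i` and `∂/∂z̄` for `σ = i`. -/
noncomputable def wirt (σ : ℂ) (f : ℂ → E) (z : ℂ) : E :=
  (1 / 2 : ℂ) • (fderiv ℝ f z 1 + σ • fderiv ℝ f z I)

/-- The operator `∂/∂z`. -/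
noncomputable abbrev dz (f : ℂ → E) : ℂ → E := wirt (-I) f

/-- The operator `∂/∂z̄`. -/
noncomputable abbrev dzb (f : ℂ → E) : ℂ → E := wirt I f

lemma delZ_eq_dz (f : ℂ → C7) : delZ f = dz f := by
  ext1 z; simp only [delZ, dz, wirt, neg_smul, sub_eq_add_neg]

lemma fderiv_apply_eq (f : ℂ → E) (z v : ℂ) :
    fderiv ℝ f z v = v • dz f z + (starRingEnd ℂ v) • dzb f z := by
  have hv : v = v.re • (1 : ℂ) + v.im • I := by simp
  have h1 : fderiv ℝ f z v = (v.re : ℂ) • fderiv ℝ f z 1 + (v.im : ℂ) • fderiv ℝ f z I := by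
    have hs : ∀ (r : ℝ) (x : E), (r : ℂ) • x = r • x := fun r x => algebraMap_smul ℂ r x
    conv_lhs => rw [hv]
    rw [map_add, map_smul, map_smul, hs, hs]
  have hc : starRingEnd ℂ v = v.re - v.im * I := by
    apply Complex.ext <;> simp
  have hv' : v = v.re + v.im * I := (Complex.re_add_im v).symm
  simp only [h1, dz, dzb, wirt]
  rw [hc]
  nth_rewrite 3 [hv']
  simp only [smul_add, smul_smul]
  match_scalars
  · ring
  · linear_combination (v.im : ℂ) * I_sq

lemma fderiv_one_eq (f : ℂ → E) (z : ℂ) : fderiv ℝ f z 1 = dz f z + dzb f z := by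
  simp [fderiv_apply_eq f z 1]

lemma fderiv_I_eq (f : ℂ → E) (z : ℂ) : fderiv ℝ f z I = I • dz f z - I • dzb f z := by
  simp [fderiv_apply_eq f z I, sub_eq_add_neg]

lemma wirt_congr {f g : ℂ → E} {z : ℂ} (σ : ℂ) (h : f =ᶠ[nhds z] g) : wirt σ f z = wirt σ g z := by
  rw [wirt, wirt, h.fderiv_eq]

@[simp] lemma wirt_const (σ : ℂ) (c : E) (z : ℂ) : wirt σ (fun _ => c) z = 0 := by simp [wirt]

lemma wirt_eq_zero_of_eventually_const {f : ℂ → E} {z : ℂ} (σ : ℂ) (c : E)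
    (h : ∀ᶠ w in nhds z, f w = c) : wirt σ f z = 0 := by
  rw [wirt_congr σ (g := fun _ => c) h, wirt_const]

lemma wirt_sub {f g : ℂ → E} {z : ℂ} (σ : ℂ) (hf : DifferentiableAt ℝ f z)
    (hg : DifferentiableAt ℝ g z) : wirt σ (fun w => f w - g w) z = wirt σ f z - wirt σ g z := by
  simp only [wirt, fderiv_fun_sub hf hg, ContinuousLinearMap.sub_apply]; module

lemma wirt_neg (f : ℂ → E) (z : ℂ) (σ : ℂ) : wirt σ (fun w => -f w) z = -wirt σ f z := by
  simp only [wirt, fderiv_fun_neg, ContinuousLinearMap.neg_apply]; module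

lemma wirt_clm (L : E →L[ℂ] F) {f : ℂ → E} {z : ℂ} (σ : ℂ) (hf : DifferentiableAt ℝ f z) :
    wirt σ (fun w => L (f w)) z = L (wirt σ f z) := by
  have h : HasFDerivAt (fun w => L (f w)) ((L.restrictScalars ℝ).comp (fderiv ℝ f z)) z :=
    (L.restrictScalars ℝ).hasFDerivAt.comp z hf.hasFDerivAt
  simp [wirt, h.fderiv]

lemma wirt_bilinear (B : E →L[ℂ] F →L[ℂ] G) {f : ℂ → E} {g : ℂ → F} {z : ℂ} (σ : ℂ)
    (hf : DifferentiableAt ℝ f z) (hg : DifferentiableAt ℝ g z) :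
    wirt σ (fun w => B (f w) (g w)) z = B (wirt σ f z) (g z) + B (f z) (wirt σ g z) := by
  have h := (B.bilinearRestrictScalars ℝ).hasFDerivAt_of_bilinear hf.hasFDerivAt hg.hasFDerivAt
  have h' : fderiv ℝ (fun w => B (f w) (g w)) z = _ := h.fderiv
  simp only [wirt, h']
  simp
  module

lemma contDiffOn_bilinear (B : E →L[ℂ] F →L[ℂ] G) {f : ℂ → E} {g : ℂ → F} {Ω : Set ℂ}
    {n : WithTop ℕ∞} (hf : ContDiffOn ℝ n f Ω) (hg : ContDiffOn ℝ n g Ω) :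
    ContDiffOn ℝ n (fun w => B (f w) (g w)) Ω :=
  ((B.bilinearRestrictScalars ℝ).isBoundedBilinearMap.contDiff (n := n)).comp_contDiffOn
    (hf.prodMk hg)

lemma contDiffOn_wirt {f : ℂ → E} {Ω : Set ℂ} (hΩ : IsOpen Ω) (σ : ℂ) (hf : ContDiffOn ℝ ∞ f Ω) :
    ContDiffOn ℝ ∞ (wirt σ f) Ω := by
  have h : ContDiffOn ℝ ∞ (fun z => fderiv ℝ f z) Ω :=
    hf.fderiv_of_isOpen hΩ (by simp)
  have hs : ∀ c : ℂ, ContDiff ℝ ∞ (fun x : E => c • x) := fun c =>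
    ((c • ContinuousLinearMap.id ℂ E).restrictScalars ℝ).contDiff
  exact (hs _).comp_contDiffOn ((h.clm_apply contDiffOn_const).add
    ((hs σ).comp_contDiffOn (h.clm_apply contDiffOn_const)))

lemma differentiableAt_of_contDiffOn {f : ℂ → E} {Ω : Set ℂ} (hf : ContDiffOn ℝ ∞ f Ω)
    (hΩ : IsOpen Ω) {z : ℂ} (hz : z ∈ Ω) : DifferentiableAt ℝ f z :=
  (hf.contDiffAt (hΩ.mem_nhds hz)).differentiableAt (by simp)

lemma fderiv_wirt {f : ℂ → E} {z : ℂ} (σ v : ℂ) (hf : ContDiffAt ℝ 2 f z) :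
    fderiv ℝ (wirt σ f) z v = (1 / 2 : ℂ) •
      (fderiv ℝ (fderiv ℝ f) z v 1 + σ • fderiv ℝ (fderiv ℝ f) z v I) := by
  have hd : DifferentiableAt ℝ (fderiv ℝ f) z :=
    (hf.fderiv_right (m := 1) (by norm_num)).differentiableAt (by simp)
  have hc : ∀ c : ℂ, ∀ {g : ℂ → E} {g' : ℂ →L[ℝ] E}, HasFDerivAt g g' z →
      HasFDerivAt (fun w => c • g w)
        (((c • ContinuousLinearMap.id ℂ E).restrictScalars ℝ).comp g') z := fun c g g' hg =>
    ((c • ContinuousLinearMap.id ℂ E).restrictScalars ℝ).hasFDerivAt.comp z hg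
  have h1 : ∀ u : ℂ, HasFDerivAt (fun w => fderiv ℝ f w u)
      ((ContinuousLinearMap.apply ℝ E u).comp (fderiv ℝ (fderiv ℝ f) z)) z := fun u =>
    (ContinuousLinearMap.apply ℝ E u).hasFDerivAt.comp z hd.hasFDerivAt
  have h2 := hc (1 / 2) ((h1 1).add (hc σ (h1 I)))
  have h3 : fderiv ℝ (wirt σ f) z = _ := h2.fderiv
  rw [h3]
  simp

/-- Keeping `σ` and `τ` free makes the expression visibly symmetric in them, which gives
commutation. The values `i, -i` give a quarter of the Laplacian, and `-i, -i` the Hopf type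
combination. -/
lemma wirt_wirt {f : ℂ → E} {z : ℂ} (σ τ : ℂ) (hf : ContDiffAt ℝ 2 f z) :
    wirt σ (wirt τ f) z = (1 / 4 : ℂ) • (fderiv ℝ (fderiv ℝ f) z 1 1 +
      (σ + τ) • fderiv ℝ (fderiv ℝ f) z 1 I + (σ * τ) • fderiv ℝ (fderiv ℝ f) z I I) := by
  have hs : IsSymmSndFDerivAt ℝ f z := hf.isSymmSndFDerivAt (by simp)
  rw [wirt, fderiv_wirt τ _ hf, fderiv_wirt τ _ hf, hs.eq I 1]
  module

lemma wirt_comm {f : ℂ → E} {z : ℂ} (σ τ : ℂ) (hf : ContDiffAt ℝ 2 f z) :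
    wirt σ (wirt τ f) z = wirt τ (wirt σ f) z := by
  rw [wirt_wirt σ τ hf, wirt_wirt τ σ hf]
  module

end Wirtinger

/-- The bilinear extension of the inner product as a continuous bilinear map. -/
noncomputable def dotL : C7 →L[ℂ] C7 →L[ℂ] ℂ :=
  (LinearMap.mk₂ ℂ dotC dotC_add_left dotC_smul_left (fun x y z => dotC_add_right y z x)
    (fun c x y => dotC_smul_right c x y)).toContinuousBilinearMap

@[simp] lemma dotL_apply (x y : C7) : dotL x y = dotC x y := rfl

/-- The complex cross product as a continuous bilinear map. -/
noncomputable def crossL : C7 →L[ℂ] C7 →L[ℂ] C7 :=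
  (LinearMap.mk₂ ℂ crossC crossC_add_left crossC_smul_left (fun x y z => crossC_add_right y z x)
    (fun c x y => crossC_smul_right c x y)).toContinuousBilinearMap

/-- Conjugation of complex vectors as a continuous real linear map. -/
noncomputable def conjL : C7 →L[ℝ] C7 :=
  LinearMap.toContinuousLinearMap
    { toFun := conjC
      map_add' := conjC_add
      map_smul' := fun c x => by ext i; simp }

@[simp] lemma conjL_apply (x : C7) : conjL x = conjC x := rfl

section Rules

variable {f g : ℂ → C7} {c d : ℂ → ℂ} {z : ℂ} {Ω : Set ℂ}

lemma wirt_dotC (σ : ℂ) (hf : DifferentiableAt ℝ f z) (hg : DifferentiableAt ℝ g z) :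
    wirt σ (fun w => dotC (f w) (g w)) z = dotC (wirt σ f z) (g z) + dotC (f z) (wirt σ g z) :=
  wirt_bilinear dotL σ hf hg

lemma wirt_crossC (σ : ℂ) (hf : DifferentiableAt ℝ f z) (hg : DifferentiableAt ℝ g z) :
    wirt σ (fun w => crossC (f w) (g w)) z =
      crossC (wirt σ f z) (g z) + crossC (f z) (wirt σ g z) :=
  wirt_bilinear crossL σ hf hg

lemma wirt_smul (σ : ℂ) (hc : DifferentiableAt ℝ c z) (hf : DifferentiableAt ℝ f z) :
    wirt σ (fun w => c w • f w) z = wirt σ c z • f z + c z • wirt σ f z :=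
  wirt_bilinear (ContinuousLinearMap.lsmul ℂ ℂ) σ hc hf

lemma wirt_mul (σ : ℂ) (hc : DifferentiableAt ℝ c z) (hd : DifferentiableAt ℝ d z) :
    wirt σ (fun w => c w * d w) z = wirt σ c z * d z + c z * wirt σ d z :=
  wirt_bilinear (ContinuousLinearMap.mul ℂ ℂ) σ hc hd

lemma wirt_conjC (σ : ℂ) (hf : DifferentiableAt ℝ f z) :
    wirt σ (fun w => conjC (f w)) z = conjC (wirt (starRingEnd ℂ σ) f z) := by
  have h : HasFDerivAt (fun w => conjC (f w)) (conjL.comp (fderiv ℝ f z)) z :=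
    conjL.hasFDerivAt.comp z hf.hasFDerivAt
  simp [wirt, h.fderiv, conjC_smul, conjC_add, Complex.conj_ofNat]

lemma contDiffOn_dotC (hf : ContDiffOn ℝ ∞ f Ω) (hg : ContDiffOn ℝ ∞ g Ω) :
    ContDiffOn ℝ ∞ (fun w => dotC (f w) (g w)) Ω := contDiffOn_bilinear dotL hf hg

lemma contDiffOn_crossC (hf : ContDiffOn ℝ ∞ f Ω) (hg : ContDiffOn ℝ ∞ g Ω) :
    ContDiffOn ℝ ∞ (fun w => crossC (f w) (g w)) Ω := contDiffOn_bilinear crossL hf hg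

lemma contDiffOn_smulC (hc : ContDiffOn ℝ ∞ c Ω) (hf : ContDiffOn ℝ ∞ f Ω) :
    ContDiffOn ℝ ∞ (fun w => c w • f w) Ω :=
  contDiffOn_bilinear (ContinuousLinearMap.lsmul ℂ ℂ) hc hf

lemma contDiffOn_div (hc : ContDiffOn ℝ ∞ c Ω) (hd : ContDiffOn ℝ ∞ d Ω)
    (h0 : ∀ w ∈ Ω, d w ≠ 0) : ContDiffOn ℝ ∞ (fun w => c w / d w) Ω := by
  simp only [div_eq_mul_inv]
  exact hc.mul (hd.inv h0)

lemma contDiffOn_conjC (hf : ContDiffOn ℝ ∞ f Ω) : ContDiffOn ℝ ∞ (fun w => conjC (f w)) Ω :=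
  conjL.contDiff.comp_contDiffOn hf

end Rules

end SixSphere

namespace SixSphere

open Complex

/-! ### Minimal surfaces in `S⁶` in a conformal coordinate -/

/-- `P` is a conformal harmonic immersion of the open set `Ω` into `S⁶`, in complex notation. -/
structure IsMinimalChart (Ω : Set ℂ) (P : ℂ → C7) : Prop where
  isOpen : IsOpen Ω
  smooth : ContDiffOn ℝ ∞ P Ω
  conj_eq : ∀ z ∈ Ω, conjC (P z) = P z
  sphere : ∀ z ∈ Ω, dotC (P z) (P z) = 1
  conformal : ∀ z ∈ Ω, dotC (dz P z) (dz P z) = 0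
  immersion : ∀ z ∈ Ω, dotC (dz P z) (dzb P z) ≠ 0
  harmonic : ∀ z ∈ Ω, dzb (dz P) z = -(dotC (dz P z) (dzb P z)) • P z

/-- The conformal factor `⟨P_z, P_z̄⟩`. -/
noncomputable def confFactor (P : ℂ → C7) (z : ℂ) : ℂ := dotC (dz P z) (dzb P z)

/-- The local section `f₂` of the second element of the harmonic sequence. -/
noncomputable def secondSection (P : ℂ → C7) (z : ℂ) : C7 :=
  dz (dz P) z - (dz (confFactor P) z / confFactor P z) • dz P z

/-- The mean curvature vector of the associated surface. -/
noncomputable def meanField (P : ℂ → C7) (z : ℂ) : C7 :=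
  meanVec (dz P z) (dzb P z) (confFactor P z)

lemma two_le_infty : (2 : WithTop ℕ∞) ≤ ∞ :=
  WithTop.coe_le_coe.2 (le_top : (2 : ℕ∞) ≤ ⊤)

namespace IsMinimalChart

variable {Ω : Set ℂ} {P : ℂ → C7} {z : ℂ}

lemma eventually (H : IsMinimalChart Ω P) (hz : z ∈ Ω) : ∀ᶠ w in nhds z, w ∈ Ω :=
  H.isOpen.mem_nhds hz

lemma smooth_wirt (H : IsMinimalChart Ω P) (σ : ℂ) : ContDiffOn ℝ ∞ (wirt σ P) Ω :=
  contDiffOn_wirt H.isOpen σ H.smooth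

lemma smooth_confFactor (H : IsMinimalChart Ω P) : ContDiffOn ℝ ∞ (confFactor P) Ω :=
  contDiffOn_dotC (H.smooth_wirt _) (H.smooth_wirt _)

lemma smooth_logDeriv (H : IsMinimalChart Ω P) :
    ContDiffOn ℝ ∞ (fun z => dz (confFactor P) z / confFactor P z) Ω :=
  contDiffOn_div (contDiffOn_wirt H.isOpen _ H.smooth_confFactor) H.smooth_confFactor H.immersion

lemma smooth_secondSection (H : IsMinimalChart Ω P) : ContDiffOn ℝ ∞ (secondSection P) Ω :=
  (contDiffOn_wirt H.isOpen _ (H.smooth_wirt _)).sub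
    (contDiffOn_smulC H.smooth_logDeriv (H.smooth_wirt _))

lemma smooth_meanField (H : IsMinimalChart Ω P) : ContDiffOn ℝ ∞ (meanField P) Ω :=
  contDiffOn_smulC (contDiffOn_div contDiffOn_const H.smooth_confFactor H.immersion)
    (contDiffOn_crossC (H.smooth_wirt _) (H.smooth_wirt _))

lemma diff (H : IsMinimalChart Ω P) (hz : z ∈ Ω) : DifferentiableAt ℝ P z :=
  differentiableAt_of_contDiffOn H.smooth H.isOpen hz

lemma diff_wirt (H : IsMinimalChart Ω P) (hz : z ∈ Ω) (σ : ℂ) : DifferentiableAt ℝ (wirt σ P) z :=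
  differentiableAt_of_contDiffOn (H.smooth_wirt σ) H.isOpen hz

lemma diff_confFactor (H : IsMinimalChart Ω P) (hz : z ∈ Ω) :
    DifferentiableAt ℝ (confFactor P) z :=
  differentiableAt_of_contDiffOn H.smooth_confFactor H.isOpen hz

lemma diff_secondSection (H : IsMinimalChart Ω P) (hz : z ∈ Ω) :
    DifferentiableAt ℝ (secondSection P) z :=
  differentiableAt_of_contDiffOn H.smooth_secondSection H.isOpen hz

lemma diff_meanField (H : IsMinimalChart Ω P) (hz : z ∈ Ω) :
    DifferentiableAt ℝ (meanField P) z :=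
  differentiableAt_of_contDiffOn H.smooth_meanField H.isOpen hz

lemma diff_conj_secondSection (H : IsMinimalChart Ω P) (hz : z ∈ Ω) :
    DifferentiableAt ℝ (fun w => conjC (secondSection P w)) z :=
  differentiableAt_of_contDiffOn (contDiffOn_conjC H.smooth_secondSection) H.isOpen hz

lemma conj_dz (H : IsMinimalChart Ω P) (hz : z ∈ Ω) : conjC (dz P z) = dzb P z := by
  have h1 : dzb (fun w => conjC (P w)) z = dzb P z :=
    wirt_congr _ ((H.eventually hz).mono fun w hw => H.conj_eq w hw)
  rw [← h1, dzb, wirt_conjC _ (H.diff hz), conj_I]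

/-- Differentiating a scalar product of two vector fields which is constant on the chart. -/
lemma dotC_deriv_eq_zero (H : IsMinimalChart Ω P) (hz : z ∈ Ω) (σ : ℂ) {f g : ℂ → C7} {c : ℂ}
    (hf : DifferentiableAt ℝ f z) (hg : DifferentiableAt ℝ g z)
    (h : ∀ w ∈ Ω, dotC (f w) (g w) = c) :
    dotC (wirt σ f z) (g z) + dotC (f z) (wirt σ g z) = 0 := by
  rw [← wirt_dotC σ hf hg]
  exact wirt_eq_zero_of_eventually_const σ c ((H.eventually hz).mono fun w hw => h w hw)

lemma dot_wirt (H : IsMinimalChart Ω P) (hz : z ∈ Ω) (σ : ℂ) : dotC (P z) (wirt σ P z) = 0 := by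
  have h := H.dotC_deriv_eq_zero hz σ (H.diff hz) (H.diff hz) H.sphere
  rw [dotC_comm (wirt σ P z)] at h
  linear_combination (1 / 2 : ℂ) * h

lemma frame (H : IsMinimalChart Ω P) (hz : z ∈ Ω) :
    IsConformalFrame (P z) (dz P z) (dzb P z) (confFactor P z) where
  pp := H.sphere z hz
  pa := H.dot_wirt hz _
  pb := H.dot_wirt hz _
  aa := H.conformal z hz
  bb := by rw [← H.conj_dz hz, dotC_conjC, H.conformal z hz, map_zero]
  ab := rfl
  ne := H.immersion z hz
  conj_p := H.conj_eq z hz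
  conj_a := H.conj_dz hz

lemma dz_dzb (H : IsMinimalChart Ω P) (hz : z ∈ Ω) : dz (dzb P) z = -confFactor P z • P z := by
  rw [dz, dzb, wirt_comm (-I) I ((H.smooth.contDiffAt (H.isOpen.mem_nhds hz)).of_le two_le_infty)]
  exact H.harmonic z hz

lemma dot_dz_dz (H : IsMinimalChart Ω P) (hz : z ∈ Ω) : dotC (P z) (dz (dz P) z) = 0 := by
  have h := H.dotC_deriv_eq_zero hz (-I) (H.diff hz) (H.diff_wirt hz (-I))
    (fun w hw => H.dot_wirt hw _)
  rwa [H.conformal z hz, zero_add] at h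

lemma dz_dot_dz_dz (H : IsMinimalChart Ω P) (hz : z ∈ Ω) : dotC (dz P z) (dz (dz P) z) = 0 := by
  have h := H.dotC_deriv_eq_zero hz (-I) (H.diff_wirt hz (-I)) (H.diff_wirt hz (-I)) H.conformal
  rw [dotC_comm] at h
  linear_combination (1 / 2 : ℂ) * h

lemma dz_confFactor (H : IsMinimalChart Ω P) (hz : z ∈ Ω) :
    dz (confFactor P) z = dotC (dzb P z) (dz (dz P) z) := by
  have h : dz (confFactor P) z = dotC (dz (dz P) z) (dzb P z) + dotC (dz P z) (dz (dzb P) z) :=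
    wirt_dotC (-I) (H.diff_wirt hz (-I)) (H.diff_wirt hz I)
  rw [h, H.dz_dzb hz, dotC_smul_right, (H.frame hz).ap, mul_zero, add_zero, dotC_comm]

lemma dot_secondSection (H : IsMinimalChart Ω P) (hz : z ∈ Ω) :
    dotC (P z) (secondSection P z) = 0 := by
  rw [secondSection, dotC_sub_right, dotC_smul_right, H.dot_dz_dz hz, (H.frame hz).pa]; simp

lemma dz_dot_secondSection (H : IsMinimalChart Ω P) (hz : z ∈ Ω) :
    dotC (dz P z) (secondSection P z) = 0 := by
  rw [secondSection, dotC_sub_right, dotC_smul_right, H.dz_dot_dz_dz hz, (H.frame hz).aa]; simp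

lemma dzb_dot_secondSection (H : IsMinimalChart Ω P) (hz : z ∈ Ω) :
    dotC (dzb P z) (secondSection P z) = 0 := by
  rw [secondSection, dotC_sub_right, dotC_smul_right, (H.frame hz).ba, ← H.dz_confFactor hz,
    div_mul_cancel₀ _ (H.frame hz).ne, sub_self]

lemma dz_dz_eq (z : ℂ) : dz (dz P) z =
    secondSection P z + (dz (confFactor P) z / confFactor P z) • dz P z := by
  rw [secondSection, sub_add_cancel]

/-- Harmonicity gives `∂_z̄ P_zz = ∂_z(-ρP) = -ρ_z P - ρ P_z`. The correction term in `f₂`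
contributes `+ρ_z P`, so only a tangential multiple of `P_z` is left. -/
lemma dzb_secondSection (H : IsMinimalChart Ω P) (hz : z ∈ Ω) :
    ∃ μ : ℂ, dzb (secondSection P) z = μ • dz P z := by
  have hq : DifferentiableAt ℝ (fun z => dz (confFactor P) z / confFactor P z) z :=
    differentiableAt_of_contDiffOn H.smooth_logDeriv H.isOpen hz
  have hdd : DifferentiableAt ℝ (dz (dz P)) z :=
    differentiableAt_of_contDiffOn (contDiffOn_wirt H.isOpen _ (H.smooth_wirt _)) H.isOpen hz
  have h1 : dzb (secondSection P) z = _ :=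
    wirt_sub I hdd (hq.smul (H.diff_wirt hz (-I)))
  have h2 : wirt I (dz (dz P)) z = dz (fun w => -confFactor P w • P w) z := by
    rw [dz, wirt_comm I (-I) (((H.smooth_wirt (-I)).contDiffAt (H.isOpen.mem_nhds hz)).of_le
      two_le_infty)]
    exact wirt_congr _ ((H.eventually hz).mono fun w hw => H.harmonic w hw)
  have h3 : dz (fun w => -confFactor P w • P w) z = _ :=
    wirt_smul (-I) (H.diff_confFactor hz).neg (H.diff hz)
  have h4 := wirt_smul I hq (H.diff_wirt hz (-I))
  have h5 : wirt I (dz P) z = -confFactor P z • P z := H.harmonic z hz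
  have h6 : wirt (-I) (fun w => -confFactor P w) z = -dz (confFactor P) z := wirt_neg _ _ _
  have h7 : dz (confFactor P) z / confFactor P z * -confFactor P z = -dz (confFactor P) z := by
    rw [mul_neg, div_mul_cancel₀ _ (H.frame hz).ne]
  refine ⟨-confFactor P z - wirt I (fun z => dz (confFactor P) z / confFactor P z) z, ?_⟩
  rw [h1, h2, h3, h4, h5, h6, smul_smul, h7]
  module

lemma dz_conj_secondSection (H : IsMinimalChart Ω P) (hz : z ∈ Ω) :
    ∃ μ : ℂ, dz (fun w => conjC (secondSection P w)) z = μ • dzb P z := by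
  obtain ⟨μ, hμ⟩ := H.dzb_secondSection hz
  refine ⟨starRingEnd ℂ μ, ?_⟩
  rw [dz, wirt_conjC _ (H.diff_secondSection hz), map_neg, conj_I, neg_neg]
  rw [show wirt I (secondSection P) z = _ from hμ, conjC_smul, H.conj_dz hz]

lemma dz_meanField (H : IsMinimalChart Ω P) (hz : z ∈ Ω) :
    dz (meanField P) z = (I / confFactor P z) • crossC (dzb P z) (secondSection P z) -
      I • crossC (P z) (dz P z) := by
  have hρ := (H.frame hz).ne
  -- Differentiating `ρ h = i b × a` avoids the derivative of a quotient. The terms in `ρ_z` cancel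
  -- against the tangential part of `P_zz`.
  have h1 : dz (fun w => confFactor P w • meanField P w) z =
      dz (fun w => crossC (I • dzb P w) (dz P w)) z := by
    refine wirt_congr _ ((H.eventually hz).mono fun w hw => ?_)
    have := (H.frame hw).ne
    simp only [meanField, meanVec, smul_smul, crossC_smul_left]
    congr 1; field_simp
  have e1 := wirt_smul (-I) (H.diff_confFactor hz) (H.diff_meanField hz)
  have e2 := wirt_crossC (-I) (f := fun w => I • dzb P w) (g := dz P)
    ((H.diff_wirt hz I).const_smul I) (H.diff_wirt hz (-I))
  replace h1 := e1.symm.trans (h1.trans e2)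
  have h2 : wirt (-I) (fun w => I • dzb P w) z = I • dz (dzb P) z :=
    wirt_clm (I • ContinuousLinearMap.id ℂ C7) (-I) (H.diff_wirt hz I)
  have h3 : confFactor P z • wirt (-I) (meanField P) z =
      confFactor P z • ((I / confFactor P z) • crossC (dzb P z) (secondSection P z) -
      I • crossC (P z) (dz P z)) := by
    rw [← eq_sub_iff_add_eq'] at h1
    rw [h1, h2, H.dz_dzb hz, show wirt (-I) (dz P) z = _ from dz_dz_eq z, meanField, meanVec]
    simp only [crossC_smul_left, crossC_smul_right, crossC_add_right, smul_add, smul_sub,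
      smul_smul]
    match_scalars <;> field_simp <;> ring
  exact smul_right_injective C7 hρ h3

lemma dzb_meanField (H : IsMinimalChart Ω P) (hz : z ∈ Ω) :
    dzb (meanField P) z = I • crossC (P z) (dzb P z) -
      (I / confFactor P z) • crossC (dz P z) (conjC (secondSection P z)) := by
  have h1 : dzb (fun w => conjC (meanField P w)) z = dzb (meanField P) z :=
    wirt_congr _ ((H.eventually hz).mono fun w hw => (H.frame hw).conj_mean)
  rw [← h1, dzb, wirt_conjC _ (H.diff_meanField hz), conj_I]
  rw [show wirt (-I) (meanField P) z = _ from H.dz_meanField hz, conjC_sub, conjC_smul, conjC_smul,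
    conjC_crossC, conjC_crossC, H.conj_eq z hz, H.conj_dz hz, (H.frame hz).conj_b, map_div₀,
    (H.frame hz).conj_rho, conj_I]
  module

/-- The derivative with respect to `z̄` of the equation `⟨N, f₂⟩ = 0`. -/
lemma dotC_pCross_aCross_conj (H : IsMinimalChart Ω P)
    (hN : ∀ w ∈ Ω, dotC (crossC (P w) (meanField P w)) (secondSection P w) = 0) (hz : z ∈ Ω) :
    dotC (secondSection P z)
      (crossC (P z) (crossC (dz P z) (conjC (secondSection P z)))) = 0 := by
  have h := H.dotC_deriv_eq_zero hz I
    (differentiableAt_of_contDiffOn (contDiffOn_crossC H.smooth H.smooth_meanField) H.isOpen hz)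
    (H.diff_secondSection hz) hN
  obtain ⟨μ, hμ⟩ := H.dzb_secondSection hz
  have F := H.frame hz
  have hN' : dotC (crossC (P z) (meanField P z)) (dz P z) = 0 := by rw [dotC_comm]; exact F.a_N
  have hbm : crossC (dzb P z) (meanField P z) = I • dzb P z := F.cross_b_mean
  rw [show wirt I (secondSection P) z = _ from hμ, dotC_smul_right, hN', mul_zero, add_zero,
    wirt_crossC I (H.diff hz) (H.diff_meanField hz), dotC_add_left,
    show wirt I P z = dzb P z from rfl, hbm, show wirt I (meanField P) z = _ from H.dzb_meanField hz,
    crossC_sub_right, crossC_smul_right, crossC_smul_right, F.p_cross_b, dotC_smul_left,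
    dotC_sub_left, dotC_smul_left, dotC_smul_left, dotC_neg_left, H.dzb_dot_secondSection hz] at h
  have h0 : I / confFactor P z ≠ 0 := div_ne_zero I_ne_zero F.ne
  rw [dotC_comm]
  apply mul_left_cancel₀ h0
  linear_combination -h

/-- Where `N` vanishes, `h = θP` with `θ² = 1`. Then `θ_z = 0`, so `h_z = θ a`, while `P × a = iθ
a`. Comparison with the general formula for `h_z` leaves only the term in `b × f₂`, which must
vanish. -/
lemma cross_eq_zero_of_normal_eq_zero (H : IsMinimalChart Ω P) (hz : z ∈ Ω)
    (hN : ∀ᶠ w in nhds z, 1 - dotC (P w) (meanField P w) ^ 2 = 0) :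
    crossC (dzb P z) (secondSection P z) = 0 := by
  have key : ∀ w ∈ Ω, 1 - dotC (P w) (meanField P w) ^ 2 = 0 →
      meanField P w = dotC (P w) (meanField P w) • P w := by
    intro w hw h
    have F := H.frame hw
    have h1 : crossC (P w) (meanField P w) = 0 := by
      rw [← dotC_conjC_self_eq_zero]
      have := F.conj_N
      rw [show conjC (crossC (P w) (meanField P w)) = _ from this]
      exact F.N_N.trans h
    have h2 : _ = dotC (P w) (meanField P w) • P w - meanField P w := F.p_cross_N
    rw [show crossC (P w) (meanVec (dz P w) (dzb P w) (confFactor P w)) = 0 from h1,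
      crossC_zero_right] at h2
    exact (sub_eq_zero.1 h2.symm).symm
  have F := H.frame hz
  have hdθ : DifferentiableAt ℝ (fun w => dotC (P w) (meanField P w)) z :=
    differentiableAt_of_contDiffOn (contDiffOn_dotC H.smooth H.smooth_meanField) H.isOpen hz
  have h1 : dz (meanField P) z = dz (fun w => dotC (P w) (meanField P w) • P w) z :=
    wirt_congr _ (((H.eventually hz).and hN).mono fun w hw => key w hw.1 hw.2)
  have h2 : dz (fun w => dotC (P w) (meanField P w) * dotC (P w) (meanField P w)) z = 0 :=
    wirt_eq_zero_of_eventually_const _ 1 (hN.mono fun w hw => by linear_combination -hw)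
  rw [dz, wirt_mul (-I) hdθ hdθ] at h2
  replace h1 := h1.trans (wirt_smul (-I) hdθ (H.diff hz))
  rw [H.dz_meanField hz] at h1
  have hz0 := hN.self_of_nhds
  have h3 := F.cross_a_mean
  rw [show meanVec (dz P z) (dzb P z) (confFactor P z) = _ from key z hz hz0,
    crossC_smul_right] at h3
  set θ := dotC (P z) (meanField P z)
  have hθ : θ ≠ 0 := by intro h; rw [h] at hz0; simp at hz0
  have h4 : wirt (-I) (fun w => dotC (P w) (meanField P w)) z = 0 := by
    apply mul_left_cancel₀ hθ; linear_combination (1 / 2 : ℂ) * h2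
  have h5 : crossC (P z) (dz P z) = (I * θ) • dz P z := by
    apply smul_right_injective C7 hθ
    change θ • _ = θ • _
    rw [crossC_anticomm, smul_neg, h3, neg_neg, smul_smul]
    congr 1; linear_combination I * hz0
  rw [h4, h5, zero_smul, zero_add, smul_smul, ← mul_assoc, I_mul_I, sub_eq_iff_eq_add] at h1
  have h6 : (I / confFactor P z) • crossC (dzb P z) (secondSection P z) = 0 := by
    rw [h1]; module
  exact (smul_eq_zero.1 h6).resolve_left (div_ne_zero I_ne_zero F.ne)

/-- If `⟨N, f₂⟩ = 0` on the chart and `∂h/∂z` is not tangential somewhere, then there is a non-empty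
open set where `f₂` is a multiple of a real vector which is not orthogonal to `h`. -/
lemma exists_open_conj_proportional (H : IsMinimalChart Ω P)
    (hN : ∀ w ∈ Ω, dotC (crossC (P w) (meanField P w)) (secondSection P w) = 0) (hz : z ∈ Ω)
    (hcross : crossC (dzb P z) (secondSection P z) ≠ 0) :
    ∃ U ⊆ Ω, IsOpen U ∧ U.Nonempty ∧ ∀ w ∈ U,
      dotC (meanField P w) (secondSection P w) ≠ 0 ∧
      dotC (meanField P w) (secondSection P w) • conjC (secondSection P w) =
        dotC (meanField P w) (conjC (secondSection P w)) • secondSection P w := by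
  have c1 : ContinuousOn (fun w => crossC (dzb P w) (secondSection P w)) Ω :=
    (contDiffOn_crossC (H.smooth_wirt _) H.smooth_secondSection).continuousOn
  have c2 : ContinuousOn (fun w => 1 - dotC (P w) (meanField P w) ^ 2) Ω :=
    continuousOn_const.sub ((contDiffOn_dotC H.smooth H.smooth_meanField).continuousOn.pow 2)
  have c3 : ContinuousOn (fun w => dotC (meanField P w) (secondSection P w)) Ω :=
    (contDiffOn_dotC H.smooth_meanField H.smooth_secondSection).continuousOn
  -- Three nested open conditions: `b × f₂ ≠ 0`, then `N ≠ 0`, then `⟨h, f₂⟩ ≠ 0`. If either later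
  -- condition failed throughout the preceding nonempty set, it would force `b × f₂ = 0` somewhere
  -- in that set.
  set V := Ω ∩ (fun w => crossC (dzb P w) (secondSection P w)) ⁻¹' {0}ᶜ with hV
  have hVo : IsOpen V := c1.isOpen_inter_preimage H.isOpen isOpen_compl_singleton
  set V' := V ∩ (fun w => 1 - dotC (P w) (meanField P w) ^ 2) ⁻¹' {0}ᶜ with hV'
  have hVo' : IsOpen V' :=
    (c2.mono Set.inter_subset_left).isOpen_inter_preimage hVo isOpen_compl_singleton
  set U := V' ∩ (fun w => dotC (meanField P w) (secondSection P w)) ⁻¹' {0}ᶜ with hU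
  have hV'Ω : V' ⊆ Ω := fun w hw => hw.1.1
  have hUo : IsOpen U := (c3.mono hV'Ω).isOpen_inter_preimage hVo' isOpen_compl_singleton
  refine ⟨U, fun w hw => hV'Ω hw.1, hUo, ?_, ?_⟩
  · obtain ⟨z₁, hz₁⟩ : V'.Nonempty := by
      by_contra hne
      rw [Set.not_nonempty_iff_eq_empty] at hne
      refine hcross (H.cross_eq_zero_of_normal_eq_zero hz ?_)
      filter_upwards [hVo.mem_nhds (show z ∈ V from ⟨hz, hcross⟩)] with w hw
      by_contra hw'
      have : w ∈ V' := ⟨hw, hw'⟩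
      rw [hne] at this; exact this
    by_contra hne
    rw [Set.not_nonempty_iff_eq_empty] at hne
    have hz₁Ω := hV'Ω hz₁
    have hzero : ∀ᶠ w in nhds z₁, dotC (meanField P w) (secondSection P w) = 0 := by
      filter_upwards [hVo'.mem_nhds hz₁] with w hw
      by_contra hw'
      have : w ∈ U := ⟨hw, hw'⟩
      rw [hne] at this; exact this
    have F := H.frame hz₁Ω
    refine hz₁.1.2 (F.cross_eq_zero hz₁.2 (H.dot_secondSection hz₁Ω) (H.dz_dot_secondSection hz₁Ω)
      (H.dzb_dot_secondSection hz₁Ω) (hN _ hz₁Ω) hzero.self_of_nhds ?_)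
    rw [← H.dzb_meanField hz₁Ω]
    -- The `z̄`-derivative of `⟨h, f₂⟩ = 0` loses the term with `∂_z̄ f₂`, since that is a multiple
    -- of `P_z` and `h` is orthogonal to `P_z`. The result is the last hypothesis of
    -- `cross_eq_zero`.
    have h := wirt_eq_zero_of_eventually_const I 0 hzero
    obtain ⟨μ, hμ⟩ := H.dzb_secondSection hz₁Ω
    rw [wirt_dotC I (H.diff_meanField hz₁Ω) (H.diff_secondSection hz₁Ω),
      show wirt I (secondSection P) z₁ = _ from hμ, dotC_smul_right,
      show dotC (meanField P z₁) (dz P z₁) = 0 from F.mean_a, mul_zero, add_zero] at h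
    exact h
  · intro w hw
    have hwΩ := hV'Ω hw.1
    exact ⟨hw.2, (H.frame hwΩ).conj_proportional hw.1.2 (H.dot_secondSection hwΩ)
      (H.dz_dot_secondSection hwΩ) (H.dzb_dot_secondSection hwΩ) (hN _ hwΩ)
      (H.dotC_pCross_aCross_conj hN hwΩ)⟩

end IsMinimalChart
end SixSphere

/-! ### Local reduction to a four-dimensional subspace -/

namespace SixSphere

open Complex

/-- Grönwall along the radius from the centre: on each segment the bound becomes a linear
differential inequality with zero initial value. -/
lemma eq_zero_of_norm_fderiv_le {E : Type*} [NormedAddCommGroup E] [NormedSpace ℝ E] {Y : ℂ → E}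
    {c : ℂ} {r K : ℝ} (hd : ∀ z ∈ Metric.ball c r, DifferentiableAt ℝ Y z)
    (hK : ∀ z ∈ Metric.ball c r, ∀ v, ‖fderiv ℝ Y z v‖ ≤ K * ‖v‖ * ‖Y z‖) (h0 : Y c = 0) :
    ∀ z ∈ Metric.ball c r, Y z = 0 := by
  intro z hz
  have hmem : ∀ t ∈ Set.Icc (0 : ℝ) 1, c + t • (z - c) ∈ Metric.ball c r := by
    intro t ht
    exact (convex_ball c r).add_smul_sub_mem (Metric.mem_ball_self (Metric.pos_of_mem_ball hz)) hz ht
  have hderiv : ∀ t ∈ Set.Icc (0 : ℝ) 1, HasDerivAt (fun t : ℝ => Y (c + t • (z - c)))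
      (fderiv ℝ Y (c + t • (z - c)) (z - c)) t := by
    intro t ht
    have h1 : HasDerivAt (fun t : ℝ => c + t • (z - c)) (z - c) t := by
      simpa using ((hasDerivAt_id t).smul_const (z - c)).const_add c
    exact (hd _ (hmem t ht)).hasFDerivAt.comp_hasDerivAt t h1
  have := eq_zero_of_abs_deriv_le_mul_abs_self_of_eq_zero_right (K := K * ‖z - c‖)
    (f := fun t : ℝ => Y (c + t • (z - c)))
    (f' := fun t => fderiv ℝ Y (c + t • (z - c)) (z - c)) (a := 0) (b := 1)
    (fun t ht => (hderiv t ht).continuousAt.continuousWithinAt)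
    (fun t ht => (hderiv t (Set.Ico_subset_Icc_self ht)).hasDerivWithinAt) (by simpa using h0)
    (fun t ht => hK _ (hmem t (Set.Ico_subset_Icc_self ht)) _) 1 (by simp)
  simpa using this

namespace IsMinimalChart

variable {Ω : Set ℂ} {P : ℂ → C7} {z : ℂ}

/-- Where `f₂` is a non-zero multiple of a real vector, its `z`-derivative is a combination of
`f₂` and `P_z̄`. -/
lemma dz_secondSection_eq (H : IsMinimalChart Ω P) {U : Set ℂ} (hU : IsOpen U) (hUΩ : U ⊆ Ω)
    (hprop : ∀ w ∈ U, dotC (meanField P w) (secondSection P w) ≠ 0 ∧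
      dotC (meanField P w) (secondSection P w) • conjC (secondSection P w) =
        dotC (meanField P w) (conjC (secondSection P w)) • secondSection P w) (hz : z ∈ U) :
    dz (secondSection P) z =
      (dotC (conjC (secondSection P z)) (dz (secondSection P) z) /
        dotC (conjC (secondSection P z)) (secondSection P z)) • secondSection P z +
      (dotC (dz P z) (dz (secondSection P) z) / confFactor P z) • dzb P z := by
  have hzΩ := hUΩ hz
  have F := H.frame hzΩ
  obtain ⟨hg, hp⟩ := hprop z hz
  have hs0 : secondSection P z ≠ 0 := by intro h; rw [h] at hg; simp at hg
  have hst : dotC (conjC (secondSection P z)) (secondSection P z) ≠ 0 :=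
    mt dotC_conjC_self_eq_zero.1 hs0
  have hg' : dotC (meanField P z) (conjC (secondSection P z)) ≠ 0 := by
    rw [← show conjC (meanField P z) = meanField P z from F.conj_mean, dotC_conjC]
    exact (map_ne_zero _).2 hg
  obtain ⟨μ, hμ⟩ := H.dz_conj_secondSection hzΩ
  have d1 : DifferentiableAt ℝ (fun w => dotC (meanField P w) (secondSection P w)) z :=
    differentiableAt_of_contDiffOn
      (contDiffOn_dotC H.smooth_meanField H.smooth_secondSection) H.isOpen hzΩ
  have d2 : DifferentiableAt ℝ (fun w => dotC (meanField P w) (conjC (secondSection P w))) z :=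
    differentiableAt_of_contDiffOn
      (contDiffOn_dotC H.smooth_meanField (contDiffOn_conjC H.smooth_secondSection)) H.isOpen hzΩ
  have hUz : ∀ᶠ w in nhds z, w ∈ U := hU.mem_nhds hz
  -- Differentiating the proportionality of `f₂` and its conjugate expresses `∂_z f₂` through `f₂`,
  -- its conjugate and `∂_z` of the conjugate. The last is a multiple of `P_z̄`, and the conjugate
  -- is itself a multiple of `f₂`.
  have h1 := (wirt_smul (-I) d1 (H.diff_conj_secondSection hzΩ)).symm.trans
    ((wirt_congr (-I) (hUz.mono fun w hw => (hprop w hw).2)).trans (wirt_smul (-I) d2 (H.diff_secondSection hzΩ)))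
  rw [show wirt (-I) (fun w => conjC (secondSection P w)) z = _ from hμ] at h1
  have ht : conjC (secondSection P z) =
      (dotC (meanField P z) (conjC (secondSection P z)) /
        dotC (meanField P z) (secondSection P z)) • secondSection P z := by
    rw [div_eq_inv_mul, mul_smul, ← hp, smul_smul, inv_mul_cancel₀ hg, one_smul]
  obtain ⟨x, y, hxy⟩ : ∃ x y : ℂ, dz (secondSection P) z = x • secondSection P z + y • dzb P z := by
    set g := dotC (meanField P z) (secondSection P z)
    set g' := dotC (meanField P z) (conjC (secondSection P z))
    rw [ht] at h1
    refine ⟨g'⁻¹ * (wirt (-I) (fun w => dotC (meanField P w) (secondSection P w)) z * (g' / g) -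
      wirt (-I) (fun w => dotC (meanField P w) (conjC (secondSection P w))) z), g'⁻¹ * g * μ, ?_⟩
    apply smul_right_injective C7 hg'
    change g' • _ = g' • _
    rw [← sub_eq_iff_eq_add'] at h1
    rw [show dz (secondSection P) z = wirt (-I) (secondSection P) z from rfl, ← h1]
    match_scalars <;> field_simp
  -- The coefficients are recovered by pairing with `f̄₂` and with `P_z`. Unlike the ones just
  -- found, these expressions are manifestly continuous in the point, so they can be bounded on
  -- compact sets.
  have htb : dotC (conjC (secondSection P z)) (dzb P z) = 0 := by
    rw [← H.conj_dz hzΩ, dotC_conjC, dotC_comm, H.dz_dot_secondSection hzΩ, map_zero]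
  have hx : dotC (conjC (secondSection P z)) (dz (secondSection P) z) /
      dotC (conjC (secondSection P z)) (secondSection P z) = x := by
    rw [hxy, dotC_add_right, dotC_smul_right, dotC_smul_right, htb]; field_simp; ring
  have hy : dotC (dz P z) (dz (secondSection P) z) / confFactor P z = y := by
    have := F.ne
    rw [hxy, dotC_add_right, dotC_smul_right, dotC_smul_right, H.dz_dot_secondSection hzΩ, F.ab]
    field_simp; ring
  rw [hx, hy]; exact hxy

lemma dzb_secondSection_eq (H : IsMinimalChart Ω P) (hz : z ∈ Ω) :
    dzb (secondSection P) z =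
      (dotC (dzb P z) (dzb (secondSection P) z) / confFactor P z) • dz P z := by
  obtain ⟨μ, hμ⟩ := H.dzb_secondSection hz
  have F := H.frame hz
  rw [hμ, dotC_smul_right, F.ba, mul_div_cancel_right₀ _ F.ne]

/-- Near a point where `f₂` is locally a non-zero multiple of a real vector, the surface stays in
the space spanned by its position, its tangent plane and `f₂` at this point. -/
lemma exists_ball_dotC_eq_zero (H : IsMinimalChart Ω P) {U : Set ℂ} (hU : IsOpen U) (hUΩ : U ⊆ Ω)
    (hprop : ∀ w ∈ U, dotC (meanField P w) (secondSection P w) ≠ 0 ∧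
      dotC (meanField P w) (secondSection P w) • conjC (secondSection P w) =
        dotC (meanField P w) (conjC (secondSection P w)) • secondSection P w) (hz : z ∈ U) :
    ∃ r > 0, Metric.ball z r ⊆ U ∧ ∀ u : C7, conjC u = u → dotC u (P z) = 0 →
      dotC u (dz P z) = 0 → dotC u (secondSection P z) = 0 →
      ∀ w ∈ Metric.ball z r, dotC u (P w) = 0 := by
  obtain ⟨r, hr, hrU⟩ := Metric.nhds_basis_closedBall.mem_iff.1 (hU.mem_nhds hz)
  have hs := H.smooth_secondSection
  have hdzs := contDiffOn_wirt H.isOpen (-I) hs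
  have hdzbs := contDiffOn_wirt H.isOpen I hs
  have hne : ∀ w ∈ U, dotC (conjC (secondSection P w)) (secondSection P w) ≠ 0 := fun w hw =>
    mt dotC_conjC_self_eq_zero.1 fun h => (hprop w hw).1 (by rw [h]; simp)
  have bound : ∀ f : ℂ → ℂ, ContinuousOn f U →
      ∃ C, 0 ≤ C ∧ ∀ w ∈ Metric.closedBall z r, ‖f w‖ ≤ C := by
    intro f hf
    obtain ⟨C, hC⟩ := (isCompact_closedBall z r).exists_bound_of_continuousOn (hf.mono hrU)
    exact ⟨C, (norm_nonneg _).trans (hC z (Metric.mem_closedBall_self hr.le)), hC⟩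
  obtain ⟨C₁, hC₁, hb₁⟩ := bound _ (H.smooth_confFactor.continuousOn.mono hUΩ)
  obtain ⟨C₂, hC₂, hb₂⟩ := bound _ (H.smooth_logDeriv.continuousOn.mono hUΩ)
  obtain ⟨C₃, hC₃, hb₃⟩ := bound _ (((contDiffOn_dotC (contDiffOn_conjC hs) hdzs).mono hUΩ).continuousOn.div
    ((contDiffOn_dotC (contDiffOn_conjC hs) hs).mono hUΩ).continuousOn hne)
  obtain ⟨C₄, hC₄, hb₄⟩ := bound _ ((contDiffOn_div (contDiffOn_dotC (H.smooth_wirt (-I)) hdzs)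
    H.smooth_confFactor H.immersion).continuousOn.mono hUΩ)
  obtain ⟨C₅, hC₅, hb₅⟩ := bound _ ((contDiffOn_div (contDiffOn_dotC (H.smooth_wirt I) hdzbs)
    H.smooth_confFactor H.immersion).continuousOn.mono hUΩ)
  refine ⟨r, hr, Metric.ball_subset_closedBall.trans hrU, ?_⟩
  intro u hu u1 u2 u3
  have hdot : ∀ {f : ℂ → C7} {w : ℂ} (v : ℂ), DifferentiableAt ℝ f w →
      fderiv ℝ (fun w => dotC u (f w)) w v =
        v * dotC u (dz f w) + starRingEnd ℂ v * dotC u (dzb f w) := by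
    intro f w v hf
    rw [fderiv_apply_eq, smul_eq_mul, smul_eq_mul]
    congr 2 <;> exact wirt_clm (dotL u) _ hf
  have hdotd : ∀ {f : ℂ → C7} {w : ℂ}, DifferentiableAt ℝ f w →
      DifferentiableAt ℝ (fun w => dotC u (f w)) w := fun {f w} hf =>
    ((dotL u).restrictScalars ℝ).differentiableAt.comp w hf
  -- These three pairings satisfy a closed first order linear system. No separate component is
  -- needed for `⟨u, P_z̄⟩`, since `u` is real and it is conjugate to `⟨u, P_z⟩`. The `2` covers the
  -- unit coefficients of the system; the `Cᵢ` bound the others.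
  have hall := eq_zero_of_norm_fderiv_le (c := z) (r := r) (K := 2 + C₁ + C₂ + C₃ + C₄ + C₅)
    (Y := fun w => (dotC u (P w), dotC u (dz P w), dotC u (secondSection P w))) ?_ ?_ ?_
  · exact fun w hw => (Prod.ext_iff.1 (hall w hw)).1
  · intro w hw
    have hwΩ := hUΩ (hrU (Metric.ball_subset_closedBall hw))
    exact (hdotd (H.diff hwΩ)).prodMk
      ((hdotd (H.diff_wirt hwΩ _)).prodMk (hdotd (H.diff_secondSection hwΩ)))
  · intro w hw v
    have hwU := hrU (Metric.ball_subset_closedBall hw)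
    have hwΩ := hUΩ hwU
    have hwc := Metric.ball_subset_closedBall hw
    have b1 := hb₁ w hwc
    have b2 := hb₂ w hwc
    have b3 := hb₃ w hwc
    have b4 := hb₄ w hwc
    have b5 := hb₅ w hwc
    have hF : fderiv ℝ (fun w => (dotC u (P w), dotC u (dz P w), dotC u (secondSection P w))) w v =
        (fderiv ℝ (fun w => dotC u (P w)) w v, fderiv ℝ (fun w => dotC u (dz P w)) w v,
          fderiv ℝ (fun w => dotC u (secondSection P w)) w v) := by
      rw [((hdotd (H.diff hwΩ)).hasFDerivAt.prodMk ((hdotd (H.diff_wirt hwΩ _)).hasFDerivAt.prodMk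
        (hdotd (H.diff_secondSection hwΩ)).hasFDerivAt)).fderiv]
      rfl
    rw [hF, hdot v (H.diff hwΩ), hdot v (H.diff_wirt hwΩ _), hdot v (H.diff_secondSection hwΩ),
      H.dz_secondSection_eq hU hUΩ hprop hwU, H.dzb_secondSection_eq hwΩ, dz_dz_eq w,
      H.harmonic w hwΩ]
    simp only [dotC_add_right, dotC_smul_right]
    set Y := (dotC u (P w), dotC u (dz P w), dotC u (secondSection P w)) with hY
    have hY1 : ‖dotC u (P w)‖ ≤ ‖Y‖ := norm_fst_le Y
    have hY2 : ‖dotC u (dz P w)‖ ≤ ‖Y‖ := (norm_fst_le Y.2).trans (norm_snd_le Y)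
    have hY3 : ‖dotC u (secondSection P w)‖ ≤ ‖Y‖ := (norm_snd_le Y.2).trans (norm_snd_le Y)
    have hY4 : ‖dotC u (dzb P w)‖ ≤ ‖Y‖ := by
      rw [← H.conj_dz hwΩ, ← hu, dotC_conjC, RCLike.norm_conj]; exact hY2
    have hv : ‖starRingEnd ℂ v‖ = ‖v‖ := RCLike.norm_conj v
    have tri : ∀ {p q : ℂ} {A B : ℝ}, ‖p‖ ≤ A → ‖q‖ ≤ B →
        ‖v * p + starRingEnd ℂ v * q‖ ≤ ‖v‖ * (A + B) := by
      intro p q A B h1 h2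
      refine (norm_add_le _ _).trans ?_
      rw [norm_mul, norm_mul, hv, mul_add]
      gcongr
    have prod : ∀ {p q : ℂ} {A : ℝ}, ‖p‖ ≤ A → ‖q‖ ≤ ‖Y‖ → ‖p * q‖ ≤ A * ‖Y‖ := by
      intro p q A h1 h2
      rw [norm_mul]
      exact mul_le_mul h1 h2 (norm_nonneg _) ((norm_nonneg _).trans h1)
    have fin : ∀ {A B : ℝ}, A + B ≤ (2 + C₁ + C₂ + C₃ + C₄ + C₅) * ‖Y‖ →
        ‖v‖ * (A + B) ≤ (2 + C₁ + C₂ + C₃ + C₄ + C₅) * ‖v‖ * ‖Y‖ := by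
      intro A B h
      calc ‖v‖ * (A + B) ≤ ‖v‖ * ((2 + C₁ + C₂ + C₃ + C₄ + C₅) * ‖Y‖) := by gcongr
        _ = _ := by ring
    have hY0 := norm_nonneg Y
    have p1 := mul_nonneg hC₁ hY0
    have p2 := mul_nonneg hC₂ hY0
    have p3 := mul_nonneg hC₃ hY0
    have p4 := mul_nonneg hC₄ hY0
    have p5 := mul_nonneg hC₅ hY0
    refine norm_prod_le_iff.2 ⟨?_, norm_prod_le_iff.2 ⟨?_, ?_⟩⟩
    · exact (tri hY2 hY4).trans (fin (by nlinarith))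
    · refine (tri ((norm_add_le _ _).trans (add_le_add hY3 (prod b2 hY2)))
        (prod (A := C₁) (by rw [norm_neg]; exact b1) hY1)).trans (fin (by nlinarith))
    · refine (tri ((norm_add_le _ _).trans (add_le_add (prod b3 hY3) (prod b4 hY4)))
        (prod b5 hY2)).trans (fin (by nlinarith))
  · simp [u1, u2, u3]

end IsMinimalChart
end SixSphere

namespace SixSphere

open Complex MeasureTheory

/-! ### Unique continuation for `|∂U/∂z̄| ≤ C |U|` -/

lemma integrable_of_eq_zero_off {E : Type*} [Zero E] {g : ℂ → E} (hc : HasCompactSupport g)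
    {f : ℂ → ℝ} (hf : Continuous f) (h : ∀ z ∉ tsupport g, f z = 0) : Integrable f :=
  hf.integrable_of_hasCompactSupport (HasCompactSupport.intro hc h)

/-- A directional Poincaré inequality. -/
lemma integral_norm_sq_le {g : ℂ → ℂ} {a : ℂ} {R : ℝ} (hg : ContDiff ℝ ∞ g)
    (hc : HasCompactSupport g) (hR : ∀ z, g z ≠ 0 → ‖z - a‖ ≤ R) :
    ∫ z, ‖g z‖ ^ 2 ≤ 4 * R ^ 2 * ∫ z, ‖fderiv ℝ g z 1‖ ^ 2 := by
  have hgx : Continuous fun z => fderiv ℝ g z 1 :=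
    (hg.continuous_fderiv (by simp)).clm_apply continuous_const
  have h0 : ∀ z ∉ tsupport g, g z = 0 := fun z hz => image_eq_zero_of_notMem_tsupport hz
  have hn : ∀ z, HasFDerivAt (fun z => ‖g z‖ ^ 2) (2 • (innerSL ℝ (g z)).comp (fderiv ℝ g z)) z :=
    fun z => ((hg.differentiable (by simp)).differentiableAt.hasFDerivAt).norm_sq
  have hn1 : ∀ z, fderiv ℝ (fun z => ‖g z‖ ^ 2) z 1 = 2 * ⟪g z, fderiv ℝ g z 1⟫ := by
    intro z; rw [(hn z).fderiv]; simp; ring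
  have hξ : ∀ z, HasFDerivAt (fun z : ℂ => (z - a).re) reCLM z := by
    intro z
    exact (reCLM.hasFDerivAt.comp z ((hasFDerivAt_id z).sub_const a))
  have hξ1 : ∀ z, fderiv ℝ (fun z : ℂ => (z - a).re) z 1 = 1 := by
    intro z; rw [(hξ z).fderiv]; simp
  have hcontn : Continuous fun z => ‖g z‖ ^ 2 := hg.continuous.norm.pow 2
  have hcontξ : Continuous fun z : ℂ => (z - a).re := by fun_prop
  have hcontin : Continuous fun z => ⟪g z, fderiv ℝ g z 1⟫ := hg.continuous.inner hgx
  have I1 : Integrable fun z => ‖g z‖ ^ 2 :=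
    integrable_of_eq_zero_off hc hcontn fun z hz => by rw [h0 z hz]; simp
  have I2 : Integrable fun z => ‖fderiv ℝ g z 1‖ ^ 2 :=
    integrable_of_eq_zero_off hc (hgx.norm.pow 2) fun z hz => by
      rw [fderiv_of_notMem_tsupport ℝ hz]; simp
  have I3 : Integrable fun z => 2 * ⟪g z, fderiv ℝ g z 1⟫ * (z - a).re :=
    integrable_of_eq_zero_off hc ((continuous_const.mul hcontin).mul hcontξ) fun z hz => by
      rw [h0 z hz, inner_zero_left, mul_zero, zero_mul]
  have I4 : Integrable fun z => ‖g z‖ ^ 2 * (z - a).re :=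
    integrable_of_eq_zero_off hc (hcontn.mul hcontξ) fun z hz => by
      rw [h0 z hz, norm_zero]; ring
  -- Integration by parts against `Re (z - a)`, whose `x`-derivative is `1` and which is at most `R`
  -- in absolute value wherever `g` is nonzero.
  have parts : ∫ z, ‖g z‖ ^ 2 = -∫ z, 2 * ⟪g z, fderiv ℝ g z 1⟫ * (z - a).re := by
    have h := integral_mul_fderiv_eq_neg_fderiv_mul_of_integrable (μ := volume) (𝕜 := ℝ)
      (f := fun z => ‖g z‖ ^ 2) (g := fun z : ℂ => (z - a).re) (v := 1)
      (by simpa only [hn1] using I3) (by simpa only [hξ1, mul_one] using I1) I4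
      (fun z _ => (hn z).differentiableAt) (fun z _ => (hξ z).differentiableAt)
    simpa only [hξ1, hn1, mul_one] using h
  have bound : ∫ z, -(2 * ⟪g z, fderiv ℝ g z 1⟫ * (z - a).re) ≤
      ∫ z, (1 / 2 * ‖g z‖ ^ 2 + 2 * R ^ 2 * ‖fderiv ℝ g z 1‖ ^ 2) := by
    refine integral_mono I3.neg ((I1.const_mul _).add (I2.const_mul _)) ?_
    intro z
    change -(2 * ⟪g z, fderiv ℝ g z 1⟫ * (z - a).re) ≤
      1 / 2 * ‖g z‖ ^ 2 + 2 * R ^ 2 * ‖fderiv ℝ g z 1‖ ^ 2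
    by_cases hz : g z = 0
    · rw [hz, inner_zero_left, mul_zero, zero_mul, neg_zero]; positivity
    · have h1 : |⟪g z, fderiv ℝ g z 1⟫| ≤ ‖g z‖ * ‖fderiv ℝ g z 1‖ := abs_real_inner_le_norm _ _
      have h2 : |(z - a).re| ≤ R := (abs_re_le_norm _).trans (hR z hz)
      have h3 : |⟪g z, fderiv ℝ g z 1⟫ * (z - a).re| ≤ ‖g z‖ * ‖fderiv ℝ g z 1‖ * R := by
        rw [abs_mul]
        exact mul_le_mul h1 h2 (abs_nonneg _) (by positivity)
      have h4 := neg_abs_le (⟪g z, fderiv ℝ g z 1⟫ * (z - a).re)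
      generalize ⟪g z, fderiv ℝ g z 1⟫ = A at *
      generalize (z - a).re = B at *
      generalize ‖g z‖ = C at *
      generalize ‖fderiv ℝ g z 1‖ = D at *
      -- Young's inequality weighted so that exactly half of `‖g‖²` appears on the right and can be
      -- absorbed.
      nlinarith [sq_nonneg (C - 2 * R * D)]
  rw [integral_neg, ← parts, integral_add (I1.const_mul _) (I2.const_mul _), integral_const_mul,
    integral_const_mul] at bound
  linarith

/-- The integral of a Jacobian determinant vanishes: moving one derivative off `q` leaves a second
derivative of `p`, which is symmetric. Compact support of `p` alone removes the boundary terms. -/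
lemma integral_fderiv_mul_fderiv_comm {p q : ℂ → ℝ} (hp : ContDiff ℝ ∞ p) (hq : ContDiff ℝ ∞ q)
    (hcp : HasCompactSupport p) (u v : ℂ) :
    ∫ z, fderiv ℝ p z u * fderiv ℝ q z v = ∫ z, fderiv ℝ p z v * fderiv ℝ q z u := by
  have hd : ContDiff ℝ ∞ (fderiv ℝ p) := hp.fderiv_right (by simp)
  have hdu : ∀ u : ℂ, ContDiff ℝ ∞ fun z => fderiv ℝ p z u := fun u => hd.clm_apply contDiff_const
  have hqu : ∀ u : ℂ, Continuous fun z => fderiv ℝ q z u := fun u =>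
    (hq.continuous_fderiv (by simp)).clm_apply continuous_const
  have h0 : ∀ z ∉ tsupport p, ∀ u, fderiv ℝ p z u = 0 := fun z hz u => by
    rw [fderiv_of_notMem_tsupport ℝ hz]; rfl
  have h : ∀ z u v, fderiv ℝ (fun z => fderiv ℝ p z u) z v = fderiv ℝ (fderiv ℝ p) z v u := by
    intro z u v
    have hh : HasFDerivAt (fun z => fderiv ℝ p z u) ((ContinuousLinearMap.apply ℝ ℝ u).comp
        (fderiv ℝ (fderiv ℝ p) z)) z :=
      (ContinuousLinearMap.apply ℝ ℝ u).hasFDerivAt.comp z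
        (hd.differentiable (by simp)).differentiableAt.hasFDerivAt
    rw [hh.fderiv]; rfl
  have h00 : ∀ z ∉ tsupport p, fderiv ℝ (fderiv ℝ p) z = 0 := fun z hz =>
    fderiv_of_notMem_tsupport ℝ fun h => hz (tsupport_fderiv_subset ℝ h)
  have key : ∀ u v : ℂ, ∫ z, fderiv ℝ p z u * fderiv ℝ q z v =
      -∫ z, fderiv ℝ (fun z => fderiv ℝ p z u) z v * q z := by
    intro u v
    refine integral_mul_fderiv_eq_neg_fderiv_mul_of_integrable ?_ ?_ ?_ ?_ ?_
    · refine integrable_of_eq_zero_off hcp ((((hdu u).continuous_fderiv (by simp)).clm_apply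
        continuous_const).mul hq.continuous) fun z hz => ?_
      rw [h, h00 z hz]; simp
    · exact integrable_of_eq_zero_off hcp ((hdu u).continuous.mul (hqu v)) fun z hz => by
        rw [h0 z hz, zero_mul]
    · exact integrable_of_eq_zero_off hcp ((hdu u).continuous.mul hq.continuous) fun z hz => by
        rw [h0 z hz, zero_mul]
    · exact fun z _ => ((hdu u).differentiable (by simp)).differentiableAt
    · exact fun z _ => (hq.differentiable (by simp)).differentiableAt
  have hsymm : ∀ z, fderiv ℝ (fun z => fderiv ℝ p z u) z v =
      fderiv ℝ (fun z => fderiv ℝ p z v) z u := by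
    intro z
    rw [h, h]
    exact (hp.contDiffAt.isSymmSndFDerivAt (by simpa using two_le_infty)).eq v u
  rw [key u v, key v u]
  simp only [hsymm]

/-- Pointwise, `4 |g_z̄|²` is `|g_x|² + |g_y|²` minus twice the Jacobian of `(Re g, Im g)`. The
Jacobian integrates to zero, so `g_z̄` controls `g_x` in `L²` and the directional Poincaré
inequality applies; `16` is `4 · 4`. -/
lemma integral_norm_sq_le_dzb {g : ℂ → ℂ} {a : ℂ} {R : ℝ} (hg : ContDiff ℝ ∞ g)
    (hc : HasCompactSupport g) (hR : ∀ z, g z ≠ 0 → ‖z - a‖ ≤ R) :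
    ∫ z, ‖g z‖ ^ 2 ≤ 16 * R ^ 2 * ∫ z, ‖dzb g z‖ ^ 2 := by
  have hgu : ∀ u : ℂ, Continuous fun z => fderiv ℝ g z u := fun u =>
    (hg.continuous_fderiv (by simp)).clm_apply continuous_const
  have h0 : ∀ z ∉ tsupport g, ∀ u, fderiv ℝ g z u = 0 := fun z hz u => by
    rw [fderiv_of_notMem_tsupport ℝ hz]; rfl
  have In : ∀ u : ℂ, Integrable fun z => ‖fderiv ℝ g z u‖ ^ 2 := fun u =>
    integrable_of_eq_zero_off hc ((hgu u).norm.pow 2) fun z hz => by rw [h0 z hz]; simp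
  have hp : ContDiff ℝ ∞ fun z => (g z).re := reCLM.contDiff.comp hg
  have hq : ContDiff ℝ ∞ fun z => (g z).im := imCLM.contDiff.comp hg
  have hcp : HasCompactSupport fun z => (g z).re := hc.comp_left (g := Complex.re) rfl
  have hgd : ∀ z, HasFDerivAt g (fderiv ℝ g z) z := fun z =>
    (hg.differentiable (by simp)).differentiableAt.hasFDerivAt
  have hpd : ∀ z u, fderiv ℝ (fun z => (g z).re) z u = (fderiv ℝ g z u).re := by
    intro z u
    have h : HasFDerivAt (fun z => (g z).re) (reCLM.comp (fderiv ℝ g z)) z :=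
      reCLM.hasFDerivAt.comp z (hgd z)
    rw [h.fderiv]; rfl
  have hqd : ∀ z u, fderiv ℝ (fun z => (g z).im) z u = (fderiv ℝ g z u).im := by
    intro z u
    have h : HasFDerivAt (fun z => (g z).im) (imCLM.comp (fderiv ℝ g z)) z :=
      imCLM.hasFDerivAt.comp z (hgd z)
    rw [h.fderiv]; rfl
  have hcomm := integral_fderiv_mul_fderiv_comm hp hq hcp 1 I
  simp only [hpd, hqd] at hcomm
  have hpt : ∀ z, 4 * ‖dzb g z‖ ^ 2 = (‖fderiv ℝ g z 1‖ ^ 2 + ‖fderiv ℝ g z I‖ ^ 2) +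
      2 * ((fderiv ℝ g z I).re * (fderiv ℝ g z 1).im -
        (fderiv ℝ g z 1).re * (fderiv ℝ g z I).im) := by
    intro z
    simp only [dzb, wirt, Complex.sq_norm, Complex.normSq_apply, smul_eq_mul]
    simp
    ring
  have J : ∀ u v : ℂ, Integrable fun z => (fderiv ℝ g z u).re * (fderiv ℝ g z v).im := fun u v =>
    integrable_of_eq_zero_off hc ((continuous_re.comp (hgu u)).mul (continuous_im.comp (hgu v)))
      fun z hz => by rw [h0 z hz]; simp
  have h4 : 4 * ∫ z, ‖dzb g z‖ ^ 2 =
      (∫ z, ‖fderiv ℝ g z 1‖ ^ 2) + ∫ z, ‖fderiv ℝ g z I‖ ^ 2 := by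
    have e1 : 4 * ∫ z, ‖dzb g z‖ ^ 2 = ∫ z, ((‖fderiv ℝ g z 1‖ ^ 2 + ‖fderiv ℝ g z I‖ ^ 2) +
        2 * ((fderiv ℝ g z I).re * (fderiv ℝ g z 1).im -
        (fderiv ℝ g z 1).re * (fderiv ℝ g z I).im)) := by
      rw [← integral_const_mul]; exact integral_congr_ae (Filter.Eventually.of_forall hpt)
    have e2 := integral_add ((In 1).add (In I)) (((J I 1).sub (J 1 I)).const_mul 2)
    have e3 := integral_add (In 1) (In I)
    have e4 := integral_sub (J I 1) (J 1 I)
    simp only [Pi.add_apply, Pi.sub_apply] at e2 e3 e4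
    rw [e1, e2, e3, integral_const_mul, e4, hcomm]
    ring
  have h1 := integral_norm_sq_le hg hc hR
  have h2 : 0 ≤ ∫ z, ‖fderiv ℝ g z I‖ ^ 2 := integral_nonneg fun z => by positivity
  have h3 : 4 * R ^ 2 * ∫ z, ‖fderiv ℝ g z 1‖ ^ 2 ≤ 4 * R ^ 2 * (4 * ∫ z, ‖dzb g z‖ ^ 2) := by
    rw [h4]; gcongr; linarith
  linarith

end SixSphere

/-! ### Carleman estimate and unique continuation in a chart -/

namespace SixSphere

open Complex MeasureTheory

lemma dzb_eq_zero_of_differentiableAt {f : ℂ → ℂ} {z : ℂ} (hf : DifferentiableAt ℂ f z) :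
    dzb f z = 0 := by
  have h : fderiv ℝ f z = (fderiv ℂ f z).restrictScalars ℝ :=
    (hf.hasFDerivAt.restrictScalars ℝ).fderiv
  have hI : fderiv ℂ f z I = I * fderiv ℂ f z 1 := by
    have := (fderiv ℂ f z).map_smul I 1
    simpa using this
  simp only [dzb, wirt, h, ContinuousLinearMap.coe_restrictScalars', hI, smul_eq_mul, ← mul_assoc,
    I_mul_I]
  ring

/-- A Carleman type estimate: a solution of `|∂U/∂z̄| ≤ C |U|` on a small disc which vanishes near
the centre vanishes identically. -/
lemma eq_zero_of_norm_dzb_le {ι : Type*} [Fintype ι] {u : ι → ℂ → ℂ} {a : ℂ} {R C δ : ℝ}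
    (hu : ∀ i, ContDiffOn ℝ ∞ (u i) (Metric.ball a R)) (hδ : 0 < δ)
    (hzero : ∀ i, ∀ z ∈ Metric.ball a δ, u i z = 0)
    (hle : ∀ z ∈ Metric.ball a R, ∑ i, ‖dzb (u i) z‖ ^ 2 ≤ C ^ 2 * ∑ i, ‖u i z‖ ^ 2)
    (hRC : 32 * R ^ 2 * C ^ 2 ≤ 1) : ∀ z ∈ Metric.ball a R, ∀ i, u i z = 0 := by
  intro z₀ hz₀
  -- Radii `|z₀ - a| < ρ < r < r' < R`: the cutoff is `1` up to `r` and vanishes from `r'` on, and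
  -- the gap between `ρ` and `r` makes the weight grow exponentially near `z₀`.
  obtain ⟨ρ, hρ₁, hρ₂⟩ := exists_between (Metric.mem_ball.1 hz₀)
  obtain ⟨r, hr₁, hr₂⟩ := exists_between hρ₂
  obtain ⟨r', hr'₁, hr'₂⟩ := exists_between hr₂
  have hρ0 : 0 < ρ := dist_nonneg.trans_lt hρ₁
  have hr0 : 0 < r := hρ0.trans hr₁
  let χ : ContDiffBump a := ⟨r, r', hr0, hr'₁⟩
  have hχs : ∀ z, r' ≤ ‖z - a‖ → χ z = 0 := fun z hz =>
    χ.zero_of_le_dist (by rw [dist_eq_norm]; exact hz)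
  have hχ1 : ∀ z ∈ Metric.closedBall a r, χ z = 1 := fun z hz => χ.one_of_mem_closedBall hz
  set k : ι → ℂ → ℂ := fun i z => (χ z : ℂ) * u i z with hk
  have hχC : ContDiff ℝ ∞ fun z => (χ z : ℂ) := ofRealCLM.contDiff.comp χ.contDiff
  have hk0 : ∀ i, ∀ z ∉ Metric.closedBall a r', k i z = 0 := by
    intro i z hz
    rw [Metric.mem_closedBall, not_le, dist_eq_norm] at hz
    simp [hk, hχs z hz.le]
  have hkδ : ∀ i, ∀ z ∈ Metric.ball a δ, k i z = 0 := fun i z hz => by simp [hk, hzero i z hz]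
  have hks : ∀ i, ContDiff ℝ ∞ (k i) := by
    intro i
    rw [contDiff_iff_contDiffAt]
    intro z
    by_cases hz : z ∈ Metric.ball a R
    · exact hχC.contDiffAt.mul ((hu i).contDiffAt (Metric.isOpen_ball.mem_nhds hz))
    · have hz' : z ∈ (Metric.closedBall a r')ᶜ := fun h =>
        hz (Metric.closedBall_subset_ball hr'₂ h)
      exact contDiffAt_const.congr_of_eventuallyEq (f := fun _ => (0 : ℂ))
        (Filter.eventuallyEq_of_mem (Metric.isClosed_closedBall.isOpen_compl.mem_nhds hz') (hk0 i))
  have hkc : ∀ i, HasCompactSupport (k i) := fun i =>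
    HasCompactSupport.intro (isCompact_closedBall a r') (hk0 i)
  have hdk0 : ∀ i, ∀ z ∉ tsupport (k i), dzb (k i) z = 0 := fun i z hz => by
    simp [dzb, wirt, fderiv_of_notMem_tsupport ℝ hz]
  have hdkδ : ∀ i, dzb (k i) a = 0 := fun i =>
    wirt_eq_zero_of_eventually_const _ 0
      (Filter.eventually_of_mem (Metric.ball_mem_nhds a hδ) (hkδ i))
  have hdkcont : ∀ i, Continuous (dzb (k i)) := fun i =>
    (contDiffOn_univ.1 (contDiffOn_wirt isOpen_univ I (hks i).contDiffOn)).continuous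
  have hdku : ∀ i, ∀ z ∈ Metric.ball a r, dzb (k i) z = dzb (u i) z := by
    intro i z hz
    refine wirt_congr _ (Filter.eventuallyEq_of_mem (Metric.isOpen_ball.mem_nhds hz) ?_)
    intro w hw
    simp [hk, hχ1 w (Metric.ball_subset_closedBall hw)]
  -- The weight is holomorphic away from `a`, so it commutes with `∂/∂z̄`. Its pole is harmless
  -- because `k` vanishes near `a`.
  set g : ℕ → ι → ℂ → ℂ := fun n i z => ((r : ℂ) / (z - a)) ^ n * k i z with hg
  have hm : ∀ n : ℕ, ∀ z, z ≠ a → DifferentiableAt ℂ (fun z => ((r : ℂ) / (z - a)) ^ n) z := by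
    intro n z hz
    exact ((differentiableAt_const _).div (differentiableAt_id.sub_const a)
      (sub_ne_zero.2 hz)).pow n
  have hms : ∀ n : ℕ, ∀ z, z ≠ a → ContDiffAt ℝ ∞ (fun z => ((r : ℂ) / (z - a)) ^ n) z := by
    intro n z hz
    have h1 : ContDiffAt ℝ ∞ (fun z => (r : ℂ) * (z - a)⁻¹) z :=
      contDiffAt_const.mul ((contDiffAt_id.sub contDiffAt_const).inv (sub_ne_zero.2 hz))
    simp only [div_eq_mul_inv]
    exact h1.pow n
  have hga : ∀ n i, ∀ z ∈ Metric.ball a δ, g n i z = 0 := fun n i z hz => by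
    simp [hg, hkδ i z hz]
  have hgs : ∀ n i, ContDiff ℝ ∞ (g n i) := by
    intro n i
    rw [contDiff_iff_contDiffAt]
    intro z
    by_cases hz : z = a
    · subst hz
      exact contDiffAt_const.congr_of_eventuallyEq (f := fun _ => (0 : ℂ))
        (Filter.eventuallyEq_of_mem (Metric.ball_mem_nhds z hδ) (hga n i))
    · exact (hms n z hz).mul (hks i).contDiffAt
  have hgc : ∀ n i, HasCompactSupport (g n i) := fun n i => (hkc i).mul_left
  have hgR : ∀ n i z, g n i z ≠ 0 → ‖z - a‖ ≤ R := by
    intro n i z hz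
    by_contra h
    refine hz ?_
    have : z ∉ Metric.closedBall a r' := by
      rw [Metric.mem_closedBall, dist_eq_norm]; intro h'; exact h (h'.trans hr'₂.le)
    simp [hg, hk0 i z this]
  have hgd : ∀ n i z, dzb (g n i) z = ((r : ℂ) / (z - a)) ^ n * dzb (k i) z := by
    intro n i z
    by_cases hz : z = a
    · subst hz
      rw [hdkδ, mul_zero]
      exact wirt_eq_zero_of_eventually_const _ 0
        (Filter.eventually_of_mem (Metric.ball_mem_nhds z hδ) (hga n i))
    · have h : dzb (g n i) z = _ := wirt_mul I ((hms n z hz).differentiableAt (by simp))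
        ((hks i).contDiffAt.differentiableAt (by simp))
      rw [h, show wirt I (fun z => ((r : ℂ) / (z - a)) ^ n) z = 0 from
        dzb_eq_zero_of_differentiableAt (hm n z hz), zero_mul, zero_add]
  have Ig : ∀ n i, Integrable fun z => ‖g n i z‖ ^ 2 := fun n i =>
    integrable_of_eq_zero_off (hgc n i) ((hgs n i).continuous.norm.pow 2) fun z hz => by
      rw [image_eq_zero_of_notMem_tsupport hz]; simp
  have Idk : ∀ i, Integrable fun z => ‖dzb (k i) z‖ ^ 2 := fun i =>
    integrable_of_eq_zero_off (hkc i) ((hdkcont i).norm.pow 2) fun z hz => by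
      rw [hdk0 i z hz]; simp
  have hdgcont : ∀ n i, Continuous (dzb (g n i)) := fun n i =>
    (contDiffOn_univ.1 (contDiffOn_wirt isOpen_univ I (hgs n i).contDiffOn)).continuous
  have Idg : ∀ n i, Integrable fun z => ‖dzb (g n i) z‖ ^ 2 := fun n i =>
    integrable_of_eq_zero_off (hkc i) ((hdgcont n i).norm.pow 2) fun z hz => by
      rw [hgd, hdk0 i z hz]; simp
  have hpt : ∀ n z, ∑ i, ‖dzb (g n i) z‖ ^ 2 ≤
      C ^ 2 * ∑ i, ‖g n i z‖ ^ 2 + ∑ i, ‖dzb (k i) z‖ ^ 2 := by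
    intro n z
    have hgn : ∀ i, ‖g n i z‖ ^ 2 = ‖((r : ℂ) / (z - a)) ^ n‖ ^ 2 * ‖k i z‖ ^ 2 := fun i => by
      rw [hg, norm_mul, mul_pow]
    simp only [hgd, hgn, norm_mul, mul_pow, ← Finset.mul_sum]
    -- Inside radius `r` the cutoff is `1` and the differential inequality can be multiplied by the
    -- weight. Outside, the weight is at most `1`, so the cutoff error is bounded independently of
    -- `n`.
    by_cases hz : z ∈ Metric.ball a r
    · have h1 : ∑ i, ‖dzb (k i) z‖ ^ 2 ≤ C ^ 2 * ∑ i, ‖k i z‖ ^ 2 := by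
        have h2 := hle z (Metric.ball_subset_ball hr₂.le hz)
        have h3 : ∀ i, k i z = u i z := fun i => by
          simp [hk, hχ1 z (Metric.ball_subset_closedBall hz)]
        simpa only [h3, hdku _ z hz] using h2
      have h4 : 0 ≤ ∑ i, ‖dzb (k i) z‖ ^ 2 := Finset.sum_nonneg fun i _ => by positivity
      have h5 := mul_le_mul_of_nonneg_left h1 (sq_nonneg ‖((r : ℂ) / (z - a)) ^ n‖)
      linarith
    · have h1 : ‖((r : ℂ) / (z - a)) ^ n‖ ≤ 1 := by
        rw [norm_pow, norm_div]
        refine pow_le_one₀ (by positivity) ?_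
        rw [Metric.mem_ball, not_lt, dist_eq_norm] at hz
        rw [norm_real, Real.norm_of_nonneg hr0.le]
        exact div_le_one_of_le₀ hz (norm_nonneg _)
      have h2 : ‖((r : ℂ) / (z - a)) ^ n‖ ^ 2 ≤ 1 := pow_le_one₀ (norm_nonneg _) h1
      have h4 : 0 ≤ ∑ i, ‖dzb (k i) z‖ ^ 2 := Finset.sum_nonneg fun i _ => by positivity
      have h5 := mul_le_mul_of_nonneg_right h2 h4
      have h6 : 0 ≤ C ^ 2 * (‖((r : ℂ) / (z - a)) ^ n‖ ^ 2 * ∑ i, ‖k i z‖ ^ 2) :=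
        mul_nonneg (sq_nonneg _) (mul_nonneg (sq_nonneg _)
          (Finset.sum_nonneg fun i _ => by positivity))
      linarith
  set L : ℝ := ∫ z, ∑ i, ‖dzb (k i) z‖ ^ 2
  -- The smallness of `R` gives `16 R² C² ≤ 1/2`, so half of the left side is absorbed and the
  -- constant `16 R²` doubles.
  have hbound : ∀ n, ∫ z, ∑ i, ‖g n i z‖ ^ 2 ≤ 32 * R ^ 2 * L := by
    intro n
    have h1 : ∫ z, ∑ i, ‖g n i z‖ ^ 2 ≤ 16 * R ^ 2 * ∫ z, ∑ i, ‖dzb (g n i) z‖ ^ 2 := by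
      rw [integral_finsetSum _ fun i _ => Ig n i, integral_finsetSum _ fun i _ => Idg n i,
        Finset.mul_sum]
      exact Finset.sum_le_sum fun i _ => integral_norm_sq_le_dzb (hgs n i) (hgc n i) (hgR n i)
    have h2 : ∫ z, ∑ i, ‖dzb (g n i) z‖ ^ 2 ≤ C ^ 2 * (∫ z, ∑ i, ‖g n i z‖ ^ 2) + L := by
      rw [← integral_const_mul, ← integral_add
        ((integrable_finsetSum _ fun i _ => Ig n i).const_mul _)
        (integrable_finsetSum _ fun i _ => Idk i)]
      exact integral_mono (integrable_finsetSum _ fun i _ => Idg n i)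
        (((integrable_finsetSum _ fun i _ => Ig n i).const_mul _).add
        (integrable_finsetSum _ fun i _ => Idk i)) (hpt n)
    have h3 : 0 ≤ ∫ z, ∑ i, ‖g n i z‖ ^ 2 :=
      integral_nonneg fun z => Finset.sum_nonneg fun i _ => by positivity
    nlinarith [mul_le_mul_of_nonneg_left h2 (show (0 : ℝ) ≤ 16 * R ^ 2 by positivity),
      mul_le_mul_of_nonneg_right hRC h3]
  suffices hK : ∑ i, ‖k i z₀‖ ^ 2 = 0 by
    intro i
    have h := (Finset.sum_eq_zero_iff_of_nonneg fun i _ => by positivity).1 hK i (Finset.mem_univ i)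
    have h1 : χ z₀ = 1 := hχ1 z₀ (Metric.mem_closedBall.2 (hρ₁.trans hr₁).le)
    simpa [hk, h1] using h
  by_contra hne
  obtain ⟨ε, hε, hεsub⟩ : ∃ ε > 0, Metric.ball z₀ ε ⊆ Metric.ball a ρ :=
    Metric.isOpen_iff.1 Metric.isOpen_ball z₀ (Metric.mem_ball.2 hρ₁)
  let ψ : ContDiffBump z₀ := ⟨ε / 2, ε, by linarith, by linarith⟩
  have hKcont : Continuous fun z => ∑ i, ‖k i z‖ ^ 2 :=
    continuous_finsetSum _ fun i _ => (hks i).continuous.norm.pow 2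
  have hψK : Continuous fun z => ψ z * ∑ i, ‖k i z‖ ^ 2 := ψ.continuous.mul hKcont
  have hψc : HasCompactSupport fun z => ψ z * ∑ i, ‖k i z‖ ^ 2 := ψ.hasCompactSupport.mul_right
  have hpos : 0 < ∫ z, ψ z * ∑ i, ‖k i z‖ ^ 2 := by
    refine hψK.integral_pos_of_hasCompactSupport_nonneg_nonzero hψc (fun z => ?_) (x := z₀) ?_
    · exact mul_nonneg ψ.nonneg (Finset.sum_nonneg fun i _ => by positivity)
    · have : ψ z₀ = 1 := ψ.one_of_mem_closedBall (Metric.mem_closedBall_self (by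
        change (0 : ℝ) ≤ ε / 2; linarith))
      rw [this, one_mul]; exact hne
  have hq : 1 < (r / ρ) ^ 2 := one_lt_pow₀ ((one_lt_div hρ0).2 hr₁) two_ne_zero
  -- The bump `ψ` is supported where the squared weight is at least `(r/ρ)^(2n)`. A positive mass of
  -- `k` near `z₀` would then exceed the uniform bound for large `n`.
  have hlow : ∀ n : ℕ, ((r / ρ) ^ 2) ^ n * ∫ z, ψ z * ∑ i, ‖k i z‖ ^ 2 ≤ 32 * R ^ 2 * L := by
    intro n
    refine le_trans ?_ (hbound n)
    rw [← integral_const_mul]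
    refine integral_mono ((hψK.integrable_of_hasCompactSupport hψc).const_mul _)
      (integrable_finsetSum _ fun i _ => Ig n i) fun z => ?_
    change ((r / ρ) ^ 2) ^ n * (ψ z * ∑ i, ‖k i z‖ ^ 2) ≤ ∑ i, ‖g n i z‖ ^ 2
    have hK0 : 0 ≤ ∑ i, ‖k i z‖ ^ 2 := Finset.sum_nonneg fun i _ => by positivity
    have hG0 : 0 ≤ ∑ i, ‖g n i z‖ ^ 2 := Finset.sum_nonneg fun i _ => by positivity
    by_cases hz : z ∈ Metric.ball z₀ ε
    · by_cases hza : z = a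
      · subst hza
        have : ∑ i, ‖k i z‖ ^ 2 = 0 := Finset.sum_eq_zero fun i _ => by
          rw [hkδ i z (Metric.mem_ball_self hδ)]; simp
        rw [this, mul_zero, mul_zero]; exact hG0
      · have hzρ : ‖z - a‖ < ρ := by
          have := hεsub hz
          rwa [Metric.mem_ball, dist_eq_norm] at this
        have hza0 : 0 < ‖z - a‖ := norm_pos_iff.2 (sub_ne_zero.2 hza)
        have h1 : ((r / ρ) ^ 2) ^ n ≤ ‖((r : ℂ) / (z - a)) ^ n‖ ^ 2 := by
          rw [norm_pow, norm_div, norm_real, Real.norm_of_nonneg hr0.le, ← pow_mul, ← pow_mul,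
            mul_comm 2 n]
          gcongr
        have h2 : ψ z * ∑ i, ‖k i z‖ ^ 2 ≤ ∑ i, ‖k i z‖ ^ 2 :=
          mul_le_of_le_one_left hK0 ψ.le_one
        simp only [hg, norm_mul, mul_pow, ← Finset.mul_sum]
        exact mul_le_mul h1 h2 (mul_nonneg ψ.nonneg hK0) (sq_nonneg _)
    · have : ψ z = 0 := ψ.zero_of_le_dist (by
        rw [Metric.mem_ball, not_lt] at hz; exact hz)
      rw [this, zero_mul, mul_zero]; exact hG0
  obtain ⟨n, hn⟩ := pow_unbounded_of_one_lt (32 * R ^ 2 * L / ∫ z, ψ z * ∑ i, ‖k i z‖ ^ 2) hq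
  rw [div_lt_iff₀ hpos] at hn
  exact absurd (hlow n) (not_le.2 hn)

namespace IsMinimalChart

variable {Ω : Set ℂ} {P : ℂ → C7}

/-- Unique continuation for a component of a minimal surface in `S⁶`. -/
lemma eventually_dotC_eq_zero (H : IsMinimalChart Ω P) {p : ℂ} (hp : p ∈ Ω) {u : C7}
    (hu : conjC u = u) (hfreq : ∃ᶠ a in nhds p, ∀ᶠ z in nhds a, dotC u (P z) = 0) :
    ∀ᶠ z in nhds p, dotC u (P z) = 0 := by
  obtain ⟨r, hr, hrΩ⟩ := Metric.nhds_basis_closedBall.mem_iff.1 (H.isOpen.mem_nhds hp)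
  obtain ⟨C₀, hC₀⟩ := (isCompact_closedBall p r).exists_bound_of_continuousOn
    (H.smooth_confFactor.continuousOn.mono hrΩ)
  -- The maximum with `1` accounts for the first equation of the system below, whose coefficient has
  -- modulus one.
  set C := max C₀ 1
  have hC1 : 1 ≤ C := le_max_right _ _
  set R := min (r / 2) (1 / (6 * C)) with hRdef
  have hC0 : 0 < C := by linarith
  have hR : 0 < R := lt_min (by linarith) (by positivity)
  have hRC : 32 * R ^ 2 * C ^ 2 ≤ 1 := by
    have h1 : R * C ≤ 1 / 6 := by
      calc R * C ≤ 1 / (6 * C) * C := by gcongr; exact min_le_right _ _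
        _ = 1 / 6 := by field_simp
    have h2 : 0 ≤ R * C := by positivity
    nlinarith
  -- The radius `R` was fixed from bounds around `p` before choosing the centre. Hence `a` can be
  -- taken within `R` of `p`, and the disc about `a` on which the estimate holds contains `p`.
  obtain ⟨a, ha, hzero⟩ := (hfreq.and_eventually (Metric.ball_mem_nhds p hR)).exists
  have hsub : Metric.ball a R ⊆ Metric.closedBall p r := by
    intro z hz
    have h1 := Metric.mem_ball.1 hz
    have h2 := Metric.mem_ball.1 hzero
    have h3 : R ≤ r / 2 := min_le_left _ _
    rw [Metric.mem_closedBall]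
    linarith [dist_triangle z a p]
  have hsubΩ := hsub.trans hrΩ
  obtain ⟨δ, hδ, hδz⟩ := Metric.eventually_nhds_iff_ball.1 ha
  have hd : ∀ {f : ℂ → C7} {w : ℂ} (σ : ℂ), DifferentiableAt ℝ f w →
      wirt σ (fun w => dotC u (f w)) w = dotC u (wirt σ f w) := fun {f w} σ hf =>
    wirt_clm (dotL u) σ hf
  -- For real `u` the pair `(⟨u, P⟩, ⟨u, P_z⟩)` has `z̄`-derivatives `conj ⟨u, P_z⟩` and `-ρ ⟨u,
  -- P⟩`. The conjugation prevents a complex linear system, but an inequality between norms is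
  -- enough.
  have key := eq_zero_of_norm_dzb_le (ι := Fin 2) (a := a) (R := R) (C := C) (δ := min δ R)
    (u := ![fun z => dotC u (P z), fun z => dotC u (dz P z)]) ?_ (lt_min hδ hR) ?_ ?_ hRC
  · filter_upwards [Metric.isOpen_ball.mem_nhds (show p ∈ Metric.ball a R by
      rw [Metric.mem_ball, dist_comm]; exact hzero)] with z hz
    exact key z hz 0
  · intro i
    fin_cases i
    · exact contDiffOn_dotC contDiffOn_const (H.smooth.mono hsubΩ)
    · exact contDiffOn_dotC contDiffOn_const ((H.smooth_wirt _).mono hsubΩ)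
  · intro i z hz
    have hzδ := Metric.ball_subset_ball (min_le_left _ _) hz
    fin_cases i
    · exact hδz z hzδ
    · change dotC u (dz P z) = 0
      rw [dz, ← hd (-I) (H.diff (hsubΩ (Metric.ball_subset_ball (min_le_right _ _) hz)))]
      exact wirt_eq_zero_of_eventually_const _ 0
        (Filter.eventually_of_mem (Metric.isOpen_ball.mem_nhds hzδ) hδz)
  · intro z hz
    have hzΩ := hsubΩ hz
    have h1 : dzb (fun z => dotC u (P z)) z = starRingEnd ℂ (dotC u (dz P z)) := by
      rw [dzb, hd I (H.diff hzΩ), ← dotC_conjC, hu, H.conj_dz hzΩ]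
    have h2 : dzb (fun z => dotC u (dz P z)) z = -confFactor P z * dotC u (P z) := by
      rw [dzb, hd I (H.diff_wirt hzΩ _), show wirt I (dz P) z = _ from H.harmonic z hzΩ,
        dotC_smul_right]
      rfl
    simp only [Fin.sum_univ_two, Matrix.cons_val_zero, Matrix.cons_val_one]
    rw [h1, h2, RCLike.norm_conj, norm_mul, norm_neg, mul_pow]
    have h3 : ‖confFactor P z‖ ≤ C := (hC₀ z (hsub hz)).trans (le_max_left _ _)
    have h4 : ‖confFactor P z‖ ^ 2 ≤ C ^ 2 := by gcongr
    have h5 : 1 ≤ C ^ 2 := one_le_pow₀ hC1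
    nlinarith [sq_nonneg ‖dotC u (P z)‖, sq_nonneg ‖dotC u (dz P z)‖]

end IsMinimalChart
end SixSphere

namespace SixSphere

open Complex

/-! ### Complexification of real vectors -/

/-- The inclusion of `ℝ⁷` in `ℂ⁷`. -/
noncomputable def cpx : E7 →L[ℝ] C7 :=
  LinearMap.toContinuousLinearMap
    { toFun := fun x => WithLp.toLp 2 fun k => ((x k : ℝ) : ℂ)
      map_add' := fun x y => by ext i; simp
      map_smul' := fun c x => by ext i; simp }

@[simp] lemma cpx_coe (x : E7) (i : Fin 7) : cpx x i = ((x i : ℝ) : ℂ) := rfl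

/-- The real part of a complex vector. -/
noncomputable def reC (x : C7) : E7 := WithLp.toLp 2 fun k => (x k).re

@[simp] lemma reC_coe (x : C7) (i : Fin 7) : reC x i = (x i).re := rfl

/-- The real part as a continuous linear map. -/
noncomputable def reL : C7 →L[ℝ] E7 :=
  LinearMap.toContinuousLinearMap
    { toFun := reC
      map_add' := fun x y => by ext i; simp
      map_smul' := fun c x => by ext i; simp }

lemma reC_cpx (x : E7) : reC (cpx x) = x := by ext i; simp

lemma cpx_injective : Function.Injective cpx := Function.LeftInverse.injective reC_cpx

@[simp] lemma conjC_cpx (x : E7) : conjC (cpx x) = cpx x := by ext i; simp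

lemma cpx_reC {x : C7} (hx : conjC x = x) : cpx (reC x) = x := by
  ext i
  have : starRingEnd ℂ (x i) = x i := congrArg (fun y : C7 => y i) hx
  simpa using Complex.conj_eq_iff_re.1 this

@[simp] lemma dotC_cpx (x y : E7) : dotC (cpx x) (cpx y) = (⟪x, y⟫ : ℝ) := by
  simp [dotC, PiLp.inner_apply, mul_comm]

lemma crossC_cpx (x y : E7) : crossC (cpx x) (cpx y) = cpx (cross x y) := by
  ext i; fin_cases i <;> simp [crossC, cross]

lemma cpx_smul (r : ℝ) (x : E7) : cpx (r • x) = (r : ℂ) • cpx x := by ext i; simp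

section Calculus

variable {f : ℂ → E7} {Ω : Set ℂ} {z : ℂ}

lemma fderiv_cpx (hf : DifferentiableAt ℝ f z) (v : ℂ) :
    fderiv ℝ (fun w => cpx (f w)) z v = cpx (fderiv ℝ f z v) := by
  have h : HasFDerivAt (fun w => cpx (f w)) (cpx.comp (fderiv ℝ f z)) z :=
    cpx.hasFDerivAt.comp z hf.hasFDerivAt
  rw [h.fderiv]; rfl

lemma contDiffOn_cpx (hf : ContDiffOn ℝ ∞ f Ω) : ContDiffOn ℝ ∞ (fun w => cpx (f w)) Ω :=
  cpx.contDiff.comp_contDiffOn hf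

lemma fderiv_fderiv_cpx (hΩ : IsOpen Ω) (hf : ContDiffOn ℝ ∞ f Ω) (hz : z ∈ Ω) (u v : ℂ) :
    fderiv ℝ (fderiv ℝ (fun w => cpx (f w))) z u v =
      cpx (fderiv ℝ (fun w => fderiv ℝ f w v) z u) := by
  have hd : ∀ w ∈ Ω, DifferentiableAt ℝ f w := fun w hw =>
    (hf.contDiffAt (hΩ.mem_nhds hw)).differentiableAt (by simp)
  have hd2 : ContDiffOn ℝ ∞ (fun w => fderiv ℝ f w v) Ω :=
    (hf.fderiv_of_isOpen hΩ (by simp)).clm_apply contDiffOn_const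
  have hd3 : DifferentiableAt ℝ (fderiv ℝ (fun w => cpx (f w))) z :=
    (((contDiffOn_cpx hf).fderiv_of_isOpen hΩ (m := ∞) (by simp)).contDiffAt
      (hΩ.mem_nhds hz)).differentiableAt (by simp)
  rw [← fderiv_cpx ((hd2.contDiffAt (hΩ.mem_nhds hz)).differentiableAt (by simp))]
  have h1 : fderiv ℝ (fun w => fderiv ℝ (fun w => cpx (f w)) w v) z u =
      fderiv ℝ (fderiv ℝ (fun w => cpx (f w))) z u v := by
    rw [fderiv_clm_apply hd3 (differentiableAt_const v)]; simp
  rw [← h1]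
  congr 1
  exact Filter.EventuallyEq.fderiv_eq
    (Filter.eventually_of_mem (hΩ.mem_nhds hz) fun w hw => fderiv_cpx (hd w hw) v)

end Calculus

/-! ### Normal projections -/

lemma differentiableAt_of_contDiffOn_real {f : ℂ → E7} {Ω : Set ℂ} (hf : ContDiffOn ℝ ∞ f Ω)
    (hΩ : IsOpen Ω) {z : ℂ} (hz : z ∈ Ω) : DifferentiableAt ℝ f z :=
  (hf.contDiffAt (hΩ.mem_nhds hz)).differentiableAt (by simp)

lemma normalProj_eq_zero_iff (G : ℂ → E7) (z : ℂ) (w : E7) :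
    normalProj G z w = 0 ↔ w ∈ tangentPlane G z := by
  rw [normalProj, Submodule.starProjection_apply_eq_zero_iff, Submodule.orthogonal_orthogonal]

lemma mem_orthogonal_tangentPlane (G : ℂ → E7) (z : ℂ) {w : E7} (h1 : ⟪fderiv ℝ G z 1, w⟫ = 0)
    (hI : ⟪fderiv ℝ G z I, w⟫ = 0) : w ∈ (tangentPlane G z)ᗮ := by
  rw [Submodule.mem_orthogonal]
  rintro _ ⟨v, rfl⟩
  have hv : v = v.re • (1 : ℂ) + v.im • I := by simp
  change ⟪fderiv ℝ G z v, w⟫ = 0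
  rw [hv, map_add, map_smul, map_smul, inner_add_left, inner_smul_left, inner_smul_left, h1, hI]
  simp

lemma normalProj_eq_self (G : ℂ → E7) (z : ℂ) {w : E7} (hw : w ∈ (tangentPlane G z)ᗮ) :
    normalProj G z w = w :=
  Submodule.starProjection_eq_self_iff.2 hw

lemma inner_normalProj (G : ℂ → E7) (z : ℂ) (u : E7) {w : E7} (hw : w ∈ (tangentPlane G z)ᗮ) :
    ⟪normalProj G z u, w⟫ = ⟪u, w⟫ := by
  rw [normalProj, Submodule.inner_starProjection_left_eq_right,
    Submodule.starProjection_eq_self_iff.2 hw]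

/-! ### The associated surface in a coordinate -/

/-- `X` and `G` are the local expressions of a conformal harmonic immersion and of its associated
surface. -/
structure IsAssociatedChart (Ω : Set ℂ) (X G : ℂ → E7) : Prop where
  minimal : IsMinimalChart Ω (fun z => cpx (X z))
  smooth_left : ContDiffOn ℝ ∞ X Ω
  smooth : ContDiffOn ℝ ∞ G Ω
  deriv_eq : ∀ z ∈ Ω, ∀ v : ℂ, fderiv ℝ G z v = cross (X z) (fderiv ℝ X z (I * v))

namespace IsAssociatedChart

variable {Ω : Set ℂ} {X G : ℂ → E7} {z : ℂ}

local notation "P" => fun z => cpx (X z)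
local notation "Q" => fun z => cpx (G z)

lemma wirt_assoc (K : IsAssociatedChart Ω X G) (hz : z ∈ Ω) :
    dz Q z = I • crossC (cpx (X z)) (dz P z) ∧ dzb Q z = -(I • crossC (cpx (X z)) (dzb P z)) := by
  have hX : DifferentiableAt ℝ X z :=
    differentiableAt_of_contDiffOn_real K.smooth_left K.minimal.isOpen hz
  have hG : DifferentiableAt ℝ G z := differentiableAt_of_contDiffOn_real K.smooth K.minimal.isOpen hz
  have e1 : fderiv ℝ Q z 1 = crossC (cpx (X z)) (I • dz P z - I • dzb P z) := by
    rw [fderiv_cpx hG, K.deriv_eq z hz, ← crossC_cpx, ← fderiv_cpx hX, mul_one, fderiv_I_eq]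
  have e2 : fderiv ℝ Q z I = -crossC (cpx (X z)) (dz P z + dzb P z) := by
    rw [fderiv_cpx hG, K.deriv_eq z hz, ← crossC_cpx, ← fderiv_cpx hX, I_mul_I, map_neg,
      fderiv_one_eq, crossC_neg_right]
  constructor
  · rw [dz, wirt, e1, e2]
    simp only [crossC_add_right, crossC_sub_right, crossC_smul_right]
    module
  · rw [dzb, wirt, e1, e2]
    simp only [crossC_add_right, crossC_sub_right, crossC_smul_right]
    module

lemma frame (K : IsAssociatedChart Ω X G) (hz : z ∈ Ω) :
    IsConformalFrame (cpx (X z)) (dz P z) (dzb P z) (confFactor P z) := K.minimal.frame hz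

lemma dots (K : IsAssociatedChart Ω X G) (hz : z ∈ Ω) :
    dotC (dz Q z) (dz Q z) = 0 ∧ dotC (dz Q z) (dzb Q z) = confFactor P z ∧
    dotC (dzb Q z) (dz Q z) = confFactor P z ∧ dotC (dzb Q z) (dzb Q z) = 0 := by
  obtain ⟨h1, h2⟩ := K.wirt_assoc hz
  obtain ⟨d1, d2, d3, d4⟩ := (K.frame hz).pCross_dots
  rw [h1, h2]
  simp only [dotC_neg_left, dotC_neg_right, dotC_smul_left, dotC_smul_right, d1, d2, d3, d4]
  refine ⟨by simp, ?_, ?_, by simp⟩ <;> linear_combination -confFactor P z * I_sq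

lemma diff (K : IsAssociatedChart Ω X G) (hz : z ∈ Ω) : DifferentiableAt ℝ G z :=
  differentiableAt_of_contDiffOn_real K.smooth K.minimal.isOpen hz

lemma confFactor_re (K : IsAssociatedChart Ω X G) (hz : z ∈ Ω) :
    ((confFactor P z).re : ℂ) = confFactor P z := Complex.conj_eq_iff_re.1 (K.frame hz).conj_rho

lemma firstForm_eq (K : IsAssociatedChart Ω X G) (hz : z ∈ Ω) :
    firstForm G z = (2 * (confFactor P z).re) • (1 : Matrix (Fin 2) (Fin 2) ℝ) := by
  obtain ⟨d1, d2, d3, d4⟩ := K.dots hz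
  have key : ∀ u v : ℂ, ((⟪fderiv ℝ G z u, fderiv ℝ G z v⟫ : ℝ) : ℂ) =
      dotC (u • dz Q z + starRingEnd ℂ u • dzb Q z) (v • dz Q z + starRingEnd ℂ v • dzb Q z) := by
    intro u v
    rw [← dotC_cpx, ← fderiv_cpx (K.diff hz), ← fderiv_cpx (K.diff hz), fderiv_apply_eq,
      fderiv_apply_eq Q]
  ext i j
  apply Complex.ofReal_injective
  rw [firstForm, Matrix.of_apply, key]
  simp only [dotC_add_left, dotC_add_right, dotC_smul_left, dotC_smul_right, d1, d2, d3, d4]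
  have := K.confFactor_re hz
  fin_cases i <;> fin_cases j <;> simp [dir, this] <;> ring_nf
  simp

/-- In `∂_z̄ (i P × P_z)` the term `P × P_zz̄` drops out because `P_zz̄` is a multiple of `P`; what
remains, `i P_z̄ × P_z`, is `ρ h` by definition of `h`. -/
lemma dzb_dz_assoc (K : IsAssociatedChart Ω X G) (hz : z ∈ Ω) :
    dzb (dz Q) z = confFactor P z • meanField P z := by
  have H := K.minimal
  have h1 : dzb (dz Q) z = dzb (fun w => crossC (I • cpx (X w)) (dz P w)) z :=
    wirt_congr _ ((H.eventually hz).mono fun w hw => by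
      simp only [(K.wirt_assoc hw).1, crossC_smul_left])
  have h2 : wirt I (fun w => I • cpx (X w)) z = I • dzb P z :=
    wirt_clm (I • ContinuousLinearMap.id ℂ C7) I (H.diff hz)
  rw [h1, dzb, wirt_crossC I (f := fun w => I • cpx (X w)) ((H.diff hz).const_smul I)
    (H.diff_wirt hz (-I)), h2, show wirt I (dz P) z = _ from H.harmonic z hz, meanField, meanVec]
  have := (H.frame hz).ne
  simp only [crossC_smul_left, crossC_smul_right, crossC_self, smul_zero, add_zero, smul_smul]
  congr 1; field_simp

lemma dz_dz_assoc (K : IsAssociatedChart Ω X G) (hz : z ∈ Ω) :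
    dz (dz Q) z = I • crossC (cpx (X z)) (dz (dz P) z) := by
  have H := K.minimal
  have h1 : dz (dz Q) z = dz (fun w => crossC (I • cpx (X w)) (dz P w)) z :=
    wirt_congr _ ((H.eventually hz).mono fun w hw => by
      simp only [(K.wirt_assoc hw).1, crossC_smul_left])
  have h2 : wirt (-I) (fun w => I • cpx (X w)) z = I • dz P z :=
    wirt_clm (I • ContinuousLinearMap.id ℂ C7) (-I) (H.diff hz)
  rw [h1, dz, wirt_crossC (-I) (f := fun w => I • cpx (X w)) ((H.diff hz).const_smul I)
    (H.diff_wirt hz (-I)), h2]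
  simp only [crossC_smul_left, crossC_self, smul_zero, zero_add]

lemma dotC_dz_dz_assoc (K : IsAssociatedChart Ω X G) (hz : z ∈ Ω) :
    dotC (dz (dz Q) z) (meanField P z) =
      -I * dotC (crossC (cpx (X z)) (meanField P z)) (secondSection P z) := by
  have F := K.frame hz
  have h1 : dotC (crossC (cpx (X z)) (dz P z)) (meanField P z) = 0 := F.pCrossA_mean
  rw [K.dz_dz_assoc hz, show dz (dz P) z = _ from IsMinimalChart.dz_dz_eq z, crossC_add_right,
    crossC_smul_right, dotC_smul_left, dotC_add_left, dotC_smul_left, h1,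
    crossC_anticomm _ (secondSection P z), dotC_neg_left, dotC_crossC_left, dotC_comm (crossC _ _)]
  ring

/-- The mean curvature vector as a real vector. -/
lemma cpx_reC_meanField (K : IsAssociatedChart Ω X G) (hz : z ∈ Ω) :
    cpx (reC (meanField P z)) = meanField P z := cpx_reC (K.frame hz).conj_mean

lemma contDiffAt (K : IsAssociatedChart Ω X G) (hz : z ∈ Ω) : ContDiffAt ℝ 2 Q z :=
  ((contDiffOn_cpx K.smooth).contDiffAt (K.minimal.isOpen.mem_nhds hz)).of_le two_le_infty

lemma meanField_mem (K : IsAssociatedChart Ω X G) (hz : z ∈ Ω) :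
    reC (meanField P z) ∈ (tangentPlane G z)ᗮ := by
  have F := K.frame hz
  have h1 : dotC (crossC (cpx (X z)) (dz P z)) (meanField P z) = 0 := F.pCrossA_mean
  have h2 : dotC (crossC (cpx (X z)) (dzb P z)) (meanField P z) = 0 := F.pCrossB_mean
  obtain ⟨w1, w2⟩ := K.wirt_assoc hz
  have key : ∀ v : ℂ, ⟪fderiv ℝ G z v, reC (meanField P z)⟫ = 0 := by
    intro v
    apply Complex.ofReal_injective
    rw [← dotC_cpx, ← fderiv_cpx (K.diff hz), K.cpx_reC_meanField hz, fderiv_apply_eq,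
      show dz Q z = _ from w1, show dzb Q z = _ from w2]
    simp only [dotC_add_left, dotC_neg_left, dotC_smul_left, h1, h2]
    simp
  exact mem_orthogonal_tangentPlane G z (key 1) (key I)

lemma second_deriv_add (K : IsAssociatedChart Ω X G) (hz : z ∈ Ω) :
    fderiv ℝ (fun w => fderiv ℝ G w 1) z 1 + fderiv ℝ (fun w => fderiv ℝ G w I) z I =
      (4 * (confFactor P z).re) • reC (meanField P z) := by
  apply cpx_injective
  rw [map_add, cpx_smul, K.cpx_reC_meanField hz,
    ← fderiv_fderiv_cpx K.minimal.isOpen K.smooth hz, ← fderiv_fderiv_cpx K.minimal.isOpen K.smooth hz]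
  have h := (wirt_wirt I (-I) (K.contDiffAt hz)).symm.trans (K.dzb_dz_assoc hz)
  simp only [add_neg_cancel, zero_smul, add_zero, mul_neg, I_mul_I, neg_neg, one_smul] at h
  push_cast
  rw [K.confFactor_re hz, mul_smul, ← h]
  module

lemma meanCurvature_eq (K : IsAssociatedChart Ω X G) (hz : z ∈ Ω) :
    meanCurvature G z = reC (meanField P z) := by
  have h0 : (confFactor P z).re ≠ 0 := by
    intro h; have := K.confFactor_re hz; rw [h] at this; exact (K.frame hz).ne this.symm
  have hinv : (firstForm G z)⁻¹ =
      (2 * (confFactor P z).re)⁻¹ • (1 : Matrix (Fin 2) (Fin 2) ℝ) := by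
    rw [K.firstForm_eq hz]
    apply Matrix.inv_eq_right_inv
    rw [smul_mul_smul_comm, one_mul, mul_inv_cancel₀ (by simpa using h0), one_smul]
  have h := congrArg (normalProj G z) (K.second_deriv_add hz)
  -- As the metric is `2ρ` times the identity, the trace formula is the normal part of the Laplacian
  -- of `G` over `4ρ`, and that Laplacian is already the normal vector `4ρ h`.
  rw [map_smul, normalProj_eq_self G z (K.meanField_mem hz), map_add] at h
  rw [meanCurvature, hinv]
  simp only [Fin.sum_univ_two, Matrix.smul_apply, Matrix.one_apply_eq, Matrix.one_apply,
    secondForm]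
  simp only [dir, Matrix.cons_val_zero, Matrix.cons_val_one, smul_eq_mul, mul_one]
  simp only [Fin.isValue, zero_ne_one, one_ne_zero, if_false, mul_zero, zero_smul, add_zero,
    zero_add]
  rw [← smul_add, h, smul_smul, smul_smul]
  convert one_smul ℝ _ using 2
  field_simp; norm_num

/-- The scalar second fundamental form in the direction of the mean curvature vector. -/
lemma inner_secondForm (K : IsAssociatedChart Ω X G) (hz : z ∈ Ω) (i j : Fin 2) :
    ⟪secondForm G z i j, meanCurvature G z⟫ =
      ⟪fderiv ℝ (fun w => fderiv ℝ G w (dir j)) z (dir i), reC (meanField P z)⟫ := by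
  rw [K.meanCurvature_eq hz, secondForm, inner_normalProj G z _ (K.meanField_mem hz)]

/-- `F` is pseudo-umbilical at a point if and only if `⟨N, f₂⟩` vanishes there, and then the factor
is `1`. -/
lemma dotC_eq_zero_iff (K : IsAssociatedChart Ω X G) (hz : z ∈ Ω) :
    dotC (crossC (cpx (X z)) (meanField P z)) (secondSection P z) = 0 ↔
      ⟪fderiv ℝ (fun w => fderiv ℝ G w 1) z 1, reC (meanField P z)⟫ =
        ⟪fderiv ℝ (fun w => fderiv ℝ G w I) z I, reC (meanField P z)⟫ ∧
      ⟪fderiv ℝ (fun w => fderiv ℝ G w I) z 1, reC (meanField P z)⟫ = 0 := by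
  have h := K.dotC_dz_dz_assoc hz
  have h2 := wirt_wirt (-I) (-I) (K.contDiffAt hz)
  rw [fderiv_fderiv_cpx K.minimal.isOpen K.smooth hz, fderiv_fderiv_cpx K.minimal.isOpen K.smooth hz,
    fderiv_fderiv_cpx K.minimal.isOpen K.smooth hz] at h2
  rw [show dz (dz Q) z = _ from h2, ← K.cpx_reC_meanField hz] at h
  simp only [dotC_add_left, dotC_smul_left, dotC_cpx] at h
  rw [K.cpx_reC_meanField hz] at h
  set A := ⟪fderiv ℝ (fun w => fderiv ℝ G w 1) z 1, reC (meanField P z)⟫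
  set B := ⟪fderiv ℝ (fun w => fderiv ℝ G w I) z I, reC (meanField P z)⟫
  set C := ⟪fderiv ℝ (fun w => fderiv ℝ G w I) z 1, reC (meanField P z)⟫
  set x := dotC (crossC (cpx (X z)) (meanField P z)) (secondSection P z)
  -- The `h`-component of `F_zz` is the Hopf coefficient: its real and imaginary parts measure the
  -- failure of umbilicity along `h`.
  have hx : x = ((C / 2 : ℝ) : ℂ) + ((A - B) / 4 : ℝ) * I := by
    push_cast
    linear_combination (-I) * h + (x - (C / 2 : ℂ) + (B / 4 : ℂ) * I) * I_sq
  rw [hx, Complex.ext_iff]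
  simp
  constructor
  · rintro ⟨h1, h2⟩; exact ⟨by linarith, by linarith⟩
  · rintro ⟨h1, h2⟩; exact ⟨by linarith, by linarith⟩

lemma dotC_eq_zero_of_umbilical (K : IsAssociatedChart Ω X G) (hz : z ∈ Ω) {l : ℝ}
    (h : ∀ i j : Fin 2, ⟪secondForm G z i j, meanCurvature G z⟫ = l * firstForm G z i j) :
    dotC (crossC (cpx (X z)) (meanField P z)) (secondSection P z) = 0 := by
  rw [K.dotC_eq_zero_iff hz]
  simp only [K.inner_secondForm hz, K.firstForm_eq hz] at h
  constructor
  · exact (h 0 0).trans (h 1 1).symm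
  · have := h 0 1; simpa [dir] using this

lemma umbilical_of_dotC_eq_zero (K : IsAssociatedChart Ω X G) (hz : z ∈ Ω)
    (h : dotC (crossC (cpx (X z)) (meanField P z)) (secondSection P z) = 0) (i j : Fin 2) :
    ⟪secondForm G z i j, meanCurvature G z⟫ = 1 * firstForm G z i j := by
  obtain ⟨h1, h2⟩ := (K.dotC_eq_zero_iff hz).1 h
  have hs := congrArg (fun x => ⟪x, reC (meanField P z)⟫) (K.second_deriv_add hz)
  have hm : ⟪reC (meanField P z), reC (meanField P z)⟫ = 1 := by
    apply Complex.ofReal_injective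
    rw [← dotC_cpx, K.cpx_reC_meanField hz, ofReal_one]
    exact (K.frame hz).mean_mean
  simp only [inner_add_left, real_inner_smul_left, hm, mul_one] at hs
  have hsymm : fderiv ℝ (fun w => fderiv ℝ G w 1) z I = fderiv ℝ (fun w => fderiv ℝ G w I) z 1 := by
    apply cpx_injective
    rw [← fderiv_fderiv_cpx K.minimal.isOpen K.smooth hz,
      ← fderiv_fderiv_cpx K.minimal.isOpen K.smooth hz]
    exact ((K.contDiffAt hz).isSymmSndFDerivAt (by simp)).eq I 1
  rw [K.inner_secondForm hz, K.firstForm_eq hz]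
  fin_cases i <;> fin_cases j <;> simp [dir, hsymm, h2] <;> linarith

lemma cpx_fderiv_meanCurvature (K : IsAssociatedChart Ω X G) (hz : z ∈ Ω) (v : ℂ) :
    cpx (fderiv ℝ (meanCurvature G) z v) = fderiv ℝ (meanField P) z v := by
  have hev : meanCurvature G =ᶠ[nhds z] fun w => reC (meanField P w) :=
    (K.minimal.eventually hz).mono fun w hw => K.meanCurvature_eq hw
  have hre : DifferentiableAt ℝ (fun w => reC (meanField P w)) z :=
    reL.differentiableAt.comp z (K.minimal.diff_meanField hz)
  rw [hev.fderiv_eq, ← fderiv_cpx hre]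
  congr 1
  exact Filter.EventuallyEq.fderiv_eq
    ((K.minimal.eventually hz).mono fun w hw => K.cpx_reC_meanField hw)

lemma parallel_of_cross_eq_zero (K : IsAssociatedChart Ω X G) (hz : z ∈ Ω)
    (h : crossC (dzb P z) (secondSection P z) = 0) (v : ℂ) :
    normalProj G z (fderiv ℝ (meanCurvature G) z v) = 0 := by
  rw [normalProj_eq_zero_iff]
  -- When `b × f₂ = 0` both Wirtinger derivatives give `dh = -dF`, so the tangent direction `-v`
  -- realises the derivative of `h`.
  refine ⟨-v, ?_⟩
  change fderiv ℝ G z (-v) = _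
  apply cpx_injective
  obtain ⟨w1, w2⟩ := K.wirt_assoc hz
  have h' : crossC (dz P z) (conjC (secondSection P z)) = 0 := by
    rw [← (K.frame hz).conj_b, ← conjC_crossC, h, conjC_zero]
  rw [K.cpx_fderiv_meanCurvature hz, ← fderiv_cpx (K.diff hz), fderiv_apply_eq,
    fderiv_apply_eq (meanField _), show dz Q z = _ from w1, show dzb Q z = _ from w2,
    K.minimal.dz_meanField hz, K.minimal.dzb_meanField hz, h, h']
  simp

/-- Where the mean curvature of a pseudo-umbilical associated surface is parallel, `f₂` is
isotropic. -/
lemma dotC_secondSection_self_eq_zero (K : IsAssociatedChart Ω X G) (hz : z ∈ Ω)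
    (hN : dotC (crossC (cpx (X z)) (meanField P z)) (secondSection P z) = 0)
    (h : ∀ v, normalProj G z (fderiv ℝ (meanCurvature G) z v) = 0) :
    dotC (secondSection P z) (secondSection P z) = 0 := by
  have F := K.frame hz
  obtain ⟨w1, w2⟩ := K.wirt_assoc hz
  have key : ∀ v, ∃ x y : ℂ, fderiv ℝ (meanField P) z v =
      x • crossC (cpx (X z)) (dz P z) + y • crossC (cpx (X z)) (dzb P z) := by
    intro v
    obtain ⟨u, hu⟩ := (normalProj_eq_zero_iff G z _).1 (h v)
    change fderiv ℝ G z u = _ at hu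
    refine ⟨u * I, -(starRingEnd ℂ u * I), ?_⟩
    rw [← K.cpx_fderiv_meanCurvature hz, ← hu, ← fderiv_cpx (K.diff hz), fderiv_apply_eq,
      show dz Q z = _ from w1, show dzb Q z = _ from w2]
    module
  obtain ⟨x₁, y₁, e₁⟩ := key 1
  obtain ⟨x₂, y₂, e₂⟩ := key I
  obtain ⟨x, y, e⟩ : ∃ x y : ℂ, crossC (dzb P z) (secondSection P z) =
      x • crossC (cpx (X z)) (dz P z) + y • crossC (cpx (X z)) (dzb P z) := by
    have h1 : dz (meanField P) z = (1 / 2 : ℂ) • (fderiv ℝ (meanField P) z 1 +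
      (-I) • fderiv ℝ (meanField P) z I) := rfl
    rw [K.minimal.dz_meanField hz, e₁, e₂, sub_eq_iff_eq_add] at h1
    have h2 : crossC (dzb P z) (secondSection P z) = (confFactor P z / I) •
        ((I / confFactor P z) • crossC (dzb P z) (secondSection P z)) := by
      rw [smul_smul, div_mul_div_cancel₀ I_ne_zero, div_self F.ne, one_smul]
    rw [h2, h1]
    refine ⟨confFactor P z / I * ((1 / 2) * (x₁ - I * x₂) + I),
      confFactor P z / I * ((1 / 2) * (y₁ - I * y₂)), ?_⟩
    module
  obtain ⟨d1, d2, d3, d4⟩ := F.pCross_dots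
  have sp := K.minimal.dot_secondSection hz
  have sa := K.minimal.dz_dot_secondSection hz
  have sb := K.minimal.dzb_dot_secondSection hz
  have hm : crossC (dz P z) (dzb P z) = (I * confFactor P z) • meanField P z := F.cross_a_b
  -- Umbilicity enters through the four-form, which exchanges `f₂` with `P_z` and turns this product
  -- into a multiple of `⟨N, f₂⟩`. The companion product with `P × P_z̄` vanishes for purely
  -- algebraic reasons, so `b × f₂`, a combination of `P × P_z` and `P × P_z̄`, is zero.
  have ha : dotC (crossC (dzb P z) (secondSection P z)) (crossC (cpx (X z)) (dz P z)) = 0 := by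
    have h1 : fourFormC (dzb P z) (secondSection P z) (cpx (X z)) (dz P z) =
        -fourFormC (dzb P z) (dz P z) (cpx (X z)) (secondSection P z) := by
      rw [fourFormC_swap₃, fourFormC_swap₂, fourFormC_swap₃, neg_neg]
    simp only [fourFormC, F.bp, F.ba, dotC_comm (secondSection P z), sa, sp, sb, F.ap,
      crossC_anticomm (dzb P z) (dz P z), hm, dotC_neg_left, dotC_smul_left] at h1
    have h2 : dotC (meanField P z) (crossC (cpx (X z)) (secondSection P z)) = 0 := by
      rw [← dotC_crossC_left, crossC_anticomm, dotC_neg_left, hN, neg_zero]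
    rw [h2] at h1
    simpa using h1
  have hb : dotC (crossC (dzb P z) (secondSection P z)) (crossC (cpx (X z)) (dzb P z)) = 0 := by
    rw [crossC_anticomm (cpx (X z)), dotC_neg_right, dotC_crossC_crossC_self, F.bb, F.bp]; simp
  rw [e, dotC_add_left, dotC_smul_left, dotC_smul_left] at ha hb
  rw [d1, d3] at ha
  rw [d2, d4] at hb
  have hy : y = 0 := by simpa [F.ne] using ha
  have hx : x = 0 := by simpa [F.ne] using hb
  rw [hx, hy, zero_smul, zero_smul, add_zero] at e
  -- Since `b × f₂ = 0` and `⟨b, f₂⟩ = 0`, the double product formula reduces to `⟨f₂, f₂⟩ b = 0`,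
  -- and `b` is nonzero.
  have h3 := crossC_crossC_self (secondSection P z) (dzb P z)
  rw [crossC_anticomm _ (dzb P z), e, neg_zero, crossC_zero_right, dotC_comm _ (dzb P z), sb,
    zero_smul, zero_sub, eq_comm, neg_eq_zero, smul_eq_zero] at h3
  refine h3.resolve_right fun hb0 => F.ne ?_
  rw [← F.ab, hb0, dotC_zero_right]

end IsAssociatedChart
end SixSphere

namespace SixSphere

open Complex

/-! ### Conformal harmonic immersions in a chart -/

lemma isMinimalChart_of_conformal_harmonic {Ω : Set ℂ} {X : ℂ → E7} (hΩ : IsOpen Ω)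
    (hX : ContDiffOn ℝ ∞ X Ω) (hs : ∀ z ∈ Ω, ⟪X z, X z⟫ = 1)
    (hc : ∀ z ∈ Ω, ConformalAt X z)
    (hh : ∀ z ∈ Ω, ∀ u : E7, ⟪X z, u⟫ = 0 → ⟪Laplacian.laplacian X z, u⟫ = 0) :
    IsMinimalChart Ω (fun z => cpx (X z)) := by
  have hP := contDiffOn_cpx hX
  have hd : ∀ z ∈ Ω, DifferentiableAt ℝ X z := fun z hz =>
    differentiableAt_of_contDiffOn_real hX hΩ hz
  have hdP : ∀ z ∈ Ω, DifferentiableAt ℝ (fun z => cpx (X z)) z := fun z hz =>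
    differentiableAt_of_contDiffOn hP hΩ hz
  have hsP : ∀ z ∈ Ω, dotC (cpx (X z)) (cpx (X z)) = 1 := fun z hz => by
    rw [dotC_cpx, hs z hz, ofReal_one]
  have hconf : ∀ z ∈ Ω, ∃ c : ℝ, 0 < c ∧ dotC (dz (fun z => cpx (X z)) z) (dz (fun z => cpx (X z)) z) = 0 ∧
      dotC (dz (fun z => cpx (X z)) z) (dzb (fun z => cpx (X z)) z) = (c / 2 : ℝ) := by
    intro z hz
    obtain ⟨c, hc0, h⟩ := conformalAt_iff'.1 (hc z hz)
    refine ⟨c, hc0, ?_, ?_⟩ <;>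
    · simp only [dz, dzb, wirt, fderiv_cpx (hd z hz), dotC_smul_left, dotC_smul_right, dotC_add_left,
        dotC_add_right, dotC_cpx, h]
      simp [Complex.inner]
      ring_nf; simp
      try ring
  have hdot : ∀ z ∈ Ω, ∀ σ, dotC (cpx (X z)) (wirt σ (fun z => cpx (X z)) z) = 0 := by
    intro z hz σ
    have h := wirt_dotC σ (hdP z hz) (hdP z hz)
    rw [wirt_eq_zero_of_eventually_const σ 1
      (Filter.eventually_of_mem (hΩ.mem_nhds hz) hsP), dotC_comm (wirt _ _ _)] at h
    linear_combination (-1 / 2 : ℂ) * h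
  refine ⟨hΩ, hP, fun z _ => conjC_cpx _, hsP, fun z hz => ?_, fun z hz => ?_, fun z hz => ?_⟩
  · obtain ⟨c, -, h, -⟩ := hconf z hz
    exact h
  · obtain ⟨c, hc, -, h⟩ := hconf z hz
    rw [h]
    exact ofReal_ne_zero.2 (by positivity)
  · have hd2 : DifferentiableAt ℝ (fderiv ℝ X) z :=
      ((hX.fderiv_of_isOpen hΩ (m := ∞) (by simp)).contDiffAt
        (hΩ.mem_nhds hz)).differentiableAt (by simp)
    -- Testing harmonicity on the component of the Laplacian orthogonal to `X` shows that this
    -- component is zero. The factor is identified below by differentiating `⟨P, P_z⟩ = 0` in `z̄`.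
    have hL : Laplacian.laplacian X z = ⟪Laplacian.laplacian X z, X z⟫ • X z := by
      rw [← sub_eq_zero, ← inner_self_eq_zero (𝕜 := ℝ)]
      set u := Laplacian.laplacian X z - ⟪Laplacian.laplacian X z, X z⟫ • X z with hu
      have h1 : ⟪X z, u⟫ = 0 := by
        rw [hu, inner_sub_right, inner_smul_right, hs z hz, real_inner_comm]; ring
      nth_rewrite 1 [hu]
      rw [inner_sub_left, inner_smul_left, h1, hh z hz u h1]; simp
    have h2 : dzb (dz (fun z => cpx (X z))) z = (1 / 4 : ℂ) • cpx (Laplacian.laplacian X z) := by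
      have h3 := wirt_wirt I (-I) ((hP.contDiffAt (hΩ.mem_nhds hz)).of_le two_le_infty)
      simp only [add_neg_cancel, zero_smul, add_zero, mul_neg, I_mul_I, neg_neg, one_smul] at h3
      rw [dzb, dz, h3, fderiv_fderiv_cpx hΩ hX hz, fderiv_fderiv_cpx hΩ hX hz, ← map_add,
        InnerProductSpace.laplacian_eq_iteratedFDeriv_complexPlane]
      simp only [iteratedFDeriv_two_apply, Matrix.cons_val_zero, Matrix.cons_val_one]
      have h4 : ∀ u v : ℂ, fderiv ℝ (fun w => fderiv ℝ X w v) z u = fderiv ℝ (fderiv ℝ X) z u v := by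
        intro u v
        rw [fderiv_clm_apply hd2 (differentiableAt_const v)]; simp
      rw [h4, h4]
    have h5 := wirt_dotC I (hdP z hz)
      (differentiableAt_of_contDiffOn (contDiffOn_wirt hΩ (-I) hP) hΩ hz)
    rw [wirt_eq_zero_of_eventually_const I 0
      (Filter.eventually_of_mem (hΩ.mem_nhds hz) fun w hw => hdot w hw (-I))] at h5
    rw [show wirt I (wirt (-I) fun z => cpx (X z)) z = _ from h2, hL, cpx_smul, dotC_smul_right,
      dotC_smul_right, hsP z hz, dotC_comm] at h5
    rw [h2, hL, cpx_smul, smul_smul]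
    congr 1
    linear_combination -h5

/-! ### Charts of the surface -/

section Surfaces

variable {S : Type*} [TopologicalSpace S] [ChartedSpace ℂ S] [IsManifold 𝓘(ℂ, ℂ) ω S]

lemma contDiffOn_coordChange {e e' : OpenPartialHomeomorph S ℂ} (he : e ∈ atlas ℂ S)
    (he' : e' ∈ atlas ℂ S) : ContDiffOn ℂ ω (e' ∘ e.symm) (e.symm ≫ₕ e').source := by
  have h1 := contMDiffOn_of_mem_maximalAtlas (I := 𝓘(ℂ, ℂ)) (n := ω)
    (IsManifold.subset_maximalAtlas he')
  have h2 := contMDiffOn_symm_of_mem_maximalAtlas (I := 𝓘(ℂ, ℂ)) (n := ω)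
    (IsManifold.subset_maximalAtlas he)
  rw [← contMDiffOn_iff_contDiffOn]
  exact h1.comp (h2.mono fun z hz => hz.1) fun z hz => hz.2

variable (S) in
-- Smoothness of `φ`, `F` and local sections is meant over `ℝ`, whereas the surface is given by its
-- holomorphic atlas; restricting scalars in the transition maps bridges the two.
lemma isManifold_real : IsManifold 𝓘(ℝ, ℂ) ∞ S :=
  isManifold_of_contDiffOn _ _ _ fun e e' he he' => by
    simpa using ((contDiffOn_coordChange he he').restrict_scalars ℝ).of_le le_top

lemma contDiffOn_comp_symm {E : Type*} [NormedAddCommGroup E] [NormedSpace ℝ E]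
    {e : OpenPartialHomeomorph S ℂ} (he : e ∈ atlas ℂ S) {f : S → E} {U : Set S}
    (hf : ContMDiffOn 𝓘(ℝ, ℂ) 𝓘(ℝ, E) ∞ f U) :
    ContDiffOn ℝ ∞ (f ∘ e.symm) (e.target ∩ e.symm ⁻¹' U) := by
  have := isManifold_real S
  have h2 := contMDiffOn_symm_of_mem_maximalAtlas (I := 𝓘(ℝ, ℂ)) (n := ∞)
    (IsManifold.subset_maximalAtlas he)
  rw [← contMDiffOn_iff_contDiffOn]
  exact hf.comp (h2.mono fun z hz => hz.1) fun z hz => hz.2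

lemma contMDiffOn_comp_chart {E : Type*} [NormedAddCommGroup E] [NormedSpace ℝ E]
    {e : OpenPartialHomeomorph S ℂ} (he : e ∈ atlas ℂ S) {f : ℂ → E} {V : Set ℂ}
    (hf : ContDiffOn ℝ ∞ f V) :
    ContMDiffOn 𝓘(ℝ, ℂ) 𝓘(ℝ, E) ∞ (f ∘ e) (e.source ∩ e ⁻¹' V) := by
  have := isManifold_real S
  have h1 := contMDiffOn_of_mem_maximalAtlas (I := 𝓘(ℝ, ℂ)) (n := ∞)
    (IsManifold.subset_maximalAtlas he)
  rw [← contMDiffOn_iff_contDiffOn] at hf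
  exact hf.comp (h1.mono fun z hz => hz.1) fun z hz => hz.2

/-- A holomorphic change of coordinate multiplies `∂/∂z` by a non-zero factor. -/
lemma exists_dz_coordChange {e e' : OpenPartialHomeomorph S ℂ} (he : e ∈ atlas ℂ S)
    (he' : e' ∈ atlas ℂ S) {p : S} (hp : p ∈ e.source) (hp' : p ∈ e'.source) :
    ∃ c : ℂ, c ≠ 0 ∧ ∀ v : S → C7, DifferentiableAt ℝ (v ∘ e'.symm) (e' p) →
      dz (v ∘ e.symm) (e p) = c • dz (v ∘ e'.symm) (e' p) := by
  have hdiff : ∀ {e e' : OpenPartialHomeomorph S ℂ}, e ∈ atlas ℂ S → e' ∈ atlas ℂ S →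
      p ∈ e.source → p ∈ e'.source → DifferentiableAt ℂ (e' ∘ e.symm) (e p) := by
    intro e e' he he' hp hp'
    refine ((contDiffOn_coordChange he he').contDiffAt
      ((e.symm ≫ₕ e').open_source.mem_nhds ?_)).differentiableAt (by simp)
    simp [hp, hp']
  have hev : ∀ {e : OpenPartialHomeomorph S ℂ}, p ∈ e.source → ∀ {U : Set S}, IsOpen U → p ∈ U →
      ∀ᶠ z in nhds (e p), z ∈ e.target ∧ e.symm z ∈ U := by
    intro e hp U hU hpU
    refine Filter.Eventually.and (e.open_target.mem_nhds (e.map_source hp)) ?_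
    refine (e.continuousAt_symm (e.map_source hp)).eventually_mem (hU.mem_nhds ?_)
    rwa [e.left_inv hp]
  have hT := (hdiff he he' hp hp').hasDerivAt
  have hT' := (hdiff he' he hp' hp).hasDerivAt
  have hTp : (e' ∘ e.symm) (e p) = e' p := by simp [e.left_inv hp]
  refine ⟨deriv (e' ∘ e.symm) (e p), ?_, fun v hv => ?_⟩
  · intro h0
    rw [← hTp] at hT'
    have h1 := hT'.comp (e p) hT
    have h2 : HasDerivAt (fun z : ℂ => z) (deriv (e ∘ e'.symm) ((e' ∘ e.symm) (e p)) *
        deriv (e' ∘ e.symm) (e p)) (e p) := by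
      rw [hTp] at h1 ⊢
      refine h1.congr_of_eventuallyEq ?_
      filter_upwards [hev hp e'.open_source hp'] with z hz
      simp [e'.left_inv hz.2, e.right_inv hz.1]
    have h3 := h2.unique (hasDerivAt_id' (e p))
    rw [h0, mul_zero] at h3
    exact zero_ne_one h3
  · have h1 : v ∘ e.symm =ᶠ[nhds (e p)] (v ∘ e'.symm) ∘ (e' ∘ e.symm) := by
      filter_upwards [hev hp e'.open_source hp'] with z hz
      simp [e'.left_inv hz.2]
    have h2 : HasFDerivAt (v ∘ e'.symm) (fderiv ℝ (v ∘ e'.symm) (e' p)) ((e' ∘ e.symm) (e p)) := by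
      rw [hTp]; exact hv.hasFDerivAt
    have h3 := h2.comp (e p) (hT.hasFDerivAt.restrictScalars ℝ)
    have h4 : ∀ u : ℂ, fderiv ℝ ((v ∘ e'.symm) ∘ (e' ∘ e.symm)) (e p) u =
        fderiv ℝ (v ∘ e'.symm) (e' p) (deriv (e' ∘ e.symm) (e p) * u) := by
      intro u
      rw [h3.fderiv]
      simp [mul_comm]
    rw [dz, wirt_congr _ h1, wirt, h4, h4]
    set c := deriv (e' ∘ e.symm) (e p)
    rw [fderiv_apply_eq, fderiv_apply_eq]
    simp only [map_mul, map_one, conj_I, mul_one]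
    match_scalars
    · linear_combination (-(1 / 2 : ℂ) * c) * I_sq
    · linear_combination ((1 / 2 : ℂ) * starRingEnd ℂ c) * I_sq

namespace IsConformalHarmonicImmersion

variable {φ F : S → E7} {e : OpenPartialHomeomorph S ℂ}

lemma smooth_chart (hφ : IsConformalHarmonicImmersion φ) (he : e ∈ atlas ℂ S) :
    ContDiffOn ℝ ∞ (φ ∘ e.symm) e.target := by
  have := contDiffOn_comp_symm he hφ.smooth.contMDiffOn (U := Set.univ)
  simpa using this

lemma isMinimalChart (hφ : IsConformalHarmonicImmersion φ) (he : e ∈ atlas ℂ S) :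
    IsMinimalChart e.target (fun z => cpx (φ (e.symm z))) := by
  refine isMinimalChart_of_conformal_harmonic e.open_target (hφ.smooth_chart he) (fun z _ => ?_)
    (fun z hz => hφ.conformal e he z hz) (fun z hz u hu => hφ.harmonic e he z hz u hu)
  have := hφ.mem_sphere (e.symm z)
  rw [mem_sphere_zero_iff_norm] at this
  simp [this]

lemma isAssociatedChart (hφ : IsConformalHarmonicImmersion φ) (hF : IsAssociatedSurface φ F)
    (he : e ∈ atlas ℂ S) : IsAssociatedChart e.target (φ ∘ e.symm) (F ∘ e.symm) where
  minimal := hφ.isMinimalChart he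
  smooth_left := hφ.smooth_chart he
  smooth := by
    have := contDiffOn_comp_symm he hF.smooth.contMDiffOn (U := Set.univ)
    simpa using this
  deriv_eq := fun z hz v => hF.deriv_eq e he z hz v

/-- Unique continuation: a conformal harmonic immersion of a connected surface which is
orthogonal to a vector on a non-empty open set is orthogonal to it everywhere. -/
lemma inner_eq_zero_of_eventually [ConnectedSpace S] (hφ : IsConformalHarmonicImmersion φ) {u : E7}
    {p : S} (hp : ∀ᶠ q in nhds p, ⟪u, φ q⟫ = 0) (q : S) : ⟪u, φ q⟫ = 0 := by
  set A : Set S := {p | ∀ᶠ q in nhds p, ⟪u, φ q⟫ = 0} with hA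
  have hopen : IsOpen A := by
    rw [isOpen_iff_mem_nhds]
    intro a ha
    exact ha.eventually_nhds
  have hclosed : IsClosed A := by
    rw [isClosed_iff_frequently]
    intro a ha
    set e := chartAt ℂ a
    have hae : a ∈ e.source := mem_chart_source ℂ a
    have hmap := e.map_nhds_eq hae
    have H := hφ.isMinimalChart (chart_mem_atlas ℂ a)
    have h1 : ∃ᶠ z in nhds (e a), ∀ᶠ w in nhds z, dotC (cpx u) (cpx (φ (e.symm w))) = 0 := by
      rw [← hmap, Filter.frequently_map]
      refine (ha.and_eventually (e.open_source.mem_nhds hae)).mono ?_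
      rintro b ⟨hb, hbe⟩
      rw [← e.map_nhds_eq hbe, Filter.eventually_map]
      filter_upwards [hb, e.open_source.mem_nhds hbe] with c hc hce
      rw [e.left_inv hce, dotC_cpx, hc, ofReal_zero]
    have h2 := H.eventually_dotC_eq_zero (e.map_source hae) (conjC_cpx u) h1
    rw [← hmap, Filter.eventually_map] at h2
    change ∀ᶠ q in nhds a, ⟪u, φ q⟫ = 0
    filter_upwards [h2, e.open_source.mem_nhds hae] with c hc hce
    rw [e.left_inv hce, dotC_cpx] at hc
    exact ofReal_eq_zero.1 hc
  have huniv := IsClopen.eq_univ ⟨hclosed, hopen⟩ ⟨p, hp⟩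
  have hq : q ∈ A := by rw [huniv]; trivial
  exact hq.self_of_nhds

end IsConformalHarmonicImmersion

end Surfaces

end SixSphere

namespace SixSphere

open Complex

/-! ### Elements of the harmonic sequence which are locally line bundles -/

/-- The component of `∂g/∂z` orthogonal to `g`. -/
noncomputable def lineStep (g : ℂ → C7) (z : ℂ) : C7 :=
  dz g z - (dotC (conjC (g z)) (dz g z) / dotC (conjC (g z)) (g z)) • g z

lemma contDiffOn_lineStep {g : ℂ → C7} {V : Set ℂ} (hV : IsOpen V) (hg : ContDiffOn ℝ ∞ g V)
    (h0 : ∀ z ∈ V, g z ≠ 0) : ContDiffOn ℝ ∞ (lineStep g) V := by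
  have h1 := contDiffOn_wirt hV (-I) hg
  have h2 := contDiffOn_conjC hg
  exact h1.sub (contDiffOn_smulC (contDiffOn_div (contDiffOn_dotC h2 h1) (contDiffOn_dotC h2 hg)
    fun z hz h => h0 z hz (dotC_conjC_self_eq_zero.1 h)) hg)

lemma dotC_conjC_lineStep {g : ℂ → C7} {z : ℂ} (h0 : g z ≠ 0) :
    dotC (conjC (g z)) (lineStep g z) = 0 := by
  have : dotC (conjC (g z)) (g z) ≠ 0 := fun h => h0 (dotC_conjC_self_eq_zero.1 h)
  rw [lineStep, dotC_sub_right, dotC_smul_right, div_mul_cancel₀ _ this, sub_self]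

lemma starProjection_orthogonal_lineStep {g : ℂ → C7} {z : ℂ} (h0 : g z ≠ 0) (c d : ℂ)
    {L : Submodule ℂ C7} (hL : L = Submodule.span ℂ {g z}) :
    Lᗮ.starProjection (c • dz g z + d • g z) = c • lineStep g z := by
  subst hL
  have h1 : (Submodule.span ℂ {g z})ᗮ.starProjection (g z) = 0 := by
    rw [Submodule.starProjection_apply_eq_zero_iff, Submodule.orthogonal_orthogonal]
    exact Submodule.mem_span_singleton_self _
  have h2 : (Submodule.span ℂ {g z})ᗮ.starProjection (lineStep g z) = lineStep g z := by
    rw [Submodule.starProjection_eq_self_iff, Submodule.mem_orthogonal_singleton_iff_inner_right,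
      inner_eq_dotC, dotC_conjC_lineStep h0]
  have h3 : c • dz g z + d • g z = c • lineStep g z +
      (c * (dotC (conjC (g z)) (dz g z) / dotC (conjC (g z)) (g z)) + d) • g z := by
    rw [lineStep]; module
  rw [h3, map_add, map_smul, map_smul, h1, h2, smul_zero, add_zero]

section Surfaces

variable {S : Type*} [TopologicalSpace S] [ChartedSpace ℂ S]

/-- A closed condition `h = 0` satisfied by the images of `A'` near `p` passes to their limits,
hence to the span of the limits. This handles the extended fibres without knowing that the zeros of
`A'` are isolated. -/
lemma delBundle_le {ψ : S → Submodule ℂ C7} {p : S} {E : Type*} [NormedAddCommGroup E]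
    (N : Submodule ℂ C7) (h : S × C7 → E) (hc : ∀ w, ContinuousAt h (p, w))
    (h0 : ∀ᶠ q in nhds p, ∀ w ∈ imageSecondFundamental ψ q, h (q, w) = 0)
    (hN : ∀ w, h (p, w) = 0 → w ∈ N) : delBundle ψ p ≤ N := by
  rw [delBundle, Submodule.span_le]
  intro w hw
  apply hN
  rw [Set.mem_setOf_eq, mem_closure_iff_frequently] at hw
  by_contra hne
  refine hw ?_
  have h1 : ∀ᶠ x in nhds (p, w), ∀ u ∈ imageSecondFundamental ψ x.1, h (x.1, u) = 0 :=
    (continuous_fst.tendsto (p, w)).eventually h0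
  filter_upwards [h1, (hc w).eventually_ne hne] with x hx hx' hmem
  exact hx' (hx x.2 hmem)

lemma imageSecondFundamental_subset_delBundle (ψ : S → Submodule ℂ C7) (p : S) :
    imageSecondFundamental ψ p ⊆ delBundle ψ p := fun _ hw =>
  Submodule.subset_span (subset_closure hw)

lemma delBundle_eq_bot {ψ : S → Submodule ℂ C7} {p : S}
    (h0 : ∀ᶠ q in nhds p, ∀ w ∈ imageSecondFundamental ψ q, w = 0) : delBundle ψ p = ⊥ :=
  le_bot_iff.1 (delBundle_le ⊥ Prod.snd (fun _ => continuous_snd.continuousAt) h0 fun w hw => by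
    simpa using hw)

lemma dotC_eq_zero_of_mem_delBundle {ψ : S → Submodule ℂ C7} {p : S} {f : S → C7}
    (hf : ContinuousAt f p)
    (h0 : ∀ᶠ q in nhds p, ∀ w ∈ imageSecondFundamental ψ q, dotC (f q) w = 0) {w : C7}
    (hw : w ∈ delBundle ψ p) : dotC (f p) w = 0 := by
  refine delBundle_le (LinearMap.ker (dotL (f p)).toLinearMap) (fun x => dotL (f x.1) x.2) (fun w => ?_) h0
    (fun w hw => hw) hw
  have hf' : ContinuousAt (fun x : S × C7 => f x.1) (p, w) :=
    ContinuousAt.comp (f := Prod.fst) (x := (p, w)) hf continuous_fst.continuousAt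
  exact (dotL.continuous.continuousAt.comp hf').clm_apply continuous_snd.continuousAt

variable [IsManifold 𝓘(ℂ, ℂ) ω S]

/-- The section `v` of a bundle read in a chart `e` near `q`, and its contribution to the image of
the second fundamental form. -/
lemma exists_of_mem_imageSecondFundamental {ψ : S → Submodule ℂ C7}
    {e : OpenPartialHomeomorph S ℂ} (he : e ∈ atlas ℂ S) {q : S} (hq : q ∈ e.source) {w : C7}
    (hw : w ∈ imageSecondFundamental ψ q) :
    ∃ (f : ℂ → C7) (k : ℂ) (V : Set ℂ), IsOpen V ∧ V ⊆ e.target ∧ e q ∈ V ∧ ContDiffOn ℝ ∞ f V ∧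
      (∀ z ∈ V, f z ∈ ψ (e.symm z)) ∧ w = (ψ q)ᗮ.starProjection (k • dz f (e q)) := by
  obtain ⟨U, v, hU, hqU, hv, hvψ, rfl⟩ := hw
  obtain ⟨k, -, hk⟩ := exists_dz_coordChange (chart_mem_atlas ℂ q) he (mem_chart_source ℂ q) hq
  have hV : IsOpen (e.target ∩ e.symm ⁻¹' U) := e.symm.isOpen_inter_preimage hU
  have hqV : e q ∈ e.target ∩ e.symm ⁻¹' U := ⟨e.map_source hq, by simpa [e.left_inv hq]⟩
  have hs := contDiffOn_comp_symm he hv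
  refine ⟨v ∘ e.symm, k, _, hV, Set.inter_subset_left, hqV, hs, fun z hz => hvψ _ hz.2, ?_⟩
  rw [delZ_eq_dz, hk v (differentiableAt_of_contDiffOn hs hV hqV)]

lemma imageSecondFundamental_of_bot {ψ : S → Submodule ℂ C7} {q : S}
    (h : ∀ᶠ p in nhds q, ψ p = ⊥) {w : C7} (hw : w ∈ imageSecondFundamental ψ q) : w = 0 := by
  obtain ⟨f, k, V, hV, hVe, hqV, -, hf, rfl⟩ :=
    exists_of_mem_imageSecondFundamental (chart_mem_atlas ℂ q) (mem_chart_source ℂ q) hw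
  set e := chartAt ℂ q
  have hq : q ∈ e.source := mem_chart_source ℂ q
  have h1 : ∀ᶠ z in nhds (e q), ψ (e.symm z) = ⊥ := by
    refine (e.continuousAt_symm (e.map_source hq)).eventually (p := fun p => ψ p = ⊥) ?_
    rwa [e.left_inv hq]
  rw [dz, wirt_eq_zero_of_eventually_const (-I) 0, smul_zero, map_zero]
  filter_upwards [h1, hV.mem_nhds hqV] with z hz hzV
  have := hf z hzV
  rwa [hz, Submodule.mem_bot] at this

section Line

variable {ψ : S → Submodule ℂ C7} {e : OpenPartialHomeomorph S ℂ} {V : Set ℂ} {g : ℂ → C7} {q : S}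

lemma imageSecondFundamental_eq (he : e ∈ atlas ℂ S) (hV : IsOpen V) (hVe : V ⊆ e.target)
    (hg : ContDiffOn ℝ ∞ g V) (h0 : ∀ z ∈ V, g z ≠ 0)
    (hψ : ∀ z ∈ V, ψ (e.symm z) = Submodule.span ℂ {g z}) (hq : q ∈ e.source) (hqV : e q ∈ V) :
    imageSecondFundamental ψ q = Submodule.span ℂ {lineStep g (e q)} := by
  have hψq : ψ q = Submodule.span ℂ {g (e q)} := by
    rw [← hψ _ hqV, e.left_inv hq]
  apply Set.Subset.antisymm
  · intro w hw
    obtain ⟨f, k, U, hU, -, hqU, hf, hfψ, rfl⟩ := exists_of_mem_imageSecondFundamental he hq hw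
    -- Taking the coefficient of `f` along `g` as a Hermitian quotient makes its smoothness evident.
    -- The term with its derivative is then killed by the projection.
    set c : ℂ → ℂ := fun z => dotC (conjC (g z)) (f z) / dotC (conjC (g z)) (g z) with hc
    have hUV : IsOpen (U ∩ V) := hU.inter hV
    have hgd : ∀ z ∈ V, dotC (conjC (g z)) (g z) ≠ 0 := fun z hz h =>
      h0 z hz (dotC_conjC_self_eq_zero.1 h)
    have hcs : ContDiffOn ℝ ∞ c (U ∩ V) :=
      contDiffOn_div (contDiffOn_dotC (contDiffOn_conjC (hg.mono Set.inter_subset_right))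
        (hf.mono Set.inter_subset_left)) (contDiffOn_dotC
        (contDiffOn_conjC (hg.mono Set.inter_subset_right)) (hg.mono Set.inter_subset_right))
        fun z hz => hgd z hz.2
    have h1 : dz f (e q) = dz (fun z => c z • g z) (e q) := by
      refine wirt_congr _ (Filter.eventually_of_mem (hUV.mem_nhds ⟨hqU, hqV⟩) fun z hz => ?_)
      have h2 := hfψ z hz.1
      rw [hψ z hz.2, Submodule.mem_span_singleton] at h2
      obtain ⟨a, ha⟩ := h2
      simp only [hc, ← ha, dotC_smul_right]
      rw [mul_div_assoc, div_self (hgd z hz.2), mul_one]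
    have h3 : dz (fun z => c z • g z) (e q) = _ :=
      wirt_smul (-I) (differentiableAt_of_contDiffOn hcs hUV ⟨hqU, hqV⟩)
        (differentiableAt_of_contDiffOn hg hV hqV)
    rw [h1, h3, add_comm, smul_add, smul_smul, smul_smul,
      show wirt (-I) g (e q) = dz g (e q) from rfl,
      starProjection_orthogonal_lineStep (h0 _ hqV) _ _ hψq]
    exact Submodule.smul_mem _ _ (Submodule.mem_span_singleton_self _)
  · intro w hw
    obtain ⟨a, rfl⟩ := Submodule.mem_span_singleton.1 hw
    obtain ⟨k, hk0, hk⟩ := exists_dz_coordChange (chart_mem_atlas ℂ q) he (mem_chart_source ℂ q) hq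
    have hag : ContDiffOn ℝ ∞ (fun z => (a / k) • g z) V :=
      contDiffOn_smulC contDiffOn_const hg
    have hev : ((fun z => (a / k) • g z) ∘ e) ∘ e.symm =ᶠ[nhds (e q)] fun z => (a / k) • g z :=
      Filter.eventually_of_mem (hV.mem_nhds hqV) fun z hz => by simp [e.right_inv (hVe hz)]
    -- The image of `A'` is defined with the preferred chart at `q`; dividing by `k` compensates the
    -- change of coordinate to `e`.
    refine ⟨e.source ∩ e ⁻¹' V, (fun z => (a / k) • g z) ∘ e, e.isOpen_inter_preimage hV, ⟨hq, hqV⟩,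
      contMDiffOn_comp_chart he hag, ?_, ?_⟩
    · rintro p ⟨hp, hpV⟩
      have : ψ p = Submodule.span ℂ {g (e p)} := by rw [← hψ _ hpV, e.left_inv hp]
      rw [this]
      exact Submodule.smul_mem _ _ (Submodule.mem_span_singleton_self _)
    · rw [delZ_eq_dz, hk _ ((differentiableAt_of_contDiffOn hag hV hqV).congr_of_eventuallyEq hev),
        dz, wirt_congr _ hev]
      have h3 := wirt_smul (c := fun _ => a / k) (-I) (differentiableAt_const _)
        (differentiableAt_of_contDiffOn hg hV hqV)
      rw [h3, wirt_const, zero_smul, zero_add, smul_smul, mul_div_cancel₀ _ hk0]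
      have h4 := starProjection_orthogonal_lineStep (h0 _ hqV) a 0 hψq
      rw [zero_smul, add_zero] at h4
      exact h4.symm

lemma delBundle_eq (he : e ∈ atlas ℂ S) (hV : IsOpen V) (hVe : V ⊆ e.target)
    (hg : ContDiffOn ℝ ∞ g V) (h0 : ∀ z ∈ V, g z ≠ 0)
    (hψ : ∀ z ∈ V, ψ (e.symm z) = Submodule.span ℂ {g z}) (hq : q ∈ e.source) (hqV : e q ∈ V)
    (hne : lineStep g (e q) ≠ 0) : delBundle ψ q = Submodule.span ℂ {lineStep g (e q)} := by
  apply le_antisymm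
  · have hgd : dotC (conjC (lineStep g (e q))) (lineStep g (e q)) ≠ 0 := fun h =>
      hne (dotC_conjC_self_eq_zero.1 h)
    have hcont : ContinuousAt (fun p => lineStep g (e p)) q :=
      ContinuousAt.comp (f := e) (g := lineStep g)
        ((contDiffOn_lineStep hV hg h0).continuousOn.continuousAt (hV.mem_nhds hqV))
        (e.continuousAt hq)
    -- For `ℓ = lineStep g ≠ 0`, membership of `w` in the line of `ℓ` is the continuous equation
    -- `⟨ℓ̄, ℓ⟩ w = ⟨ℓ̄, w⟩ ℓ`, with denominators cleared.
    refine delBundle_le _ (fun x => dotL (conjL (lineStep g (e x.1))) (lineStep g (e x.1)) • x.2 -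
      dotL (conjL (lineStep g (e x.1))) x.2 • lineStep g (e x.1)) (fun w => ?_) ?_ fun w hw => ?_
    · have hf : ContinuousAt (fun x : S × C7 => lineStep g (e x.1)) (q, w) :=
        ContinuousAt.comp (f := Prod.fst) (x := (q, w)) hcont continuous_fst.continuousAt
      have hf' : ContinuousAt (fun x : S × C7 => dotL (conjL (lineStep g (e x.1)))) (q, w) :=
        (dotL.continuous.comp conjL.continuous).continuousAt.comp hf
      exact ((hf'.clm_apply hf).smul continuous_snd.continuousAt).sub
        ((hf'.clm_apply continuous_snd.continuousAt).smul hf)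
    · filter_upwards [(e.isOpen_inter_preimage hV).mem_nhds ⟨hq, hqV⟩] with p hp w hw
      rw [imageSecondFundamental_eq he hV hVe hg h0 hψ hp.1 hp.2] at hw
      obtain ⟨a, rfl⟩ := Submodule.mem_span_singleton.1 hw
      simp only [map_smul, smul_smul, smul_eq_mul]
      rw [mul_comm, sub_self]
    · rw [Submodule.mem_span_singleton]
      refine ⟨dotC (conjC (lineStep g (e q))) w / dotC (conjC (lineStep g (e q))) (lineStep g (e q)),
        ?_⟩
      simp only [dotL_apply, conjL_apply] at hw
      rw [div_eq_inv_mul, mul_smul, ← sub_eq_zero.1 hw, smul_smul, inv_mul_cancel₀ hgd, one_smul]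
  · rw [Submodule.span_singleton_le_iff_mem]
    apply imageSecondFundamental_subset_delBundle
    rw [imageSecondFundamental_eq he hV hVe hg h0 hψ hq hqV]
    exact Submodule.mem_span_singleton_self _

end Line

/-! ### The harmonic sequence of a conformal harmonic immersion -/

namespace IsConformalHarmonicImmersion

variable {φ : S → E7} {e : OpenPartialHomeomorph S ℂ} {q : S}

lemma harmonicSequence_one (hφ : IsConformalHarmonicImmersion φ) (he : e ∈ atlas ℂ S)
    (hq : q ∈ e.source) :
    harmonicSequence φ 1 q = Submodule.span ℂ {dz (fun z => cpx (φ (e.symm z))) (e q)} := by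
  have H := hφ.isMinimalChart he
  have hqt := e.map_source hq
  have h1 : lineStep (fun z => cpx (φ (e.symm z))) (e q) =
      dz (fun z => cpx (φ (e.symm z))) (e q) := by
    rw [lineStep, H.conj_eq _ hqt, (H.frame hqt).pa]; simp
  rw [← h1]
  refine delBundle_eq he e.open_target subset_rfl H.smooth (fun z hz h => ?_) (fun z hz => rfl) hq hqt
    (fun h => ?_)
  · have := H.sphere z hz
    rw [show cpx (φ (e.symm z)) = 0 from h] at this; simp at this
  · rw [h1] at h
    apply (H.frame hqt).ne
    rw [← (H.frame hqt).ab, h, dotC_zero_left]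

lemma dz_ne_zero (hφ : IsConformalHarmonicImmersion φ) (he : e ∈ atlas ℂ S) {z : ℂ}
    (hz : z ∈ e.target) : dz (fun z => cpx (φ (e.symm z))) z ≠ 0 := by
  intro h
  have F := (hφ.isMinimalChart he).frame hz
  apply F.ne
  rw [← F.ab, h, dotC_zero_left]

lemma lineStep_dz (hφ : IsConformalHarmonicImmersion φ) (he : e ∈ atlas ℂ S) {z : ℂ}
    (hz : z ∈ e.target) : lineStep (dz (fun z => cpx (φ (e.symm z)))) z =
      secondSection (fun z => cpx (φ (e.symm z))) z := by
  have H := hφ.isMinimalChart he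
  rw [lineStep, H.conj_dz hz, ← H.dz_confFactor hz, (H.frame hz).ba, secondSection]

lemma harmonicSequence_one_symm (hφ : IsConformalHarmonicImmersion φ) (he : e ∈ atlas ℂ S) {z : ℂ}
    (hz : z ∈ e.target) : harmonicSequence φ 1 (e.symm z) =
      Submodule.span ℂ {dz (fun z => cpx (φ (e.symm z))) z} := by
  rw [hφ.harmonicSequence_one he (e.map_target hz), e.right_inv hz]

lemma image_one (hφ : IsConformalHarmonicImmersion φ) (he : e ∈ atlas ℂ S) (hq : q ∈ e.source) :
    imageSecondFundamental (harmonicSequence φ 1) q =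
      Submodule.span ℂ {secondSection (fun z => cpx (φ (e.symm z))) (e q)} := by
  have H := hφ.isMinimalChart he
  have hqt := e.map_source hq
  rw [← hφ.lineStep_dz he hqt]
  exact imageSecondFundamental_eq he e.open_target subset_rfl (H.smooth_wirt _)
    (fun z hz => hφ.dz_ne_zero he hz) (fun z hz => hφ.harmonicSequence_one_symm he hz) hq hqt

lemma harmonicSequence_two (hφ : IsConformalHarmonicImmersion φ) (he : e ∈ atlas ℂ S)
    (hq : q ∈ e.source) (h : secondSection (fun z => cpx (φ (e.symm z))) (e q) ≠ 0) :
    harmonicSequence φ 2 q =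
      Submodule.span ℂ {secondSection (fun z => cpx (φ (e.symm z))) (e q)} := by
  have H := hφ.isMinimalChart he
  have hqt := e.map_source hq
  rw [← hφ.lineStep_dz he hqt] at h ⊢
  exact delBundle_eq he e.open_target subset_rfl (H.smooth_wirt _)
    (fun z hz => hφ.dz_ne_zero he hz) (fun z hz => hφ.harmonicSequence_one_symm he hz) hq hqt h

lemma continuousAt_chart {f : ℂ → C7} (hf : ContDiffOn ℝ ∞ f e.target) (hq : q ∈ e.source) :
    ContinuousAt (fun p => f (e p)) q :=
  ContinuousAt.comp (f := e) (g := f)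
    (hf.continuousOn.continuousAt (e.open_target.mem_nhds (e.map_source hq))) (e.continuousAt hq)

lemma dot_harmonicSequence_two (hφ : IsConformalHarmonicImmersion φ) (he : e ∈ atlas ℂ S)
    (hq : q ∈ e.source) {w : C7} (hw : w ∈ harmonicSequence φ 2 q) :
    dotC (cpx (φ q)) w = 0 ∧ dotC (dz (fun z => cpx (φ (e.symm z))) (e q)) w = 0 := by
  have H := hφ.isMinimalChart he
  have hev : ∀ᶠ p in nhds q, p ∈ e.source := e.open_source.mem_nhds hq
  constructor
  · have h1 := dotC_eq_zero_of_mem_delBundle (continuousAt_chart H.smooth hq) (hev.mono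
      fun p hp u hu => ?_) hw
    · simpa [e.left_inv hq] using h1
    · rw [hφ.image_one he hp] at hu
      obtain ⟨a, rfl⟩ := Submodule.mem_span_singleton.1 hu
      rw [dotC_smul_right, H.dot_secondSection (e.map_source hp), mul_zero]
  · refine dotC_eq_zero_of_mem_delBundle (continuousAt_chart (H.smooth_wirt (-I)) hq) (hev.mono
      fun p hp u hu => ?_) hw
    rw [hφ.image_one he hp] at hu
    obtain ⟨a, rfl⟩ := Submodule.mem_span_singleton.1 hu
    rw [dotC_smul_right, H.dz_dot_secondSection (e.map_source hp), mul_zero]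

/-- For a section `f` of `φ₂`, differentiating `⟨P, f⟩ = 0` gives `⟨P, f_z⟩ = -⟨P_z, f⟩ = 0`.
Removing the part of `f_z` in `φ₂`, also orthogonal to `P`, changes nothing. No local frame of `φ₂`
is needed, so zeros of `f₂` cause no trouble. -/
lemma dot_harmonicSequence_three (hφ : IsConformalHarmonicImmersion φ) {w : C7}
    (hw : w ∈ harmonicSequence φ 3 q) : dotC (cpx (φ q)) w = 0 := by
  set e := chartAt ℂ q
  have he : e ∈ atlas ℂ S := chart_mem_atlas ℂ q
  have hq : q ∈ e.source := mem_chart_source ℂ q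
  have H := hφ.isMinimalChart he
  have hev : ∀ᶠ p in nhds q, p ∈ e.source := e.open_source.mem_nhds hq
  have h1 := dotC_eq_zero_of_mem_delBundle (continuousAt_chart H.smooth hq) (hev.mono
      fun p hp u hu => ?_) hw
  · simpa [e.left_inv hq] using h1
  · obtain ⟨f, k, V, hV, hVe, hpV, hf, hfψ, rfl⟩ := exists_of_mem_imageSecondFundamental he hp hu
    have hpt := hVe hpV
    have h2 := wirt_dotC (-I) (H.diff hpt) (differentiableAt_of_contDiffOn hf hV hpV)
    have h3 : ∀ z ∈ V, dotC (cpx (φ (e.symm z))) (f z) = 0 := fun z hz =>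
      (hφ.dot_harmonicSequence_two he (e.map_target (hVe hz)) (hfψ z hz)).1
    have h4 := (hφ.dot_harmonicSequence_two he (e.map_target hpt) (hfψ _ hpV)).2
    rw [e.right_inv hpt] at h4
    rw [wirt_eq_zero_of_eventually_const (-I) 0 (Filter.eventually_of_mem (hV.mem_nhds hpV) h3),
      show dotC (wirt (-I) (fun z => cpx (φ (e.symm z))) (e p)) (f (e p)) = 0 from h4, zero_add] at h2
    have h5 := Submodule.starProjection_add_starProjection_orthogonal
      (K := harmonicSequence φ 2 p) (k • dz f (e p))
    have h6 : dotC (cpx (φ p)) ((harmonicSequence φ 2 p).starProjection (k • dz f (e p))) = 0 :=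
      (hφ.dot_harmonicSequence_two he hp (Submodule.starProjection_apply_mem _ _)).1
    have h7 := congrArg (dotC (cpx (φ p))) h5
    rw [e.left_inv hp] at h2 ⊢
    rwa [dotC_add_right, h6, zero_add, dotC_smul_right, ← h2, mul_zero] at h7

lemma isOrtho_of_dotC {φ : S → E7} {L : Submodule ℂ C7} (h : ∀ w ∈ L, dotC (cpx (φ q)) w = 0) :
    harmonicSequence φ 0 q ⟂ L := by
  change Submodule.span ℂ {cpx (φ q)} ⟂ L
  rw [Submodule.isOrtho_iff_inner_eq]
  intro u hu w hw
  obtain ⟨a, rfl⟩ := Submodule.mem_span_singleton.1 hu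
  rw [inner_smul_left, inner_eq_dotC, conjC_cpx, h w hw, mul_zero]

/-- If `⟨f₂, f₂⟩` does not vanish identically then the isotropy order is `3`. -/
lemma hasIsotropyOrder_three (hφ : IsConformalHarmonicImmersion φ) (he : e ∈ atlas ℂ S) {z : ℂ}
    (hz : z ∈ e.target) (h : dotC (secondSection (fun z => cpx (φ (e.symm z))) z)
      (secondSection (fun z => cpx (φ (e.symm z))) z) ≠ 0) : HasIsotropyOrder φ 3 := by
  have H := hφ.isMinimalChart he
  refine ⟨by norm_num, fun i hi hi3 p => isOrtho_of_dotC fun w hw => ?_, fun hall => ?_⟩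
  · have hp := mem_chart_source ℂ p
    obtain rfl | rfl | rfl : i = 1 ∨ i = 2 ∨ i = 3 := by omega
    · rw [hφ.harmonicSequence_one (chart_mem_atlas ℂ p) hp] at hw
      obtain ⟨a, rfl⟩ := Submodule.mem_span_singleton.1 hw
      have h1 := ((hφ.isMinimalChart (chart_mem_atlas ℂ p)).frame
        ((chartAt ℂ p).map_source hp)).pa
      rw [(chartAt ℂ p).left_inv hp] at h1
      rw [dotC_smul_right, h1, mul_zero]
    · exact (hφ.dot_harmonicSequence_two (chart_mem_atlas ℂ p) hp hw).1
    · exact hφ.dot_harmonicSequence_three hw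
  · set s := secondSection (fun z => cpx (φ (e.symm z))) with hs
    set V := e.target ∩ (fun z => dotC (s z) (s z)) ⁻¹' {0}ᶜ with hVdef
    have hss : ContDiffOn ℝ ∞ s e.target := H.smooth_secondSection
    have hV : IsOpen V := (contDiffOn_dotC hss hss).continuousOn.isOpen_inter_preimage
      e.open_target isOpen_compl_singleton
    have hzV : z ∈ V := ⟨hz, h⟩
    have hVe : V ⊆ e.target := Set.inter_subset_left
    have hs0 : ∀ w ∈ V, s w ≠ 0 := fun w hw h0 => hw.2 (by simp [h0])
    have hsV : ContDiffOn ℝ ∞ s V := hss.mono hVe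
    have hψ2 : ∀ w ∈ V, harmonicSequence φ 2 (e.symm w) = Submodule.span ℂ {s w} := by
      intro w hw
      have hw' := e.map_target (hVe hw)
      have hr := e.right_inv (hVe hw)
      have := hφ.harmonicSequence_two he hw' (by rw [hr]; exact hs0 w hw)
      rwa [hr] at this
    have hss0 : ∀ w ∈ e.target, dotC (cpx (φ (e.symm w))) (s w) = 0 := fun w hw =>
      H.dot_secondSection hw
    have hds0 : ∀ w ∈ e.target, dotC (dz (fun z => cpx (φ (e.symm z))) w) (s w) = 0 := fun w hw =>
      H.dz_dot_secondSection hw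
    have hp3 : ∀ w ∈ V, dotC (cpx (φ (e.symm w))) (lineStep s w) = 0 := by
      intro w hw
      have hwt := hVe hw
      have h1 := H.dotC_deriv_eq_zero hwt (-I) (H.diff hwt) (H.diff_secondSection hwt) hss0
      rw [show dotC (wirt (-I) (fun z => cpx (φ (e.symm z))) w) (s w) = 0 from hds0 w hwt,
        zero_add] at h1
      rw [lineStep, dotC_sub_right, dotC_smul_right, hss0 w hwt, mul_zero, sub_zero]
      exact h1
    -- Shifting a derivative across the product twice, `⟨P, f₄⟩ = -⟨P_z, f₃⟩ = ⟨f₂, f₂⟩`, which is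
    -- nonzero at the chosen point.
    have ha3 : ∀ w ∈ V, dotC (dz (fun z => cpx (φ (e.symm z))) w) (lineStep s w) =
        -dotC (s w) (s w) := by
      intro w hw
      have hwt := hVe hw
      have h1 := H.dotC_deriv_eq_zero hwt (-I) (H.diff_wirt hwt (-I)) (H.diff_secondSection hwt) hds0
      rw [show wirt (-I) (wirt (-I) fun z => cpx (φ (e.symm z))) w = _ from
        IsMinimalChart.dz_dz_eq w, dotC_add_left, dotC_smul_left,
        H.dz_dot_secondSection hwt, mul_zero, add_zero] at h1
      rw [lineStep, dotC_sub_right, dotC_smul_right, hds0 w hwt, mul_zero, sub_zero,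
        eq_neg_iff_add_eq_zero, add_comm]
      exact h1
    have h30 : ∀ w ∈ V, lineStep s w ≠ 0 := by
      intro w hw h0
      have := ha3 w hw
      rw [h0, dotC_zero_right, eq_comm, neg_eq_zero] at this
      exact hw.2 this
    have hs3 := contDiffOn_lineStep hV hsV hs0
    have hψ3 : ∀ w ∈ V, harmonicSequence φ 3 (e.symm w) = Submodule.span ℂ {lineStep s w} := by
      intro w hw
      have hw' := e.map_target (hVe hw)
      have hr := e.right_inv (hVe hw)
      have := delBundle_eq (q := e.symm w) he hV hVe hsV hs0 hψ2 hw' (by rwa [hr])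
        (by rw [hr]; exact h30 w hw)
      rwa [hr] at this
    have hmem : lineStep (lineStep s) z ∈ harmonicSequence φ 4 (e.symm z) := by
      apply imageSecondFundamental_subset_delBundle
      have hr := e.right_inv hz
      rw [imageSecondFundamental_eq he hV hVe hs3 h30 hψ3 (e.map_target hz) (by rwa [hr]), hr]
      exact Submodule.mem_span_singleton_self _
    have hort := Submodule.isOrtho_iff_inner_eq.1 (hall (e.symm z)) (cpx (φ (e.symm z)))
      (Submodule.mem_span_singleton_self _) _ hmem
    have h1 := wirt_dotC (-I) (H.diff hz) (differentiableAt_of_contDiffOn hs3 hV hzV)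
    rw [wirt_eq_zero_of_eventually_const (-I) 0 (Filter.eventually_of_mem (hV.mem_nhds hzV) hp3),
      show dotC (wirt (-I) (fun z => cpx (φ (e.symm z))) z) (lineStep s z) = _ from ha3 z hzV] at h1
    rw [inner_eq_dotC, conjC_cpx, lineStep, dotC_sub_right, dotC_smul_right, hp3 z hzV, mul_zero,
      sub_zero] at hort
    rw [show dotC (cpx (φ (e.symm z))) (wirt (-I) (lineStep s) z) = 0 from hort, add_zero, eq_comm,
      neg_eq_zero] at h1
    exact h h1

/-- If `f₂` vanishes identically then the harmonic sequence ends at `φ₂`. -/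
lemma exists_secondSection_ne_zero (hφ : IsConformalHarmonicImmersion φ)
    (h : HasIsotropyOrder φ 3) : ∃ e ∈ atlas ℂ S, ∃ z ∈ e.target,
      secondSection (fun z => cpx (φ (e.symm z))) z ≠ 0 := by
  by_contra! hall
  have h2 : ∀ p, harmonicSequence φ 2 p = ⊥ := fun p =>
    delBundle_eq_bot (Filter.Eventually.of_forall fun q w hw => by
      have hq := mem_chart_source ℂ q
      rw [hφ.image_one (chart_mem_atlas ℂ q) hq,
        hall _ (chart_mem_atlas ℂ q) _ ((chartAt ℂ q).map_source hq)] at hw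
      simpa using hw)
  have step : ∀ {ψ : S → Submodule ℂ C7}, (∀ p, ψ p = ⊥) → ∀ p, delBundle ψ p = ⊥ :=
    fun hψ p => delBundle_eq_bot (Filter.Eventually.of_forall fun q w hw =>
      imageSecondFundamental_of_bot (Filter.Eventually.of_forall hψ) hw)
  refine h.2.2 fun p => ?_
  have h4 : harmonicSequence φ (3 + 1) p = ⊥ := step (step h2) p
  rw [h4]
  exact Submodule.isOrtho_bot_right

end IsConformalHarmonicImmersion

end Surfaces

end SixSphere

namespace SixSphere

open Complex

/-! ### The four-form -/

/-- The four-form as an alternating map. -/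
noncomputable def fourFormAlt : C7 [⋀^Fin 4]→ₗ[ℂ] ℂ where
  toFun m := fourFormC (m 0) (m 1) (m 2) (m 3)
  map_update_add' := by
    intro inst m i x y
    obtain rfl : inst = instDecidableEqFin 4 := Subsingleton.elim _ _
    fin_cases i <;>
      simp [fourFormC, crossC_add_left, crossC_add_right, dotC_add_left, dotC_add_right] <;> ring
  map_update_smul' := by
    intro inst m i c x
    obtain rfl : inst = instDecidableEqFin 4 := Subsingleton.elim _ _
    fin_cases i <;>
      simp [fourFormC, crossC_smul_left, crossC_smul_right, dotC_smul_left, dotC_smul_right] <;> ring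
  map_eq_zero_of_eq' m i j h hij := by
    have e1 : ∀ x z w : C7, fourFormC x x z w = 0 := fun x z w => by
      linear_combination (1 / 2 : ℂ) * fourFormC_swap₁ x x z w
    have e2 : ∀ x y w : C7, fourFormC x y y w = 0 := fun x y w => by
      linear_combination (1 / 2 : ℂ) * fourFormC_swap₂ x y y w
    have e3 : ∀ x y z : C7, fourFormC x y z z = 0 := fun x y z => by
      linear_combination (1 / 2 : ℂ) * fourFormC_swap₃ x y z z
    have e4 : ∀ x y w : C7, fourFormC x y x w = 0 := fun x y w => by
      rw [fourFormC_swap₂, e1, neg_zero]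
    have e5 : ∀ x y z : C7, fourFormC x y z y = 0 := fun x y z => by
      rw [fourFormC_swap₃, e2, neg_zero]
    have e6 : ∀ x y z : C7, fourFormC x y z x = 0 := fun x y z => by
      rw [fourFormC_swap₃, e4, neg_zero]
    fin_cases i <;> fin_cases j <;> simp at h hij <;> simp [h, e1, e2, e3, e4, e5, e6]

/-- Pulled back to `ℂ⁴` along the generators, an alternating four-form is determined by its value on
one basis. Linear independence of the generators is not required. -/
lemma fourFormC_eq_zero_of_mem_span {f : Fin 4 → C7}
    (h : fourFormC (f 0) (f 1) (f 2) (f 3) = 0) {x y z w : C7}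
    (hx : x ∈ Submodule.span ℂ (Set.range f)) (hy : y ∈ Submodule.span ℂ (Set.range f))
    (hz : z ∈ Submodule.span ℂ (Set.range f)) (hw : w ∈ Submodule.span ℂ (Set.range f)) :
    fourFormC x y z w = 0 := by
  have h0 : fourFormAlt.compLinearMap (Fintype.linearCombination ℂ f) = 0 := by
    refine Module.Basis.ext_alternating (Pi.basisFun ℂ (Fin 4)) fun v hv => ?_
    obtain ⟨σ, rfl⟩ : ∃ σ : Equiv.Perm (Fin 4), v = σ :=
      ⟨Equiv.ofBijective v (Finite.injective_iff_bijective.1 hv), rfl⟩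
    have h1 : (fourFormAlt.compLinearMap (Fintype.linearCombination ℂ f))
        (fun i => Pi.basisFun ℂ (Fin 4) (σ i)) = fourFormAlt (f ∘ σ) := by
      rw [AlternatingMap.compLinearMap_apply]
      congr 1; ext1 i
      simp [Fintype.linearCombination_apply_single]
    rw [h1, AlternatingMap.map_perm]
    have h2 : fourFormAlt f = 0 := h
    simp [h2]
  rw [← Fintype.range_linearCombination] at hx hy hz hw
  obtain ⟨x, rfl⟩ := hx
  obtain ⟨y, rfl⟩ := hy
  obtain ⟨z, rfl⟩ := hz
  obtain ⟨w, rfl⟩ := hw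
  exact DFunLike.congr_fun h0 ![x, y, z, w]

namespace IsConformalFrame

variable {p a b s : C7} {ρ : ℂ}

lemma fourFormC_eq (F : IsConformalFrame p a b ρ) (sa : dotC a s = 0) :
    fourFormC p a b s = -(I * ρ) * dotC (crossC p (meanVec a b ρ)) s := by
  rw [fourFormC_swap₁, fourFormC_swap₂, neg_neg, fourFormC, F.cross_a_b, dotC_smul_left, F.ap, sa,
    ← dotC_crossC_left, crossC_anticomm _ p, dotC_neg_left]
  ring

end IsConformalFrame

/-! ### Cross compatible decompositions -/

lemma cross_lincomb (x y : E7) (a b c d : ℝ) :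
    cross (a • x + b • y) (c • x + d • y) = (a * d - b * c) • cross x y := by
  ext i; fin_cases i <;> simp [cross] <;> ring

lemma finrank_span_pair_of_orthogonal {x y : E7} (hx : x ≠ 0) (hy : y ≠ 0) (hxy : ⟪x, y⟫ = 0) :
    Module.finrank ℝ (Submodule.span ℝ {x, y}) = 2 := by
  have hli : LinearIndependent ℝ ![x, y] := by
    refine linearIndependent_of_ne_zero_of_inner_eq_zero (𝕜 := ℝ) (fun i => ?_) fun i j hij => ?_
    · fin_cases i <;> simpa
    · fin_cases i <;> fin_cases j <;> simp_all [real_inner_comm]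
  have := finrank_span_eq_card hli
  rwa [Matrix.range_cons_cons_empty, Fintype.card_fin] at this

lemma hasCrossCompatibleDecomposition_span {x y u v : E7} (hx : x ≠ 0) (hy : y ≠ 0) (hu : u ≠ 0)
    (hv : v ≠ 0) (hxy : ⟪x, y⟫ = 0) (hxu : ⟪x, u⟫ = 0) (hxv : ⟪x, v⟫ = 0) (hyu : ⟪y, u⟫ = 0)
    (hyv : ⟪y, v⟫ = 0) (huv : ⟪u, v⟫ = 0) (hc : ⟪cross x y, cross u v⟫ = 0) :
    Module.finrank ℝ ↥(Submodule.span ℝ {x, y} ⊔ Submodule.span ℝ {u, v}) = 4 ∧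
      HasCrossCompatibleDecomposition (Submodule.span ℝ {x, y} ⊔ Submodule.span ℝ {u, v}) := by
  have h1 := finrank_span_pair_of_orthogonal hx hy hxy
  have h2 := finrank_span_pair_of_orthogonal hu hv huv
  have hort : Submodule.span ℝ {x, y} ⟂ Submodule.span ℝ {u, v} := by
    rw [Submodule.isOrtho_span]
    rintro a (rfl | rfl) b (rfl | rfl) <;> assumption
  constructor
  · have h := Submodule.finrank_sup_add_finrank_inf_eq (Submodule.span ℝ {x, y})
      (Submodule.span ℝ {u, v})
    rw [hort.disjoint.eq_bot, finrank_bot, h1, h2] at h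
    exact h
  -- Products of two vectors of a plane are determinant multiples of a single vector, so one
  -- orthogonality relation suffices.
  · refine ⟨_, _, h1, h2, hort, rfl, fun a ha b hb c hc' d hd => ?_⟩
    obtain ⟨a₁, a₂, rfl⟩ := Submodule.mem_span_pair.1 ha
    obtain ⟨b₁, b₂, rfl⟩ := Submodule.mem_span_pair.1 hb
    obtain ⟨c₁, c₂, rfl⟩ := Submodule.mem_span_pair.1 hc'
    obtain ⟨d₁, d₂, rfl⟩ := Submodule.mem_span_pair.1 hd
    rw [cross_lincomb, cross_lincomb, inner_smul_left, inner_smul_right, hc]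
    simp

/-- The four-form vanishes on a subspace with a cross compatible decomposition. -/
lemma HasCrossCompatibleDecomposition.exists_family {W : Submodule ℝ E7}
    (hW : HasCrossCompatibleDecomposition W) : ∃ f : Fin 4 → E7,
      W = Submodule.span ℝ (Set.range f) ∧
      fourFormC (cpx (f 0)) (cpx (f 1)) (cpx (f 2)) (cpx (f 3)) = 0 := by
  obtain ⟨W₁, W₂, h1, h2, hort, rfl, hc⟩ := hW
  have hspan : ∀ {V : Submodule ℝ E7}, Module.finrank ℝ V = 2 →
      ∃ x ∈ V, ∃ y ∈ V, V = Submodule.span ℝ {x, y} := by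
    intro V hV
    let B := Module.finBasisOfFinrankEq ℝ V hV
    refine ⟨B 0, (B 0).2, B 1, (B 1).2, ?_⟩
    have h3 := congrArg (Submodule.map V.subtype) B.span_eq
    rw [Submodule.map_span, Submodule.map_top, Submodule.range_subtype, ← Set.range_comp] at h3
    refine h3.symm.trans ?_
    congr 1
    ext w
    simp [Fin.exists_fin_two, eq_comm]
  obtain ⟨x, hx, y, hy, e1⟩ := hspan h1
  obtain ⟨u, hu, v, hv, e2⟩ := hspan h2
  refine ⟨![x, y, u, v], ?_, ?_⟩
  · conv_lhs => rw [e1, e2]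
    rw [← Submodule.span_union]
    congr 1
    ext w
    simp only [Set.mem_union, Set.mem_insert_iff, Set.mem_singleton_iff, Set.mem_range,
      Fin.exists_fin_succ, eq_comm (b := w)]
    simp [or_assoc]
  · have hort' := Submodule.isOrtho_iff_inner_eq.1 hort
    simp only [Matrix.cons_val_zero, Matrix.cons_val_one, Matrix.cons_val]
    rw [fourFormC, crossC_cpx, crossC_cpx, dotC_cpx, hc x hx y hy u hu v hv, dotC_cpx, dotC_cpx,
      dotC_cpx, dotC_cpx, hort' x hx u hu, hort' y hy u hu]
    simp

/-- Projection onto the orthogonal complement of `L` is complex linear, hence commutes with the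
derivative, and annihilates `f` near `z`. -/
lemma wirt_mem {L : Submodule ℂ C7} {f : ℂ → C7} {z : ℂ} (σ : ℂ) (hf : DifferentiableAt ℝ f z)
    (h : ∀ᶠ w in nhds z, f w ∈ L) : wirt σ f z ∈ L := by
  have h1 := wirt_clm Lᗮ.starProjection σ hf
  have h2 : ∀ w, Lᗮ.starProjection w = 0 ↔ w ∈ L := fun w => by
    rw [Submodule.starProjection_apply_eq_zero_iff, Submodule.orthogonal_orthogonal]
  rw [← h2, ← h1]
  exact wirt_eq_zero_of_eventually_const σ 0 (h.mono fun w hw => (h2 _).2 hw)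

lemma IsMinimalChart.mem_of_forall_mem {Ω : Set ℂ} {P : ℂ → C7} (H : IsMinimalChart Ω P)
    {L : Submodule ℂ C7} (h : ∀ z ∈ Ω, P z ∈ L) {z : ℂ} (hz : z ∈ Ω) :
    dz P z ∈ L ∧ dzb P z ∈ L ∧ secondSection P z ∈ L := by
  have h1 : ∀ σ, ∀ w ∈ Ω, wirt σ P w ∈ L := fun σ w hw =>
    wirt_mem σ (H.diff hw) ((H.eventually hw).mono h)
  refine ⟨h1 _ z hz, h1 _ z hz, L.sub_mem ?_ (L.smul_mem _ (h1 _ z hz))⟩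
  exact wirt_mem _ (H.diff_wirt hz _) ((H.eventually hz).mono (h1 _))

/-- Five orthogonal vectors do not fit into a space of dimension `4`. -/
lemma IsMinimalChart.dotC_secondSection_self_ne_zero {Ω : Set ℂ} {P : ℂ → C7}
    (H : IsMinimalChart Ω P) {f : Fin 4 → E7}
    (h : ∀ z ∈ Ω, P z ∈ Submodule.span ℂ (Set.range fun i => cpx (f i))) {z : ℂ} (hz : z ∈ Ω)
    (hs : secondSection P z ≠ 0) : dotC (secondSection P z) (secondSection P z) ≠ 0 := by
  intro h0
  set L := Submodule.span ℂ (Set.range fun i => cpx (f i)) with hL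
  have hconj : ∀ x ∈ L, conjC x ∈ L := by
    intro x hx
    induction hx using Submodule.span_induction with
    | mem x hx =>
      obtain ⟨i, rfl⟩ := hx
      rw [conjC_cpx]
      exact Submodule.subset_span ⟨i, rfl⟩
    | zero => rw [conjC_zero]; exact L.zero_mem
    | add x y _ _ hx hy => rw [conjC_add]; exact L.add_mem hx hy
    | smul c x _ hx => rw [conjC_smul]; exact L.smul_mem _ hx
  obtain ⟨ha, hb, hsL⟩ := H.mem_of_forall_mem h hz
  have F := H.frame hz
  have sp := H.dot_secondSection hz
  have sa := H.dz_dot_secondSection hz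
  have sb := H.dzb_dot_secondSection hz
  set p := P z
  set a := dz P z
  set b := dzb P z
  set s := secondSection P z
  have tp : dotC p (conjC s) = 0 := by rw [← F.conj_p, dotC_conjC, sp, map_zero]
  have ta : dotC a (conjC s) = 0 := by rw [← F.conj_b, dotC_conjC, sb, map_zero]
  have tb : dotC b (conjC s) = 0 := by rw [← F.conj_a, dotC_conjC, sa, map_zero]
  have tt : dotC (conjC s) (conjC s) = 0 := by rw [dotC_conjC, h0, map_zero]
  have hp0 : p ≠ 0 := fun h => by have := F.pp; rw [h] at this; simp at this
  have ha0 : a ≠ 0 := fun h => F.ne (by rw [← F.ab, h, dotC_zero_left])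
  have hb0 : b ≠ 0 := fun h => F.ne (by rw [← F.ab, h, dotC_zero_right])
  have ht0 : conjC s ≠ 0 := fun h => hs (by rw [← conjC_conjC s, h, conjC_zero])
  -- The assumption `⟨s, s⟩ = 0` is what makes `s` and its conjugate Hermitian orthogonal; the other
  -- relations hold for any minimal surface.
  have hli : LinearIndependent ℂ ![p, a, b, s, conjC s] := by
    refine linearIndependent_of_ne_zero_of_inner_eq_zero (𝕜 := ℂ) (fun i => ?_) fun i j hij => ?_
    · fin_cases i <;> simpa
    · change inner ℂ _ _ = 0
      rw [inner_eq_dotC]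
      have c1 := F.conj_p
      have c2 := F.conj_a
      have c3 := F.conj_b
      fin_cases i <;> fin_cases j <;>
        first
        | exact absurd rfl hij
        | simp [c1, c2, c3, F.pa, F.pb, F.aa, F.bb, F.ap, F.bp, sp, sa, sb, tp, ta, tb, h0, tt,
            dotC_comm s p, dotC_comm s a, dotC_comm s b, dotC_comm (conjC s) p,
            dotC_comm (conjC s) a, dotC_comm (conjC s) b]
  have h5 := finrank_span_eq_card hli
  have hle : Submodule.span ℂ (Set.range ![p, a, b, s, conjC s]) ≤ L := by
    rw [Submodule.span_le]
    rintro _ ⟨i, rfl⟩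
    fin_cases i
    · exact h z hz
    · exact ha
    · exact hb
    · exact hsL
    · exact hconj _ hsL
  have h6 := Submodule.finrank_mono hle
  have h7 : Module.finrank ℂ L ≤ 4 :=
    (finrank_range_le_card (R := ℂ) fun i => cpx (f i)).trans (by simp)
  rw [h5] at h6
  simp at h6
  omega

/-! ### The two implications on the surface -/

section Surfaces

variable {S : Type*} [TopologicalSpace S] [ChartedSpace ℂ S] [IsManifold 𝓘(ℂ, ℂ) ω S]
  {φ F : S → E7}

lemma pseudoUmbilical_of_superconformal (hφ : IsConformalHarmonicImmersion φ)
    (hF : IsAssociatedSurface φ F) {W : Submodule ℝ E7} (hfin : Module.finrank ℝ W = 4)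
    (hW : HasCrossCompatibleDecomposition W) (hs : IsSuperconformalIn φ W) :
    IsPseudoUmbilical F ∧ ¬ HasParallelMeanCurvature F := by
  obtain ⟨f, rfl, hf⟩ := hW.exists_family
  obtain ⟨hφW, n, hn, hiso⟩ := hs
  obtain rfl : n = 3 := by omega
  have hmem : ∀ q, cpx (φ q) ∈ Submodule.span ℂ (Set.range fun i => cpx (f i)) := by
    intro q
    have h1 := Submodule.mem_map_of_mem (f := cpx.toLinearMap) (hφW q)
    rw [Submodule.map_span, ← Set.range_comp] at h1
    exact Submodule.span_le_restrictScalars ℝ ℂ _ h1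
  have hN : ∀ e ∈ atlas ℂ S, ∀ z ∈ e.target,
      dotC (crossC (cpx (φ (e.symm z))) (meanField (fun z => cpx (φ (e.symm z))) z))
        (secondSection (fun z => cpx (φ (e.symm z))) z) = 0 := by
    intro e he z hz
    have H := hφ.isMinimalChart he
    obtain ⟨ha, hb, hs⟩ := H.mem_of_forall_mem (fun w _ => hmem (e.symm w)) hz
    -- As `P` stays in the complexification of `W`, so do its derivatives and `f₂`; the four-form
    -- vanishes on them, and its value is a nonzero multiple of `⟨N, f₂⟩`.
    have h4 := fourFormC_eq_zero_of_mem_span (f := fun i => cpx (f i)) hf (hmem (e.symm z)) ha hb hs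
    rw [(H.frame hz).fourFormC_eq (H.dz_dot_secondSection hz)] at h4
    exact (mul_eq_zero.1 h4).resolve_left
      (neg_ne_zero.2 (mul_ne_zero I_ne_zero (H.frame hz).ne))
  constructor
  · refine ⟨fun _ => 1, contMDiff_const, fun e he z hz i j => ?_⟩
    exact (hφ.isAssociatedChart hF he).umbilical_of_dotC_eq_zero hz (hN e he z hz) i j
  · intro hpar
    obtain ⟨e, he, z, hz, hs⟩ := hφ.exists_secondSection_ne_zero hiso
    exact (hφ.isMinimalChart he).dotC_secondSection_self_ne_zero (fun w _ => hmem (e.symm w)) hz hs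
      ((hφ.isAssociatedChart hF he).dotC_secondSection_self_eq_zero hz (hN e he z hz)
        (hpar e he z hz))

lemma exists_superconformal_of_pseudoUmbilical [ConnectedSpace S]
    (hφ : IsConformalHarmonicImmersion φ) (hF : IsAssociatedSurface φ F)
    (hPU : IsPseudoUmbilical F) (hNP : ¬ HasParallelMeanCurvature F) :
    ∃ W : Submodule ℝ E7, Module.finrank ℝ W = 4 ∧
        HasCrossCompatibleDecomposition W ∧ IsSuperconformalIn φ W := by
  obtain ⟨lam, -, hlam⟩ := hPU
  simp only [HasParallelMeanCurvature, not_forall] at hNP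
  obtain ⟨e, he, z₁, hz₁, v, hv⟩ := hNP
  have K := hφ.isAssociatedChart hF he
  have H := hφ.isMinimalChart he
  set P : ℂ → C7 := fun z => cpx (φ (e.symm z)) with hP
  have hN : ∀ w ∈ e.target, dotC (crossC (P w) (meanField P w)) (secondSection P w) = 0 :=
    fun w hw => K.dotC_eq_zero_of_umbilical hw (hlam e he w hw)
  obtain ⟨U, hUΩ, hU, ⟨z, hzU⟩, hprop⟩ := H.exists_open_conj_proportional hN hz₁
    fun h => hv (K.parallel_of_cross_eq_zero hz₁ h v)
  obtain ⟨r, hr, hrU, hball⟩ := H.exists_ball_dotC_eq_zero hU hUΩ hprop hzU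
  have hz := hUΩ hzU
  have Fr := H.frame hz
  obtain ⟨hg, hg2⟩ := hprop z hzU
  have hNz := hN z hz
  have sp := H.dot_secondSection hz
  have sa := H.dz_dot_secondSection hz
  have sb := H.dzb_dot_secondSection hz
  have hm : meanField P z = meanVec (dz P z) (dzb P z) (confFactor P z) := rfl
  set a := dz P z
  set b := dzb P z
  set s := secondSection P z
  set g := dotC (meanField P z) s with hgdef
  have hgc : dotC (meanField P z) (conjC s) = starRingEnd ℂ g := by
    rw [hgdef, ← dotC_conjC, hm, Fr.conj_mean]
  rw [hgc] at hg2
  have hg' : starRingEnd ℂ g ≠ 0 := (map_ne_zero _).2 hg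
  have hs0 : s ≠ 0 := fun h => hg (by rw [hgdef, h, dotC_zero_right])
  -- the real vectors spanning `W`
  obtain ⟨x, hx⟩ : ∃ x : E7, cpx x = a + b :=
    ⟨_, cpx_reC (by rw [conjC_add, Fr.conj_a, Fr.conj_b, add_comm])⟩
  obtain ⟨y, hy⟩ : ∃ y : E7, cpx y = I • (a - b) :=
    ⟨_, cpx_reC (by rw [conjC_smul, conjC_sub, Fr.conj_a, Fr.conj_b, conj_I]; module)⟩
  -- The proportionality `g s̄ = ḡ s` says precisely that `ḡ s` is fixed by conjugation.
  obtain ⟨n, hn⟩ : ∃ n : E7, cpx n = starRingEnd ℂ g • s :=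
    ⟨_, cpx_reC (by rw [conjC_smul, RingHomCompTriple.comp_apply, RingHom.id_apply, hg2])⟩
  have hn0 : n ≠ 0 := fun h => by
    rw [h, map_zero, eq_comm, smul_eq_zero] at hn
    exact hn.elim hg' hs0
  have hx0 : x ≠ 0 := fun h => by
    have h1 : dotC (cpx x) (cpx x) = 2 * confFactor P z := by
      rw [hx, dotC_add_left, dotC_add_right, dotC_add_right, Fr.aa, Fr.ab, Fr.ba, Fr.bb]; ring
    rw [h, map_zero, dotC_zero_left] at h1
    exact Fr.ne (by linear_combination (-1 / 2 : ℂ) * h1)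
  have hy0 : y ≠ 0 := fun h => by
    have h1 : dotC (cpx y) (cpx y) = 2 * confFactor P z := by
      rw [hy, dotC_smul_left, dotC_smul_right, dotC_sub_left, dotC_sub_right, dotC_sub_right, Fr.aa,
        Fr.ab, Fr.ba, Fr.bb]
      linear_combination (-2 * confFactor P z) * I_sq
    rw [h, map_zero, dotC_zero_left] at h1
    exact Fr.ne (by linear_combination (-1 / 2 : ℂ) * h1)
  have hp0 : φ (e.symm z) ≠ 0 := fun h => by
    have := H.sphere z hz
    simp [hP, h] at this
  have real : ∀ {u v : E7}, dotC (cpx u) (cpx v) = 0 → ⟪u, v⟫ = 0 := fun h => by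
    rw [dotC_cpx] at h; exact ofReal_eq_zero.1 h
  have hpa : dotC (cpx (φ (e.symm z))) a = 0 := Fr.pa
  have hpb : dotC (cpx (φ (e.symm z))) b = 0 := Fr.pb
  have hps : dotC (cpx (φ (e.symm z))) s = 0 := sp
  -- The planes are spanned by `φ, x` and by `y, n`. With `x = a + b` and `y = i(a - b)`, the
  -- product expands into values of the four-form on `P, s` and two of `a, b`. Those with a repeated
  -- entry vanish by alternation, the mixed ones by umbilicity.
  have hcross : ⟪cross (φ (e.symm z)) x, cross y n⟫ = 0 := by
    apply real
    have h1 : fourFormC (cpx (φ (e.symm z))) a b s = 0 := by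
      have := Fr.fourFormC_eq sa
      rw [show crossC (P z) (meanVec a b (confFactor P z)) = crossC (P z) (meanField P z) from rfl,
        hNz, mul_zero] at this
      exact this
    have h2 := fourFormC_swap₂ (cpx (φ (e.symm z))) a b s
    have h3 := fourFormC_swap₂ (cpx (φ (e.symm z))) a a s
    have h4 := fourFormC_swap₂ (cpx (φ (e.symm z))) b b s
    rw [h1, neg_zero] at h2
    simp only [fourFormC, hpa, hpb, hps] at h1 h2 h3 h4
    rw [← crossC_cpx, ← crossC_cpx, hx, hy, hn]
    simp only [crossC_add_right, crossC_smul_left, crossC_smul_right, crossC_sub_left, dotC_add_left,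
      dotC_smul_right, dotC_sub_right]
    linear_combination starRingEnd ℂ g * I * (-h1 + h2 + (1 / 2 : ℂ) * h3 - (1 / 2 : ℂ) * h4)
  obtain ⟨hfin, hdec⟩ := hasCrossCompatibleDecomposition_span hp0 hx0 hy0 hn0
    (real (by rw [hx, dotC_add_right, hpa, hpb, add_zero]))
    (real (by rw [hy, dotC_smul_right, dotC_sub_right, hpa, hpb, sub_zero, mul_zero]))
    (real (by rw [hn, dotC_smul_right, hps, mul_zero]))
    (real (by rw [hx, hy, dotC_smul_right, dotC_sub_right, dotC_add_left, dotC_add_left, Fr.aa,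
      Fr.ab, Fr.ba, Fr.bb]; ring))
    (real (by rw [hx, hn, dotC_smul_right, dotC_add_left, sa, sb, add_zero, mul_zero]))
    (real (by rw [hy, hn, dotC_smul_right, dotC_smul_left, dotC_sub_left, sa, sb]; ring)) hcross
  have hss : dotC s s ≠ 0 := fun h => hn0 (by
    have : dotC (cpx n) (cpx n) = 0 := by
      rw [hn, dotC_smul_left, dotC_smul_right, h, mul_zero, mul_zero]
    exact inner_self_eq_zero.1 (real this))
  refine ⟨_, hfin, hdec, fun q => ?_, 3, hfin, hφ.hasIsotropyOrder_three he hz hss⟩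
  -- Membership in `W` is tested against each real `u` normal to it. Such a `u` annihilates `P, a,
  -- s` at `z`, so `⟨u, φ⟩` vanishes on a disc and then everywhere by unique continuation.
  rw [← Submodule.orthogonal_orthogonal (_ ⊔ _), Submodule.mem_orthogonal]
  intro u hu
  have hu' : ∀ w ∈ ({φ (e.symm z), x} ∪ {y, n} : Set E7), dotC (cpx u) (cpx w) = 0 := by
    intro w hw
    rw [← Submodule.span_union] at hu
    rw [dotC_cpx, real_inner_comm, (Submodule.mem_orthogonal _ _).1 hu w (Submodule.subset_span hw),
      ofReal_zero]
  have hux := hu' x (by simp)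
  have huy := hu' y (by simp)
  have hun := hu' n (by simp)
  rw [hx, dotC_add_right] at hux
  rw [hy, dotC_smul_right, dotC_sub_right, mul_eq_zero, or_iff_right I_ne_zero] at huy
  rw [hn, dotC_smul_right, mul_eq_zero, or_iff_right hg'] at hun
  have hua : dotC (cpx u) a = 0 := by linear_combination (1 / 2 : ℂ) * (hux + huy)
  have hzero := hball (cpx u) (conjC_cpx u) (hu' _ (by simp)) hua hun
  refine hφ.inner_eq_zero_of_eventually (p := e.symm z) ?_ q
  have hsrc := e.map_target hz
  have hcont : Filter.Tendsto e (nhds (e.symm z)) (nhds z) := by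
    have := e.continuousAt hsrc
    rwa [ContinuousAt, e.right_inv hz] at this
  filter_upwards [hcont.eventually (Metric.ball_mem_nhds z hr), e.open_source.mem_nhds hsrc]
    with c hc hce
  have h1 := hzero (e c) hc
  apply real
  simpa [hP, e.left_inv hce] using h1

end Surfaces

end SixSphere

theorem mainTheorem3 {S : Type*} [TopologicalSpace S] [T2Space S] [ConnectedSpace S]
    [ChartedSpace ℂ S] [IsManifold 𝓘(ℂ, ℂ) ω S]
    (φ F : S → SixSphere.E7)
    (hφ : SixSphere.IsConformalHarmonicImmersion φ)
    (hF : SixSphere.IsAssociatedSurface φ F) :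
    (SixSphere.IsPseudoUmbilical F ∧ ¬ SixSphere.HasParallelMeanCurvature F →
      (∃ W : Submodule ℝ SixSphere.E7, Module.finrank ℝ W = 5 ∧
        SixSphere.IsFullIn φ W ∧ SixSphere.IsSuperminimal φ) ∨
      (∃ W : Submodule ℝ SixSphere.E7, Module.finrank ℝ W = 5 ∧
        SixSphere.IsFullIn φ W ∧ SixSphere.HasIsotropyOrder φ 3) ∨
      (∃ W : Submodule ℝ SixSphere.E7, Module.finrank ℝ W = 4 ∧
        SixSphere.HasCrossCompatibleDecomposition W ∧ SixSphere.IsSuperconformalIn φ W)) ∧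
    ((∃ W : Submodule ℝ SixSphere.E7, Module.finrank ℝ W = 4 ∧
        SixSphere.HasCrossCompatibleDecomposition W ∧ SixSphere.IsSuperconformalIn φ W) →
      SixSphere.IsPseudoUmbilical F ∧ ¬ SixSphere.HasParallelMeanCurvature F) := by
  exact ⟨fun h => Or.inr (Or.inr
    (SixSphere.exists_superconformal_of_pseudoUmbilical hφ hF h.1 h.2)),
    fun ⟨_, hfin, hW, hs⟩ => SixSphere.pseudoUmbilical_of_superconformal hφ hF hfin hW hs⟩
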